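/- **Setting.** Let $d\ge 2$, let $E_d=\{\{x,y\}:x,y\in\mathbb Z^d,\ |x-y|=1\}$ be the nearest-neighbour bonds, and write $x\sim y$ if $\{x,y\}\in E_d$. Let $\Omega=(0,\infty)^{\mathbb R\times E_d}$ be the space of environments $\omega=(\omega_t(e))_{t\in\mathbb R,\,e\in E_d}$; put $\omega_t(x,y)=\omega_t(\{x,y\})$ if $x\sim y$ and $\omega_t(x,y)=0$ otherwise. For $(s,z)\in\mathbb R\times\mathbb Z^d$ let $(\tau_{s,z}\omega)_t(\{x,y\})=\omega_{t+s}(\{x+z,y+z\})$. Let $\mathcal F$ be a $\sigma$-algebra on $\Omega$ and $P$ a probability measure on $(\Omega,\mathcal F)$, with expectation $\mathbb E$, such that 1. for all $t\in\mathbb R$ and $e\in E_d$, $\omega_t(e)$ is a random variable (measurable up to a $P$-null set), $\mathbb E[\omega_t(e)]<\infty$ and $\mathbb E[\omega_t(e)^{-1}]<\infty$; 2. $P\circ\tau_{t,x}^{-1}=P$ for all $t,x$, and $P[A]\in\{0,1\}$ for every $A\in\mathcal F$ with $P[A\,\triangle\,\tau_{t,x}(A)]=0$ for all $t,x$; 3.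 for every $A\in\mathcal F$ the map $(\omega,t,x)\mapsto \mathbf 1_A(\tau_{t,x}\omega)$ is $\mathcal F\otimes\mathcal B(\mathbb R)\otimes\mathcal P(\mathbb Z^d)$-measurable. For $f:\mathbb Z^d\to\mathbb R$ let $(\mathcal L^\omega_tf)(x)=\sum_{y\sim x}\omega_t(x,y)(f(y)-f(x))$. Let $m(d\omega,dz)=\sum_{x\in\mathbb Z^d}\omega_0(0,x)\,P(d\omega)\otimes\delta_x(dz)$, and let $L^2_{\mathrm{pot}}$ be the closure in $L^2(m)$ of the gradients $D\phi(\omega,x)=\phi(\tau_{0,x}\omega)-\phi(\omega)$ of bounded measurable $\phi:\Omega\to\mathbb R$. A field $\Psi:\Omega\times\mathbb Z^d\to\mathbb R$ is the extension of $\psi\in L^2_{\mathrm{pot}}$ if for $P$-a.e. $\omega$, all $x\in\mathbb Z^d$ and every nearest-neighbour path $0=x_0,x_1,\dots,x_k=x$, one has $\Psi(\omega,x)=\sum_{i=1}^k\psi(\tau_{0,x_{i-1}}\omega,x_i-x_{i-1})$. Let $L^2_{\mathrm{cov}}$ be the set of measurable $\Psi:\Omega\times\mathbb Z^d\to\mathbb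 R$ with $\mathbb E\big[\sum_x\omega_0(0,x)\Psi(\omega,x)^2\big]<\infty$ such that for $P$-a.e. $\omega$, $\Psi(\tau_{0,x}\omega,y-x)=\Psi(\omega,y)-\Psi(\omega,x)$ for all $x,y\in\mathbb Z^d$. A function $\Phi_0=(\Phi_0^1,\dots,\Phi_0^d):\Omega\times\mathbb Z^d\to\mathbb R^d$ is said to *generate harmonic coordinates* if, for each $j$, $\Phi_0^j\in L^2_{\mathrm{cov}}$, $(\omega,x)\mapsto x^j-\Phi_0^j(\omega,x)$ is the extension of an element of $L^2_{\mathrm{pot}}$, and $$\Phi^j(\omega,t,x)=\Phi^j_0(\tau_{t,0}\omega,x)-\int_0^t\big(\mathcal L^\omega_s\Phi^j_0(\tau_{s,0}\omega,\cdot)\big)(0)\,ds$$ satisfies, for $P$-a.e. $\omega$: $\Phi^j(\omega,0,0)=0$, $t\mapsto\Phi^j(\omega,t,x)$ is locally absolutely continuous for every $x$, and for a.e. $t\in\mathbb R$ and all $x$ it is differentiable at $t$ with $\partial_t\Phi^j(\omega,t,x)+\mathcal L^\omega_t\Phi^j(\omega,t,\cdot)(x)=0$. The associated *corrector* is $\chi(\omega,t,x)=x-\Phi(\omega,t,x)\in\mathbb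 R^d$. Let $B(n)$ be the closed ball of radius $n$ around $0$ in the graph distance of $(\mathbb Z^d,E_d)$. **Proposition.** There exists a $\Phi_0$ that generates harmonic coordinates. Moreover, for every such $\Phi_0$, with corrector $\chi$, and for $P$-a.e. $\omega$, the function $t\mapsto|\chi(\omega,t,x)|$ is locally integrable for every $x\in\mathbb Z^d$ and $$\lim_{n\to\infty}\frac1{n^3}\int_0^{n^2}\frac1{|B(n)|}\sum_{x\in B(n)}|\chi(\omega,t,x)|\,dt=0 .$$ -/

import Mathlib

open MeasureTheory Filter Topology
open scoped ENNReal

/-! ### The lattice and the environments -/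

/-- The Euclidean lattice `(ℤ^d, E_d)`: nearest neighbours, `|x - y| = 1`. -/
def latticeGraph (d : ℕ) : SimpleGraph (Fin d → ℤ) where
  Adj x y := ∑ i, |x i - y i| = 1
  symm := ⟨fun x y h => by simpa only [abs_sub_comm] using h⟩
  loopless := ⟨fun x h => by simp at h⟩

/-- The closed ball `B(x, n)` of the graph distance (the `ℓ¹` distance) of the lattice. -/
noncomputable def latticeBall {d : ℕ} (x : Fin d → ℤ) (n : ℕ) : Finset (Fin d → ℤ) :=
  (Finset.Icc (fun i => x i - (n : ℤ)) (fun i => x i + (n : ℤ))).filter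
    (fun y => ∑ i, |y i - x i| ≤ (n : ℤ))

theorem mem_latticeBall {d : ℕ} (x y : Fin d → ℤ) (n : ℕ) :
    y ∈ latticeBall x n ↔ ∑ i, |y i - x i| ≤ (n : ℤ) := by
  simp only [latticeBall, Finset.mem_filter, Finset.mem_Icc, Pi.le_def, and_iff_right_iff_imp]
  intro h
  have key : ∀ i, |y i - x i| ≤ (n : ℤ) := fun i =>
    (Finset.single_le_sum (f := fun i => |y i - x i|) (fun j _ => abs_nonneg _)
      (Finset.mem_univ i)).trans h
  exact ⟨fun i => by have := abs_le.1 (key i); linarith,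
    fun i => by have := abs_le.1 (key i); linarith⟩

/-- The translation by `z`, acting on the edges. -/
def shiftEdge {d : ℕ} (z : Fin d → ℤ) : (latticeGraph d).edgeSet → (latticeGraph d).edgeSet :=
  SimpleGraph.Hom.mapEdgeSet
    ({ toFun := fun x => x + z
       map_rel' := fun {x y} h => by simpa [latticeGraph] using h } :
      latticeGraph d →g latticeGraph d)

/-- The space `Ω = (0, ∞)^(ℝ × E_d)` of space-time environments `ω_t(e)`.  It is a `def`, so that
no `σ`-algebra is attached to it. -/
def Env (d : ℕ) : Type := ℝ → (latticeGraph d).edgeSet → Set.Ioi (0 : ℝ)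

/-- The space-time shift `(τ_{s,z} ω)_t({x, y}) = ω_{t+s}({x + z, y + z})`. -/
def Env.shift {d : ℕ} (s : ℝ) (z : Fin d → ℤ) (ω : Env d) : Env d :=
  fun t e => ω (t + s) (shiftEdge z e)

open Classical in
/-- `ω_t(x, y)`: the conductance of `{x, y}` if this is an edge, and `0` otherwise. -/
noncomputable def Env.cond {d : ℕ} (ω : Env d) (t : ℝ) (x y : Fin d → ℤ) : ℝ :=
  if h : (latticeGraph d).Adj x y then (ω t ⟨s(x, y), h⟩ : ℝ) else 0

/-- The generator `(L_t^ω f)(x) = ∑_{y ∼ x} ω_t(x, y) (f(y) - f(x))`.  The unit ball consists of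
the neighbours of `x` and of `x` itself, which does not contribute. -/
noncomputable def Env.gen {d : ℕ} (ω : Env d) (t : ℝ) (f : (Fin d → ℤ) → ℝ) (x : Fin d → ℤ) : ℝ :=
  ∑ y ∈ latticeBall x 1, ω.cond t x y * (f y - f x)

/-- The standing assumption on the law `P` of the environment: integrability of the conductances
and of their inverses (`Integrable` contains measurability up to a `P`-null set), stationarity and
ergodicity under space-time shifts, and joint measurability of the shifts. -/
structure StationaryErgodicLaw {d : ℕ} [MeasurableSpace (Env d)] (P : Measure (Env d)) : Prop where
  integrable_cond : ∀ (t : ℝ) (e : (latticeGraph d).edgeSet),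
    Integrable (fun ω : Env d => (ω t e : ℝ)) P
  integrable_inv_cond : ∀ (t : ℝ) (e : (latticeGraph d).edgeSet),
    Integrable (fun ω : Env d => (ω t e : ℝ)⁻¹) P
  stationary : ∀ (t : ℝ) (x : Fin d → ℤ), P.map (Env.shift t x) = P
  ergodic : ∀ A : Set (Env d), MeasurableSet A →
    (∀ (t : ℝ) (x : Fin d → ℤ), P (symmDiff A (Env.shift t x '' A)) = 0) → P A = 0 ∨ P A = 1
  measurable_shift : ∀ A : Set (Env d), MeasurableSet A →
    Measurable (fun p : Env d × ℝ × (Fin d → ℤ) =>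
      A.indicator (fun _ => (1 : ℝ)) (Env.shift p.2.1 p.2.2 p.1))

/-! ### Potential fields and cocycles -/

/-- The measure `m(dω, dz) = ∑_x ω_0(0, x) P(dω) ⊗ δ_x(dz)`.  It is carried by the neighbours `z`
of the origin, hence may be considered on `Ω × ℤ^d`. -/
noncomputable def gradMeasure {d : ℕ} [MeasurableSpace (Env d)] (P : Measure (Env d)) :
    Measure (Env d × (Fin d → ℤ)) :=
  Measure.sum fun x : Fin d → ℤ =>
    (P.withDensity fun ω => ENNReal.ofReal (ω.cond 0 0 x)).prod (Measure.dirac x)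

/-- The horizontal gradient `D φ(ω, x) = φ(τ_{0,x} ω) - φ(ω)`. -/
def horizGrad {d : ℕ} (φ : Env d → ℝ) (p : Env d × (Fin d → ℤ)) : ℝ :=
  φ (p.1.shift 0 p.2) - φ p.1

/-- `L²_pot`: the closure in `L²(m)` of the gradients of the bounded measurable functions. -/
noncomputable def L2pot {d : ℕ} [MeasurableSpace (Env d)] (P : Measure (Env d)) :
    Set (Lp ℝ 2 (gradMeasure P)) :=
  closure {g | ∃ φ : Env d → ℝ, Measurable φ ∧ (∃ C : ℝ, ∀ ω, |φ ω| ≤ C) ∧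
    g =ᵐ[gradMeasure P] horizGrad φ}

/-- `Ψ` is the extension of `ψ`: for `P`-a.e. `ω` and every nearest-neighbour path
`0 = x_0, …, x_k = x`, one has `Ψ(ω, x) = ∑ ψ(τ_{0, x_{i-1}} ω, x_i - x_{i-1})`. -/
def IsExtension {d : ℕ} [MeasurableSpace (Env d)] (P : Measure (Env d))
    (ψ : Env d × (Fin d → ℤ) → ℝ) (Ψ : Env d → (Fin d → ℤ) → ℝ) : Prop :=
  ∀ᵐ ω ∂P, ∀ (x : Fin d → ℤ) (w : (latticeGraph d).Walk 0 x),
    Ψ ω x = (w.darts.map fun a => ψ (ω.shift 0 a.fst, a.snd - a.fst)).sum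

/-- `L²_cov`: random fields with the cocycle property and a finite norm. -/
structure IsL2Cov {d : ℕ} [MeasurableSpace (Env d)] (P : Measure (Env d))
    (Ψ : Env d → (Fin d → ℤ) → ℝ) : Prop where
  measurable : ∀ x, Measurable fun ω => Ψ ω x
  cocycle : ∀ᵐ ω ∂P, ∀ x y : Fin d → ℤ, Ψ (ω.shift 0 x) (y - x) = Ψ ω y - Ψ ω x
  norm_lt_top : ∫⁻ ω, ∑' x : Fin d → ℤ, ENNReal.ofReal (ω.cond 0 0 x * Ψ ω x ^ 2) ∂P < ∞

/-! ### Harmonic coordinates and the corrector -/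

/-- `Φ^j(ω, t, x) = Φ_0^j(τ_{t,0} ω, x) - ∫_0^t (L_s^ω Φ_0^j(τ_{s,0} ω, ·))(0) ds`. -/
noncomputable def harmonicCoord {d : ℕ} (Φ₀ : Fin d → Env d → (Fin d → ℤ) → ℝ) (j : Fin d)
    (ω : Env d) (t : ℝ) (x : Fin d → ℤ) : ℝ :=
  Φ₀ j (ω.shift t 0) x - ∫ s in (0 : ℝ)..t, ω.gen s (Φ₀ j (ω.shift s 0)) 0

/-- The corrector `χ(ω, t, x) = x - Φ(ω, t, x)`, a vector of the Euclidean space `ℝ^d`. -/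
noncomputable def corrector {d : ℕ} (Φ₀ : Fin d → Env d → (Fin d → ℤ) → ℝ)
    (ω : Env d) (t : ℝ) (x : Fin d → ℤ) : EuclideanSpace ℝ (Fin d) :=
  WithLp.toLp 2 fun j => (x j : ℝ) - harmonicCoord Φ₀ j ω t x

/-- `Φ_0` generates harmonic coordinates: its components are in `L²_cov`, the components of
`χ_0(ω, x) = x - Φ_0(ω, x)` are extensions of elements of `L²_pot`, and `Φ` solves
`∂_t Φ + L_t^ω Φ = 0`, `Φ(ω, 0, 0) = 0`, with trajectories that are locally absolutely continuous
in time (the equation for the classical derivative at a.e. time is then the weak equation). -/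
structure GeneratesHarmonicCoord {d : ℕ} [MeasurableSpace (Env d)] (P : Measure (Env d))
    (Φ₀ : Fin d → Env d → (Fin d → ℤ) → ℝ) : Prop where
  mem_cov : ∀ j, IsL2Cov P (Φ₀ j)
  potential : ∀ j, ∃ ψ ∈ L2pot P, IsExtension P ψ fun ω x => (x j : ℝ) - Φ₀ j ω x
  abs_cont : ∀ᵐ ω ∂P, ∀ (j : Fin d) (x : Fin d → ℤ) (a b : ℝ),
    AbsolutelyContinuousOnInterval (fun t => harmonicCoord Φ₀ j ω t x) a b
  harmonic : ∀ᵐ ω ∂P, ∀ᵐ t : ℝ, ∀ (j : Fin d) (x : Fin d → ℤ),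
    HasDerivAt (fun s => harmonicCoord Φ₀ j ω s x) (-ω.gen t (harmonicCoord Φ₀ j ω t) x) t
  zero : ∀ᵐ ω ∂P, ∀ j, harmonicCoord Φ₀ j ω 0 0 = 0

/-! ### Space-time shifts -/

/-! Sublinearity. Let X(x, t) be a component of the corrector, viewed on a parabolic cylinder of
size 2^k in space and 4^k in time. In space, X(·, t) has for a.e. t the stationary gradient ψ ∘ τ, a
limit in L²(m) of gradients of bounded functions. Since E[1/ω] is finite, closeness in L²(m) gives
closeness of the components in L¹(P). The bounded function oscillates by O(1). By the ℓ¹ Poincaré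
inequality, the remainder oscillates by 2^k times a space-time average of a stationary function of
small mean, and Wiener's maximal inequality makes such averages small at all scales at once
(`spatial_oscillation`). In time, X(x, ·) moves by the integrated drift, which is the discrete
divergence of an integrable stationary flux. X is averaged twice over a box of side of order 2^k.
The inner average turns the time integral of the centred flux into o(4^k) by the ergodic theorem;
the outer one telescopes the divergence to the boundary and gains 2^(-k). The total is o(2^k)
(`temporal_oscillation`). Hence X is within o(2^k), on average, of a constant depending on k.
Comparing consecutive scales on the smaller cylinder, these constants have increments o(2^k), so
they are o(2^k) themselves (`eventually_integral_le_of_oscillation`).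

The ergodic theorem is proved in a form uniform in translations of the box and in shorter time
intervals. It is clear for bounded coboundaries, survives L¹ limits by the maximal inequality, and
reaches all centred functions because a function in L² orthogonal to the coboundaries is invariant,
hence constant.

Existence. The equation for a potential field u is tested against gradients of divergences of
functions that are differentiable in time. Stationarity makes the time derivative antisymmetric, so
the bilinear form is coercive on test functions, and Lions' lemma gives a weak solution
(`exists_weak_solution`). Summation by parts identifies the weak time derivative of each spatial
increment with an increment of the drift, which integrates to an identity along almost every
trajectory at almost all times (`ae_ae_cocycle_shift_eq`). Right time averages then select a version
for which the identity holds at all times (`exists_regular_version`). -/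

theorem shiftEdge_mk {d : ℕ} (z x y : Fin d → ℤ) (h : (latticeGraph d).Adj x y)
    (h' : (latticeGraph d).Adj (x + z) (y + z)) :
    shiftEdge z ⟨s(x, y), h⟩ = ⟨s(x + z, y + z), h'⟩ := rfl

theorem latticeGraph_adj_add {d : ℕ} (x y z : Fin d → ℤ) :
    (latticeGraph d).Adj (x + z) (y + z) ↔ (latticeGraph d).Adj x y := by
  simp [latticeGraph]

theorem shiftEdge_shiftEdge {d : ℕ} (x y : Fin d → ℤ) (e : (latticeGraph d).edgeSet) :
    shiftEdge y (shiftEdge x e) = shiftEdge (x + y) e := by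
  obtain ⟨e, he⟩ := e
  induction e using Sym2.ind with
  | _ a b =>
    have he' : (latticeGraph d).Adj a b := he
    have h1 := (latticeGraph_adj_add a b x).2 he'
    rw [shiftEdge_mk x a b he' h1, shiftEdge_mk y _ _ h1 ((latticeGraph_adj_add _ _ y).2 h1),
      shiftEdge_mk (x + y) a b he' ((latticeGraph_adj_add _ _ _).2 he')]
    simp only [add_assoc]

theorem shiftEdge_zero {d : ℕ} (e : (latticeGraph d).edgeSet) : shiftEdge 0 e = e := by
  obtain ⟨e, he⟩ := e
  induction e using Sym2.ind with
  | _ a b =>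
    rw [shiftEdge_mk 0 a b he ((latticeGraph_adj_add _ _ _).2 he)]
    simp only [add_zero]

namespace Env

theorem shift_shift {d : ℕ} (s t : ℝ) (x y : Fin d → ℤ) (ω : Env d) :
    (ω.shift t y).shift s x = ω.shift (s + t) (x + y) := by
  funext r e
  simp only [shift, shiftEdge_shiftEdge, add_assoc]

@[simp]
theorem shift_zero {d : ℕ} (ω : Env d) : ω.shift 0 0 = ω := by
  funext r e
  simp only [shift, shiftEdge_zero, add_zero]

theorem cond_shift {d : ℕ} (ω : Env d) (s t : ℝ) (x y z : Fin d → ℤ) :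
    (ω.shift s z).cond t x y = ω.cond (t + s) (x + z) (y + z) := by
  unfold cond
  by_cases h : (latticeGraph d).Adj x y
  · rw [dif_pos h, dif_pos ((latticeGraph_adj_add x y z).2 h)]
    rfl
  · rw [dif_neg h, dif_neg (fun h' => h ((latticeGraph_adj_add x y z).1 h'))]

theorem cond_comm {d : ℕ} (ω : Env d) (t : ℝ) (x y : Fin d → ℤ) :
    ω.cond t x y = ω.cond t y x := by
  unfold cond
  by_cases h : (latticeGraph d).Adj x y
  · rw [dif_pos h, dif_pos h.symm]
    congr 3
    exact Sym2.eq_swap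
  · rw [dif_neg h, dif_neg (fun h' => h h'.symm)]

theorem cond_nonneg {d : ℕ} (ω : Env d) (t : ℝ) (x y : Fin d → ℤ) : 0 ≤ ω.cond t x y := by
  unfold cond
  split_ifs with h
  · exact (ω t _).2.le
  · exact le_rfl

theorem cond_pos {d : ℕ} (ω : Env d) (t : ℝ) {x y : Fin d → ℤ} (h : (latticeGraph d).Adj x y) :
    0 < ω.cond t x y := by
  unfold cond
  rw [dif_pos h]
  exact (ω t _).2

theorem cond_eq_zero {d : ℕ} (ω : Env d) (t : ℝ) {x y : Fin d → ℤ}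
    (h : ¬ (latticeGraph d).Adj x y) : ω.cond t x y = 0 := by
  unfold cond
  rw [dif_neg h]

theorem gen_eq_sum {d : ℕ} (ω : Env d) (t : ℝ) (f : (Fin d → ℤ) → ℝ) (x : Fin d → ℤ) :
    ω.gen t f x = ∑ z ∈ latticeBall 0 1, ω.cond t x (x + z) * (f (x + z) - f x) := by
  unfold gen
  refine (Finset.sum_bij (fun z _ => x + z) ?_ ?_ ?_ ?_).symm
  · intro z hz
    rw [mem_latticeBall] at hz ⊢
    simpa using hz
  · intro a _ b _ h
    exact add_left_cancel h
  · intro y hy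
    refine ⟨y - x, ?_, by simp⟩
    rw [mem_latticeBall] at hy ⊢
    simpa using hy
  · intro z _
    rfl

/-- The ergodicity hypothesis speaks of images under shifts, whereas measurability and invariance
are handled through preimages. -/
theorem shift_image {d : ℕ} (s : ℝ) (z : Fin d → ℤ) (A : Set (Env d)) :
    shift s z '' A = shift (-s) (-z) ⁻¹' A := by
  ext ω
  constructor
  · rintro ⟨ω', h, rfl⟩
    simpa [shift_shift] using h
  · intro h
    exact ⟨_, h, by simp [shift_shift]⟩

end Env

theorem mem_latticeBall_zero_one {d : ℕ} {z : Fin d → ℤ} (h : (latticeGraph d).Adj 0 z) :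
    z ∈ latticeBall 0 1 := by
  rw [mem_latticeBall]
  simp only [latticeGraph, Pi.zero_apply, zero_sub, abs_neg] at h
  simp [h]

theorem latticeGraph_adj_single {d : ℕ} (i : Fin d) :
    (latticeGraph d).Adj 0 (Pi.single i 1) := by
  simp only [latticeGraph, Pi.zero_apply, zero_sub, abs_neg]
  rw [Finset.sum_eq_single i]
  · simp
  · intro j _ hj
    simp [hj]
  · simp

/-! ### Stationarity: null sets and integrals along trajectories -/

namespace StationaryErgodicLaw

variable {d : ℕ} [MeasurableSpace (Env d)] {P : Measure (Env d)}

theorem measurable_shift_joint (hP : StationaryErgodicLaw P) :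
    Measurable (fun p : Env d × ℝ × (Fin d → ℤ) => Env.shift p.2.1 p.2.2 p.1) := by
  intro A hA
  have h := hP.measurable_shift A hA (measurableSet_singleton (1 : ℝ))
  convert! h using 1
  ext p
  by_cases hp : Env.shift p.2.1 p.2.2 p.1 ∈ A <;> simp [hp]

theorem measurable_shift_time (hP : StationaryErgodicLaw P) (x : Fin d → ℤ) :
    Measurable (fun p : Env d × ℝ => Env.shift p.2 x p.1) :=
  hP.measurable_shift_joint.comp
    (measurable_fst.prodMk (measurable_snd.prodMk measurable_const))

theorem measurable_shift_fixed (hP : StationaryErgodicLaw P) (t : ℝ) (x : Fin d → ℤ) :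
    Measurable (Env.shift t x) :=
  (hP.measurable_shift_time x).comp (measurable_id.prodMk measurable_const)

theorem measurable_shift_path (hP : StationaryErgodicLaw P) (ω : Env d) (x : Fin d → ℤ) :
    Measurable (fun t : ℝ => ω.shift t x) :=
  (hP.measurable_shift_time x).comp (measurable_const.prodMk measurable_id)

theorem measurePreserving (hP : StationaryErgodicLaw P) (t : ℝ) (x : Fin d → ℤ) :
    MeasurePreserving (Env.shift t x) P P :=
  ⟨hP.measurable_shift_fixed t x, hP.stationary t x⟩

/-- By stationarity every time section of the preimage of `A` has probability `P A`. This transfers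
null sets and integrability from `P` to the product with a time interval. -/
theorem map_prod_shift [IsProbabilityMeasure P] (hP : StationaryErgodicLaw P) (x : Fin d → ℤ)
    (I : Set ℝ) :
    (P.prod (volume.restrict I)).map (fun p => Env.shift p.2 x p.1) = volume I • P := by
  ext A hA
  rw [Measure.map_apply (hP.measurable_shift_time x) hA,
    Measure.prod_apply_symm (hP.measurable_shift_time x hA)]
  have : ∀ t : ℝ, P ((fun ω => (ω, t)) ⁻¹' ((fun p : Env d × ℝ => Env.shift p.2 x p.1) ⁻¹' A))
      = P A := fun t => (hP.measurePreserving t x).measure_preimage hA.nullMeasurableSet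
  simp [this, mul_comm]

theorem quasiMeasurePreserving_time [IsProbabilityMeasure P] (hP : StationaryErgodicLaw P)
    (x : Fin d → ℤ) :
    Measure.QuasiMeasurePreserving (fun p : Env d × ℝ => Env.shift p.2 x p.1)
      (P.prod volume) P := by
  refine ⟨hP.measurable_shift_time x, ?_⟩
  have := hP.map_prod_shift x Set.univ
  rw [Measure.restrict_univ] at this
  rw [this]
  exact Measure.smul_absolutelyContinuous

theorem ae_shift (hP : StationaryErgodicLaw P) {p : Env d → Prop} (h : ∀ᵐ ω ∂P, p ω) :
    ∀ᵐ ω ∂P, ∀ x, p (ω.shift 0 x) :=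
  ae_all_iff.2 fun x => (hP.measurePreserving 0 x).quasiMeasurePreserving.ae h

/-- Times are uncountable, so a property that holds almost surely passes to the shifted environments
only at almost every time. This is why the equation is first obtained at a.e. time. -/
theorem ae_ae_shift [IsProbabilityMeasure P] (hP : StationaryErgodicLaw P) {p : Env d → Prop}
    (h : ∀ᵐ ω ∂P, p ω) : ∀ᵐ ω ∂P, ∀ᵐ t : ℝ, ∀ x, p (ω.shift t x) := by
  have : ∀ x, ∀ᵐ ω ∂P, ∀ᵐ t : ℝ, p (ω.shift t x) := fun x =>
    Measure.ae_ae_of_ae_prod ((hP.quasiMeasurePreserving_time x).ae h)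
  filter_upwards [ae_all_iff.2 this] with ω hω
  exact ae_all_iff.2 hω

theorem integrable_comp_shift (hP : StationaryErgodicLaw P) {F : Env d → ℝ}
    (hF : Integrable F P) (t : ℝ) (x : Fin d → ℤ) :
    Integrable (fun ω => F (ω.shift t x)) P :=
  (hP.measurePreserving t x).integrable_comp_of_integrable hF

theorem integral_comp_shift (hP : StationaryErgodicLaw P) {F : Env d → ℝ}
    (hF : AEStronglyMeasurable F P) (t : ℝ) (x : Fin d → ℤ) :
    ∫ ω, F (ω.shift t x) ∂P = ∫ ω, F ω ∂P := by
  rw [← integral_map (hP.measurable_shift_fixed t x).aemeasurable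
    (by rwa [hP.stationary t x]), hP.stationary t x]

theorem integrable_prod_shift [IsProbabilityMeasure P] (hP : StationaryErgodicLaw P)
    {F : Env d → ℝ} (hF : Integrable F P) (x : Fin d → ℤ) {I : Set ℝ} (hI : volume I ≠ ∞) :
    Integrable (fun p : Env d × ℝ => F (p.1.shift p.2 x)) (P.prod (volume.restrict I)) := by
  have h : Integrable F ((P.prod (volume.restrict I)).map (fun p => Env.shift p.2 x p.1)) := by
    rw [hP.map_prod_shift x I]
    exact hF.smul_measure hI
  exact (integrable_map_measure h.aestronglyMeasurable
    (hP.measurable_shift_time x).aemeasurable).1 h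

theorem ae_intervalIntegrable [IsProbabilityMeasure P] (hP : StationaryErgodicLaw P)
    {F : Env d → ℝ} (hF : Integrable F P) :
    ∀ᵐ ω ∂P, ∀ (x : Fin d → ℤ) (a b : ℝ),
      IntervalIntegrable (fun t => F (ω.shift t x)) volume a b := by
  have h1 : ∀ (x : Fin d → ℤ) (n : ℕ), ∀ᵐ ω ∂P,
      IntegrableOn (fun t => F (ω.shift t x)) (Set.Icc (-(n : ℝ)) n) volume := fun x n =>
    (hP.integrable_prod_shift hF x (I := Set.Icc (-(n : ℝ)) n) (by simp)).prod_right_ae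
  filter_upwards [ae_all_iff.2 fun x => ae_all_iff.2 (h1 x)] with ω hω x a b
  obtain ⟨n, hn⟩ := exists_nat_ge (max |a| |b|)
  have ha := abs_le.1 ((le_max_left _ _).trans hn)
  have hb := abs_le.1 ((le_max_right _ _).trans hn)
  rw [intervalIntegrable_iff]
  refine (hω x n).mono_set fun t ht => ?_
  rw [Set.mem_uIoc] at ht
  rw [Set.mem_Icc]
  rcases ht with ht | ht <;> constructor <;> linarith [ht.1, ht.2, ha.1, ha.2, hb.1, hb.2]

theorem intervalIntegrable_of_bounded (hP : StationaryErgodicLaw P) {g : Env d → ℝ}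
    (hg : Measurable g) {C : ℝ} (hC : ∀ ω, |g ω| ≤ C) (ω : Env d) (x : Fin d → ℤ) (a b : ℝ) :
    IntervalIntegrable (fun t => g (ω.shift t x)) volume a b := by
  rw [intervalIntegrable_iff]
  refine Measure.integrableOn_of_bounded (M := C) (by simp)
    (hg.comp (hP.measurable_shift_path ω x)).aestronglyMeasurable ?_
  exact Eventually.of_forall fun t => by simpa using hC (ω.shift t x)

end StationaryErgodicLaw

/-! ### Boxes -/

/-- The box `[-n, n]^d`. -/
noncomputable def latticeBox (d n : ℕ) : Finset (Fin d → ℤ) :=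
  Finset.Icc (fun _ => -(n : ℤ)) (fun _ => (n : ℤ))

theorem mem_latticeBox {d n : ℕ} {x : Fin d → ℤ} :
    x ∈ latticeBox d n ↔ ∀ i, -(n : ℤ) ≤ x i ∧ x i ≤ n := by
  simp [latticeBox, Finset.mem_Icc, Pi.le_def, forall_and]

theorem card_latticeBox (d n : ℕ) : (latticeBox d n).card = (2 * n + 1) ^ d := by
  rw [latticeBox, Pi.card_Icc]
  simp only [Int.card_Icc, Finset.prod_const, Finset.card_univ, Fintype.card_fin]
  congr 1
  omega

theorem zero_mem_latticeBox (d n : ℕ) : (0 : Fin d → ℤ) ∈ latticeBox d n := by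
  simp [mem_latticeBox]

theorem latticeBox_mono {d m n : ℕ} (h : m ≤ n) : latticeBox d m ⊆ latticeBox d n := by
  intro x hx
  rw [mem_latticeBox] at hx ⊢
  intro i
  have := hx i
  omega

theorem add_mem_latticeBox {d m n : ℕ} {x y : Fin d → ℤ} (hx : x ∈ latticeBox d m)
    (hy : y ∈ latticeBox d n) : x + y ∈ latticeBox d (m + n) := by
  rw [mem_latticeBox] at *
  intro i
  have := hx i
  have := hy i
  simp only [Pi.add_apply]
  push_cast
  omega

theorem neg_mem_latticeBox {d n : ℕ} {x : Fin d → ℤ} (hx : x ∈ latticeBox d n) :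
    -x ∈ latticeBox d n := by
  rw [mem_latticeBox] at *
  intro i
  have := hx i
  simp only [Pi.neg_apply]
  omega

theorem exists_mem_latticeBox {d : ℕ} (x : Fin d → ℤ) : ∃ m, x ∈ latticeBox d m := by
  refine ⟨∑ i, (x i).natAbs, mem_latticeBox.2 fun i => ?_⟩
  have := Finset.single_le_sum (f := fun i => (x i).natAbs) (fun _ _ => Nat.zero_le _)
    (Finset.mem_univ i)
  omega

/-- A translation by `y ∈ [-m, m]^d` moves few points out of a large box. -/
theorem card_filter_add_notMem_latticeBox {d m n : ℕ} {y : Fin d → ℤ} (hy : y ∈ latticeBox d m) :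
    (((latticeBox d n).filter (fun x => x + y ∉ latticeBox d n)).card : ℝ) * n
      ≤ d * m * (latticeBox d n).card := by
  have hsub : (((latticeBox d n).filter (fun x => x + y ∉ latticeBox d n)).card : ℝ)
      ≤ (latticeBox d n).card := by
    exact_mod_cast Finset.card_filter_le _ _
  by_cases hmn : n ≤ m
  · rcases Nat.eq_zero_or_pos d with rfl | hd
    · have : (latticeBox 0 n).filter (fun x => x + y ∉ latticeBox 0 n) = ∅ := by
        ext x
        simp [mem_latticeBox]
      rw [this]
      simp
    have h1 : (n : ℝ) ≤ d * m := by
      have : n ≤ d * m := hmn.trans (Nat.le_mul_of_pos_left m hd)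
      exact_mod_cast this
    calc _ ≤ ((latticeBox d n).card : ℝ) * (d * m) := by gcongr
      _ = _ := by ring
  · push Not at hmn
    have h1 : latticeBox d (n - m) ⊆ (latticeBox d n).filter (fun x => x + y ∈ latticeBox d n) := by
      intro x hx
      rw [Finset.mem_filter]
      refine ⟨latticeBox_mono (Nat.sub_le _ _) hx, ?_⟩
      have := add_mem_latticeBox hx hy
      rwa [Nat.sub_add_cancel hmn.le] at this
    have h2 := Finset.card_filter_add_card_filter_not (s := latticeBox d n)
      (fun x => x + y ∈ latticeBox d n)
    have h3 := Finset.card_le_card h1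
    have h4 : (((latticeBox d n).filter (fun x => x + y ∉ latticeBox d n)).card : ℝ)
        ≤ (2 * n + 1) ^ d - (2 * (n - m) + 1 : ℝ) ^ d := by
      rw [card_latticeBox] at h2 h3
      have h2' : (((latticeBox d n).filter (fun x => x + y ∈ latticeBox d n)).card : ℝ) +
        ((latticeBox d n).filter (fun x => x + y ∉ latticeBox d n)).card = (2 * n + 1) ^ d := by
        exact_mod_cast h2
      have h3' : (2 * ((n - m : ℕ) : ℝ) + 1) ^ d ≤
          (((latticeBox d n).filter (fun x => x + y ∈ latticeBox d n)).card : ℝ) := by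
        exact_mod_cast h3
      rw [Nat.cast_sub hmn.le] at h3'
      linarith
    have hB : (0 : ℝ) < 2 * n + 1 := by positivity
    have hmn' : (m : ℝ) ≤ n := by exact_mod_cast hmn.le
    -- Bernoulli's inequality, for the proportion of the box occupied by the smaller box of radius
    -- `n - m`.
    have h5 : 1 - d * (2 * m / (2 * n + 1)) ≤ (1 - 2 * m / (2 * n + 1) : ℝ) ^ d := by
      have hle : 2 * (m : ℝ) / (2 * n + 1) ≤ 1 := by
        rw [div_le_one hB]; linarith
      have := one_add_mul_le_pow (a := -(2 * m / (2 * n + 1) : ℝ)) (by linarith) d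
      rw [← sub_eq_add_neg] at this
      linarith
    have h6 : (2 * (n - m) + 1 : ℝ) ^ d = (2 * n + 1) ^ d * (1 - 2 * m / (2 * n + 1) : ℝ) ^ d := by
      rw [← mul_pow]
      congr 1
      field_simp
      ring
    rw [card_latticeBox]
    push_cast
    have h7 : (((latticeBox d n).filter (fun x => x + y ∉ latticeBox d n)).card : ℝ)
        ≤ (2 * n + 1) ^ d * (d * (2 * m / (2 * n + 1))) := by
      rw [h6] at h4
      have : (0 : ℝ) ≤ (2 * n + 1) ^ d := by positivity
      nlinarith
    have h8 : (2 * (m : ℝ) / (2 * n + 1)) * n ≤ m := by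
      rw [div_mul_eq_mul_div, div_le_iff₀ hB]
      have : (0 : ℝ) ≤ m := by positivity
      nlinarith
    calc _ ≤ (2 * n + 1 : ℝ) ^ d * (d * (2 * m / (2 * n + 1))) * n := by gcongr
      _ = (2 * n + 1 : ℝ) ^ d * d * (2 * m / (2 * n + 1) * n) := by ring
      _ ≤ (2 * n + 1 : ℝ) ^ d * d * m := by gcongr
      _ = _ := by ring

/-! ### A maximal inequality -/

section Maximal

open scoped Pointwise

variable {G : Type*} [AddCommGroup G] [DecidableEq G]

/-- Vitali's covering argument: among the translates `S (k p) + p`, choose disjoint ones whose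
enlargements by `S - S` cover `A`. Doubling bounds the cardinality of `A` by the total size of the
chosen translates; on each of them the sum of `a` is large, and they are disjoint inside `S K + B`.
-/
theorem covering_sum_le {S : ℕ → Finset G} (hmono : Monotone S) {C : ℕ}
    (hne : ∀ k, (S k).Nonempty) (hsub : ∀ k, (S k - S k).card ≤ C * (S k).card)
    (a : G → ℝ≥0∞) (lam : ℝ≥0∞) (K : ℕ) (A B : Finset G) (hAB : A ⊆ B)
    (hA : ∀ p ∈ A, ∃ k ≤ K, lam * (S k).card ≤ ∑ g ∈ S k, a (g + p)) :
    lam * A.card ≤ C * ∑ q ∈ S K + B, a q := by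
  choose! k hkK hk using hA
  -- With radii 2^k and the factor 3/2, a covering translate has radius at least 2/3 of that of the
  -- covered one. For powers of 2 this forces its index to be at least as large.
  obtain ⟨u, huA, hdisj, hcov⟩ := Vitali.exists_disjoint_subfamily_covering_enlargement
    (fun p : G => ((S (k p) + {p} : Finset G) : Set G)) (A : Set G) (fun p => (2 : ℝ) ^ k p) (3 / 2)
    (by norm_num) (fun p _ => by positivity) (2 ^ K)
    (fun p hp => pow_le_pow_right₀ (by norm_num) (hkK p hp))
    (fun p _ => by
      simpa only [Finset.coe_nonempty] using (hne (k p)).add (Finset.singleton_nonempty p))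
  lift u to Finset G using A.finite_toSet.subset huA
  have hcov' : A ⊆ u.biUnion fun b => (S (k b) - S (k b)) + {b} := by
    intro x hx
    obtain ⟨b, hb, ⟨q, hq1, hq2⟩, hle⟩ := hcov x hx
    rw [Finset.mem_coe, Finset.mem_add] at hq1 hq2
    obtain ⟨g, hg, x', hx', rfl⟩ := hq1
    obtain ⟨g', hg', b', hb', heq⟩ := hq2
    rw [Finset.mem_singleton] at hx' hb'
    subst hx' hb'
    have hkk : k x' ≤ k b' := by
      by_contra hlt
      push Not at hlt
      have h1 : (2 : ℝ) ^ (k b' + 1) ≤ 2 ^ k x' := pow_le_pow_right₀ (by norm_num) hlt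
      have h2 : (0 : ℝ) < 2 ^ k b' := by positivity
      rw [pow_succ] at h1
      linarith
    rw [Finset.mem_biUnion]
    refine ⟨b', hb, Finset.mem_add.2 ⟨g' - g, Finset.sub_mem_sub hg' (hmono hkk hg), b',
      Finset.mem_singleton_self _, ?_⟩⟩
    rw [sub_add_eq_add_sub, heq, add_sub_cancel_left]
  have hcard : (A.card : ℝ≥0∞) ≤ C * ∑ b ∈ u, ((S (k b)).card : ℝ≥0∞) := by
    have : A.card ≤ C * ∑ b ∈ u, (S (k b)).card := by
      refine (Finset.card_le_card hcov').trans (Finset.card_biUnion_le.trans ?_)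
      rw [Finset.mul_sum]
      refine Finset.sum_le_sum fun b _ => ?_
      rw [Finset.card_add_singleton]
      exact hsub _
    exact_mod_cast this
  have hsum : ∑ b ∈ u, ∑ g ∈ S (k b), a (g + b) ≤ ∑ q ∈ S K + B, a q := by
    have h1 : ∀ b ∈ u, ∑ g ∈ S (k b), a (g + b) = ∑ q ∈ S (k b) + {b}, a q := by
      intro b _
      rw [Finset.add_singleton, ← Finset.image_vadd, Finset.sum_image]
      · rfl
      · intro x _ y _ h
        exact add_right_cancel h
    rw [Finset.sum_congr rfl h1, ← Finset.sum_biUnion]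
    · refine Finset.sum_le_sum_of_subset ?_
      intro q hq
      rw [Finset.mem_biUnion] at hq
      obtain ⟨b, hb, hq⟩ := hq
      exact Finset.add_subset_add (hmono (hkK b (huA hb)))
        (Finset.singleton_subset_iff.2 (hAB (huA hb))) hq
    · intro b hb c hc hbc
      exact Finset.disjoint_coe.1 (hdisj hb hc hbc)
  calc lam * A.card ≤ lam * (C * ∑ b ∈ u, ((S (k b)).card : ℝ≥0∞)) := by gcongr
    _ = C * ∑ b ∈ u, lam * (S (k b)).card := by rw [← Finset.mul_sum]; ring
    _ ≤ C * ∑ b ∈ u, ∑ g ∈ S (k b), a (g + b) := by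
      gcongr with b hb
      exact hk b (huA hb)
    _ ≤ _ := by gcongr

/-- Wiener's maximal inequality for an action of an abelian group, along a monotone sequence of
finite sets with the doubling property. -/
theorem mul_measure_maximal_le {Ω : Type*} [MeasurableSpace Ω] {P : Measure Ω} (T : G → Ω → Ω)
    (hT : ∀ g, MeasurePreserving (T g) P P) (hTadd : ∀ g h ω, T g (T h ω) = T (g + h) ω)
    {S : ℕ → Finset G} (hmono : Monotone S) {C : ℕ}
    (hne : ∀ k, (S k).Nonempty) (hsub : ∀ k, (S k - S k).card ≤ C * (S k).card)
    (hadd : ∀ k, (S k + S k).card ≤ C * (S k).card) {f : Ω → ℝ≥0∞} (hf : Measurable f)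
    (lam : ℝ≥0∞) :
    lam * P {ω | ∃ k, lam * (S k).card ≤ ∑ g ∈ S k, f (T g ω)} ≤ C * C * ∫⁻ ω, f ω ∂P := by
  classical
  have hmeas : ∀ k, Measurable fun ω => ∑ g ∈ S k, f (T g ω) := fun k =>
    Finset.measurable_fun_sum _ fun g _ => hf.comp (hT g).measurable
  set E : ℕ → Set Ω := fun K => {ω | ∃ k ≤ K, lam * (S k).card ≤ ∑ g ∈ S k, f (T g ω)} with hE
  have hEmeas : ∀ K, MeasurableSet (E K) := by
    intro K
    have : E K = ⋃ k, ⋃ (_ : k ≤ K), {ω | lam * (S k).card ≤ ∑ g ∈ S k, f (T g ω)} := by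
      ext ω
      simp [hE]
    rw [this]
    exact MeasurableSet.iUnion fun k => MeasurableSet.iUnion fun _ =>
      measurableSet_le measurable_const (hmeas k)
  have hfin : ∀ K, lam * P (E K) ≤ C * C * ∫⁻ ω, f ω ∂P := by
    intro K
    -- Transference: the covering inequality is applied along one orbit, to the points of `S K` at
    -- which the orbit visits `E K`. Integration then replaces each indicator by `P (E K)`.
    have hpt : ∀ ω, lam * ∑ p ∈ S K, (E K).indicator 1 (T p ω)
        ≤ C * ∑ q ∈ S K + S K, f (T q ω) := by
      intro ω
      have h := covering_sum_le hmono hne hsub (fun q => f (T q ω)) lam K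
        ((S K).filter fun p => T p ω ∈ E K) (S K) (Finset.filter_subset _ _) (by
          intro p hp
          obtain ⟨k, hk, hk'⟩ := (Finset.mem_filter.1 hp).2
          exact ⟨k, hk, by simpa only [hTadd] using hk'⟩)
      convert h using 2
      rw [Finset.card_filter]
      push_cast
      refine Finset.sum_congr rfl fun p _ => ?_
      simp [Set.indicator_apply]
    have hint := lintegral_mono (μ := P) hpt
    rw [lintegral_const_mul, lintegral_const_mul, lintegral_finsetSum, lintegral_finsetSum] at hint
    · have h1 : ∀ p, ∫⁻ ω, (E K).indicator 1 (T p ω) ∂P = P (E K) := by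
        intro p
        rw [(hT p).lintegral_comp (measurable_one.indicator (hEmeas K)),
          lintegral_indicator_one (hEmeas K)]
      have h2 : ∀ p, ∫⁻ ω, f (T p ω) ∂P = ∫⁻ ω, f ω ∂P := fun p => (hT p).lintegral_comp hf
      simp only [h1, h2, Finset.sum_const, nsmul_eq_mul] at hint
      have hc0 : ((S K).card : ℝ≥0∞) ≠ 0 := by
        exact_mod_cast (Finset.card_pos.2 (hne K)).ne'
      have hct : ((S K).card : ℝ≥0∞) ≠ ∞ := ENNReal.natCast_ne_top _
      have h3 : ((S K).card : ℝ≥0∞) * (lam * P (E K))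
          ≤ (S K).card * (C * C * ∫⁻ ω, f ω ∂P) := by
        calc _ = lam * ((S K).card * P (E K)) := by ring
          _ ≤ C * ((S K + S K).card * ∫⁻ ω, f ω ∂P) := hint
          _ ≤ C * ((C * (S K).card) * ∫⁻ ω, f ω ∂P) := by
            gcongr
            exact_mod_cast hadd K
          _ = _ := by ring
      exact (ENNReal.mul_le_mul_iff_right hc0 hct).1 h3
    · exact fun g _ => hf.comp (hT g).measurable
    · exact fun g _ => (measurable_one.indicator (hEmeas K)).comp (hT g).measurable
    · exact Finset.measurable_fun_sum _ fun g _ => hf.comp (hT g).measurable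
    · exact Finset.measurable_fun_sum _ fun g _ =>
        (measurable_one.indicator (hEmeas K)).comp (hT g).measurable
  have hunion : {ω | ∃ k, lam * (S k).card ≤ ∑ g ∈ S k, f (T g ω)} = ⋃ K, E K := by
    ext ω
    simp only [hE, Set.mem_ofPred_eq, Set.mem_iUnion]
    exact ⟨fun ⟨k, hk⟩ => ⟨k, k, le_rfl, hk⟩, fun ⟨_, k, _, hk⟩ => ⟨k, hk⟩⟩
  have hEmono : Monotone E := fun K L hKL ω ⟨k, hk, h⟩ => ⟨k, hk.trans hKL, h⟩
  rw [hunion, hEmono.measure_iUnion, ENNReal.mul_iSup]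
  exact iSup_le hfin

end Maximal

/-! ### The maximal inequality for space-time averages -/

theorem lintegral_Ico_natCast_eq_sum (h : ℝ → ℝ≥0∞) (M : ℕ) :
    ∫⁻ s in Set.Ico (0 : ℝ) M, h s
      = ∑ n ∈ Finset.range M, ∫⁻ s in Set.Ico (0 : ℝ) 1, h (s + n) := by
  induction M with
  | zero => simp
  | succ M ih =>
    have h1 : Set.Ico (0 : ℝ) ((M + 1 : ℕ) : ℝ) = Set.Ico 0 (M : ℝ) ∪ Set.Ico (M : ℝ) (M + 1) := by
      rw [Set.Ico_union_Ico_eq_Ico (by positivity) (by linarith)]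
      push_cast
      rfl
    have h2 : ∫⁻ s in Set.Ico (M : ℝ) (M + 1), h s = ∫⁻ s in Set.Ico (0 : ℝ) 1, h (s + M) := by
      have hmp := measurePreserving_add_right (volume : Measure ℝ) (M : ℝ)
      have := hmp.setLIntegral_comp_preimage_emb (measurableEmbedding_addRight (M : ℝ)) h
        (Set.Ico (M : ℝ) (M + 1))
      rw [← this]
      congr 2
      ext s
      simp
    rw [h1, lintegral_union measurableSet_Ico, ih, h2, Finset.sum_range_succ]
    exact Set.disjoint_left.2 fun s hs hs' => absurd hs.2 (not_lt.2 hs'.1)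

theorem card_spaceTimeBox_le {d : ℕ} (m n : ℕ) :
    (Finset.Icc (-((m + m : ℕ) : ℤ)) ((m + m : ℕ) : ℤ) ×ˢ latticeBox d (n + n)).card
      ≤ 2 ^ (d + 1) * (Finset.Icc (-(m : ℤ)) (m : ℤ) ×ˢ latticeBox d n).card := by
  rw [Finset.card_product, Finset.card_product, card_latticeBox, card_latticeBox, Int.card_Icc,
    Int.card_Icc]
  have h1 : (((m + m : ℕ) : ℤ) + 1 - -((m + m : ℕ) : ℤ)).toNat ≤
      2 * ((m : ℤ) + 1 - -(m : ℤ)).toNat := by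
    push_cast
    omega
  have h2 : (2 * (n + n) + 1) ^ d ≤ 2 ^ d * (2 * n + 1) ^ d := by
    rw [← mul_pow]
    exact Nat.pow_le_pow_left (by omega) d
  calc _ ≤ (2 * ((m : ℤ) + 1 - -(m : ℤ)).toNat) * (2 ^ d * (2 * n + 1) ^ d) :=
        Nat.mul_le_mul h1 h2
    _ = _ := by ring

namespace StationaryErgodicLaw

variable {d : ℕ} [MeasurableSpace (Env d)] {P : Measure (Env d)}

open scoped Pointwise in
-- The discrete maximal inequality for ℤ × ℤ^d, applied to time integrals over unit intervals. Its
-- index sets must have controlled differences, hence the symmetric time intervals, which contain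
-- [0, 4^k).
theorem mul_measure_spaceTime_maximal_le [IsProbabilityMeasure P] (hP : StationaryErgodicLaw P)
    {f : Env d → ℝ≥0∞} (hf : Measurable f) (lam : ℝ≥0∞) :
    lam * P {ω | ∃ k : ℕ, lam * (4 ^ k * (latticeBox d (2 * 2 ^ k)).card) ≤
        ∫⁻ s in Set.Ico (0 : ℝ) (4 ^ k), ∑ x ∈ latticeBox d (2 * 2 ^ k), f (ω.shift s x)}
      ≤ 2 ^ (d + 1) * 2 ^ (d + 1) * 3 * ∫⁻ ω, f ω ∂P := by
  -- The factor 3 pays for symmetrization: the symmetric interval has 2·4^k + 1 ≤ 3·4^k integer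
  -- times.
  set g : Env d → ℝ≥0∞ := fun ω => 3 * ∫⁻ s in Set.Ico (0 : ℝ) 1, f (ω.shift s 0) with hg
  have hfm : Measurable (fun p : Env d × ℝ => f (p.1.shift p.2 0)) :=
    hf.comp (hP.measurable_shift_time 0)
  have hgm : Measurable g := (hfm.lintegral_prod_right').const_mul 3
  set S : ℕ → Finset (ℤ × (Fin d → ℤ)) := fun k =>
    Finset.Icc (-((4 ^ k : ℕ) : ℤ)) ((4 ^ k : ℕ) : ℤ) ×ˢ latticeBox d (2 * 2 ^ k) with hS
  have hmono : Monotone S := by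
    intro k l hkl
    have h4 : 4 ^ k ≤ 4 ^ l := Nat.pow_le_pow_right (by norm_num) hkl
    have h2 : 2 ^ k ≤ 2 ^ l := Nat.pow_le_pow_right (by norm_num) hkl
    refine Finset.product_subset_product (Finset.Icc_subset_Icc ?_ ?_) (latticeBox_mono ?_)
    · exact neg_le_neg (by exact_mod_cast h4)
    · exact_mod_cast h4
    · omega
  have hadd : ∀ k, (S k + S k).card ≤ 2 ^ (d + 1) * (S k).card := by
    intro k
    refine (Finset.card_le_card ?_).trans (card_spaceTimeBox_le (4 ^ k) (2 * 2 ^ k))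
    intro q hq
    obtain ⟨a, ha, b, hb, rfl⟩ := Finset.mem_add.1 hq
    rw [hS, Finset.mem_product, Finset.mem_Icc] at ha hb
    rw [Finset.mem_product, Finset.mem_Icc]
    refine ⟨⟨?_, ?_⟩, add_mem_latticeBox ha.2 hb.2⟩ <;> rw [Prod.fst_add, Nat.cast_add] <;>
      linarith [ha.1.1, ha.1.2, hb.1.1, hb.1.2]
  have hneg : ∀ k, -S k = S k := by
    intro k
    have : ∀ q, q ∈ S k → -q ∈ S k := by
      intro q hq
      rw [hS, Finset.mem_product, Finset.mem_Icc] at hq ⊢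
      refine ⟨⟨?_, ?_⟩, neg_mem_latticeBox hq.2⟩ <;> rw [Prod.fst_neg] <;>
        linarith [hq.1.1, hq.1.2]
    ext q
    rw [Finset.mem_neg']
    exact ⟨fun h => by simpa using this _ h, this q⟩
  have hsub : ∀ k, (S k - S k).card ≤ 2 ^ (d + 1) * (S k).card := by
    intro k
    rw [sub_eq_add_neg, hneg]
    exact hadd k
  have hne : ∀ k, (S k).Nonempty := fun k =>
    ⟨(0, 0), by simp [hS, Finset.mem_product, zero_mem_latticeBox]⟩
  have key := mul_measure_maximal_le (P := P) (fun q : ℤ × (Fin d → ℤ) => Env.shift (q.1 : ℝ) q.2)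
    (fun q => hP.measurePreserving _ _)
    (fun q r ω => by simp [Env.shift_shift]) hmono hne hsub hadd hgm lam
  have hgint : ∫⁻ ω, g ω ∂P = 3 * ∫⁻ ω, f ω ∂P := by
    rw [hg, lintegral_const_mul _ hfm.lintegral_prod_right',
      lintegral_lintegral_swap hfm.aemeasurable]
    congr 1
    have : ∀ s : ℝ, ∫⁻ ω, f (ω.shift s 0) ∂P = ∫⁻ ω, f ω ∂P := fun s =>
      (hP.measurePreserving s 0).lintegral_comp hf
    simp [this]
  rw [hgint] at key
  push_cast at key
  refine le_trans ?_ (key.trans_eq (by ring))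
  refine mul_le_mul_right (measure_mono ?_) _
  intro ω hω
  obtain ⟨k, hk⟩ := hω
  refine ⟨k, ?_⟩
  have h1 : ((S k).card : ℝ≥0∞) ≤ 3 * (4 ^ k * (latticeBox d (2 * 2 ^ k)).card) := by
    have : (S k).card ≤ 3 * (4 ^ k * (latticeBox d (2 * 2 ^ k)).card) := by
      rw [hS, Finset.card_product, Int.card_Icc, ← mul_assoc]
      refine Nat.mul_le_mul_right _ ?_
      have : 1 ≤ 4 ^ k := Nat.one_le_pow _ _ (by norm_num)
      omega
    exact_mod_cast this
  have h2 : ∫⁻ s in Set.Ico (0 : ℝ) (4 ^ k), ∑ x ∈ latticeBox d (2 * 2 ^ k), f (ω.shift s x)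
      ≤ ∑ q ∈ S k, ∫⁻ s in Set.Ico (0 : ℝ) 1, f ((ω.shift q.1 q.2).shift s 0) := by
    have hcast : (4 : ℝ) ^ k = ((4 ^ k : ℕ) : ℝ) := by push_cast; rfl
    rw [hcast, lintegral_Ico_natCast_eq_sum]
    have h3 : ∀ n : ℕ, ∫⁻ s in Set.Ico (0 : ℝ) 1, ∑ x ∈ latticeBox d (2 * 2 ^ k),
          f (ω.shift (s + n) x)
        = ∑ x ∈ latticeBox d (2 * 2 ^ k), ∫⁻ s in Set.Ico (0 : ℝ) 1,
          f ((ω.shift (n : ℤ) x).shift s 0) := by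
      intro n
      rw [lintegral_finsetSum]
      · simp [Env.shift_shift]
      · intro x _
        exact hf.comp ((hP.measurable_shift_path ω x).comp (measurable_add_const _))
    rw [Finset.sum_congr rfl fun n _ => h3 n, hS, Finset.sum_product]
    have h4 : ∀ F : ℤ → ℝ≥0∞, ∑ n ∈ Finset.range (4 ^ k), F n ≤
        ∑ n ∈ Finset.Icc (-((4 ^ k : ℕ) : ℤ)) ((4 ^ k : ℕ) : ℤ), F n := by
      intro F
      rw [← Finset.sum_image (g := fun n : ℕ => (n : ℤ)) (f := F)
        (fun x _ y _ h => Int.ofNat_inj.1 h)]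
      refine Finset.sum_le_sum_of_subset fun q hq => ?_
      obtain ⟨n, hn, rfl⟩ := Finset.mem_image.1 hq
      rw [Finset.mem_range] at hn
      rw [Finset.mem_Icc]
      constructor
      · have : (0 : ℤ) ≤ ((4 ^ k : ℕ) : ℤ) := by positivity
        have : (0 : ℤ) ≤ n := by positivity
        linarith
      · exact_mod_cast hn.le
    exact h4 fun n => ∑ x ∈ latticeBox d (2 * 2 ^ k), ∫⁻ s in Set.Ico (0 : ℝ) 1,
          f ((ω.shift (n : ℤ) x).shift s 0)
  calc lam * (S k).card ≤ lam * (3 * (4 ^ k * (latticeBox d (2 * 2 ^ k)).card)) := by gcongr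
    _ = 3 * (lam * (4 ^ k * (latticeBox d (2 * 2 ^ k)).card)) := by ring
    _ ≤ 3 * ∑ q ∈ S k, ∫⁻ s in Set.Ico (0 : ℝ) 1, f ((ω.shift q.1 q.2).shift s 0) := by
      gcongr
      exact hk.trans h2
    _ = _ := by rw [Finset.mul_sum]

/-- Borel–Cantelli for space-time averages at all dyadic scales. -/
theorem ae_eventually_average_le [IsProbabilityMeasure P] (hP : StationaryErgodicLaw P)
    {r : ℕ → Env d → ℝ} (hr : ∀ m, Integrable (r m) P) (hb : ∀ m, ∫ ω, |r m ω| ∂P ≤ (1 / 4) ^ m) :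
    ∀ᵐ ω ∂P, ∀ᶠ m in atTop, ∀ k : ℕ,
      ∫ s in (0 : ℝ)..4 ^ k, ∑ x ∈ latticeBox d (2 * 2 ^ k), |r m (ω.shift s x)|
        ≤ (1 / 2) ^ m * (4 ^ k * (latticeBox d (2 * 2 ^ k)).card) := by
  set f : ℕ → Env d → ℝ≥0∞ := fun m ω => ENNReal.ofReal |(hr m).1.mk (r m) ω| with hf
  have hfm : ∀ m, Measurable (f m) := fun m =>
    ((hr m).1.stronglyMeasurable_mk.measurable.abs).ennreal_ofReal
  have hfi : ∀ m, ∫⁻ ω, f m ω ∂P ≤ (1 / 4) ^ m := by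
    intro m
    have h1 : ∫⁻ ω, f m ω ∂P = ∫⁻ ω, ENNReal.ofReal |r m ω| ∂P := by
      refine lintegral_congr_ae ?_
      filter_upwards [(hr m).1.ae_eq_mk] with ω hω
      rw [hf]
      simp only [hω]
    rw [h1, ← ofReal_integral_eq_lintegral_ofReal (hr m).abs
      (Eventually.of_forall fun _ => abs_nonneg _)]
    refine (ENNReal.ofReal_le_ofReal (hb m)).trans_eq ?_
    rw [ENNReal.ofReal_pow (by norm_num)]
    congr 1
    rw [ENNReal.ofReal_div_of_pos (by norm_num)]
    simp
  set c : ℝ≥0∞ := 2 ^ (d + 1) * 2 ^ (d + 1) * 3 with hc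
  have hctop : c ≠ ∞ := by
    rw [hc]
    finiteness
  set Bad : ℕ → Set (Env d) := fun m =>
    {ω | ∃ k : ℕ, (1 / 2 : ℝ≥0∞) ^ m * (4 ^ k * (latticeBox d (2 * 2 ^ k)).card) ≤
        ∫⁻ s in Set.Ico (0 : ℝ) (4 ^ k), ∑ x ∈ latticeBox d (2 * 2 ^ k), f m (ω.shift s x)}
    with hBad
  -- The mean is at most (1/4)^m and the threshold is (1/2)^m, so the maximal inequality leaves the
  -- summable bound c (1/2)^m.
  have hmeas : ∀ m, P (Bad m) ≤ c * (1 / 2) ^ m := by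
    intro m
    have h1 := (hP.mul_measure_spaceTime_maximal_le (hfm m) ((1 / 2) ^ m)).trans
      (mul_le_mul_right (hfi m) _)
    have h0 : (1 / 2 : ℝ≥0∞) ^ m ≠ 0 := pow_ne_zero _ (by simp)
    have ht : (1 / 2 : ℝ≥0∞) ^ m ≠ ∞ := by finiteness
    refine (ENNReal.mul_le_mul_iff_right h0 ht).1 (h1.trans_eq ?_)
    have : (1 / 4 : ℝ≥0∞) = 1 / 2 * (1 / 2) := by
      simp only [one_div]
      rw [← ENNReal.mul_inv (by simp) (by simp)]
      norm_num
    rw [this, mul_pow]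
    ring
  have hBC := measure_limsup_atTop_eq_zero (μ := P) (s := Bad) (by
    refine ne_top_of_le_ne_top ?_ (ENNReal.tsum_le_tsum hmeas)
    rw [ENNReal.tsum_mul_left, ENNReal.tsum_geometric]
    refine ENNReal.mul_ne_top hctop ?_
    simp)
  have hev : ∀ᵐ ω ∂P, ∀ᶠ m in atTop, ω ∉ Bad m := by
    rw [ae_iff]
    convert hBC using 2
    ext ω
    simp [mem_limsup_iff_frequently_mem, frequently_atTop]
  have hmk : ∀ᵐ ω ∂P, ∀ᵐ s : ℝ, ∀ x, ∀ m, r m (ω.shift s x) = (hr m).1.mk (r m) (ω.shift s x) :=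
    hP.ae_ae_shift (ae_all_iff.2 fun m => (hr m).1.ae_eq_mk)
  filter_upwards [hev, hmk, ae_all_iff.2 fun m => hP.ae_intervalIntegrable (hr m)]
    with ω hω hω2 hω3
  filter_upwards [hω] with m hm k
  have hm' := not_le.1 fun h => hm ⟨k, h⟩
  have h4 : (0 : ℝ) ≤ 4 ^ k := by positivity
  rw [intervalIntegral.integral_of_le h4, ← integral_Ico_eq_integral_Ioc,
    integral_eq_lintegral_of_nonneg_ae]
  · have h5 : ∫⁻ s in Set.Ico (0 : ℝ) (4 ^ k),
        ENNReal.ofReal (∑ x ∈ latticeBox d (2 * 2 ^ k), |r m (ω.shift s x)|)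
        = ∫⁻ s in Set.Ico (0 : ℝ) (4 ^ k), ∑ x ∈ latticeBox d (2 * 2 ^ k), f m (ω.shift s x) := by
      refine lintegral_congr_ae (ae_restrict_of_ae ?_)
      filter_upwards [hω2] with s hs
      rw [ENNReal.ofReal_sum_of_nonneg fun _ _ => abs_nonneg _]
      refine Finset.sum_congr rfl fun x _ => ?_
      rw [hs x m]
    rw [h5]
    refine (ENNReal.toReal_mono (by finiteness) hm'.le).trans_eq ?_
    simp
  · exact Eventually.of_forall fun s => Finset.sum_nonneg fun _ _ => abs_nonneg _
  · have : IntervalIntegrable (fun s => ∑ x ∈ latticeBox d (2 * 2 ^ k), |r m (ω.shift s x)|)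
        volume 0 (4 ^ k) := by
      have := IntervalIntegrable.sum (latticeBox d (2 * 2 ^ k))
        (f := fun x s => |r m (ω.shift s x)|) (fun x _ => (hω3 m x 0 (4 ^ k)).abs)
      simpa [Finset.sum_fn] using this
    rw [intervalIntegrable_iff_integrableOn_Ico_of_le h4] at this
    exact this.1

end StationaryErgodicLaw

/-! ### The ergodic theorem for space-time averages -/

/-- The points common to the set and its translate cancel. This is the telescoping that turns
divergences and coboundaries into boundary terms. -/
theorem sum_add_sub_sum_eq {G : Type*} [AddCommGroup G] [DecidableEq G] (B : Finset G) (y : G)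
    (h : G → ℝ) :
    ∑ p ∈ B, h (p + y) - ∑ p ∈ B, h p
      = ∑ p ∈ B with p + y ∉ B, h (p + y) - ∑ p ∈ B with p + -y ∉ B, h p := by
  have h1 : ∑ p ∈ B with p + y ∈ B, h (p + y) = ∑ p ∈ B with p + -y ∈ B, h p := by
    refine Finset.sum_bij' (fun p _ => p + y) (fun p _ => p + -y) ?_ ?_ ?_ ?_ ?_ <;> intro a ha <;>
      simp_all
  rw [← Finset.sum_filter_add_sum_filter_not B (fun p => p + y ∈ B),
    ← Finset.sum_filter_add_sum_filter_not B (fun p => p + -y ∈ B) (fun p => h p), h1]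
  ring

/-- Only a fraction of order `m / n` of the points is near the boundary. This is the source of the
gain of one power of the side length. -/
theorem abs_sum_add_sub_sum_le {d m n : ℕ} {y : Fin d → ℤ} (hy : y ∈ latticeBox d m)
    {h : (Fin d → ℤ) → ℝ} {M : ℝ} (hM : ∀ p ∈ latticeBox d n, |h p| ≤ M)
    (hM' : ∀ p ∈ latticeBox d n, |h (p + y)| ≤ M) :
    |∑ p ∈ latticeBox d n, h (p + y) - ∑ p ∈ latticeBox d n, h p| * n
      ≤ 2 * M * (d * m * (latticeBox d n).card) := by
  have h0 : 0 ≤ M := (abs_nonneg _).trans (hM 0 (zero_mem_latticeBox d n))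
  rw [sum_add_sub_sum_eq]
  have h1 : |∑ p ∈ latticeBox d n with p + y ∉ latticeBox d n, h (p + y)|
      ≤ ((latticeBox d n).filter (fun p => p + y ∉ latticeBox d n)).card * M := by
    refine (Finset.abs_sum_le_sum_abs _ _).trans ?_
    rw [← nsmul_eq_mul]
    exact Finset.sum_le_card_nsmul _ _ _ fun p hp => hM' p (Finset.mem_filter.1 hp).1
  have h2 : |∑ p ∈ latticeBox d n with p + -y ∉ latticeBox d n, h p|
      ≤ ((latticeBox d n).filter (fun p => p + -y ∉ latticeBox d n)).card * M := by
    refine (Finset.abs_sum_le_sum_abs _ _).trans ?_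
    rw [← nsmul_eq_mul]
    exact Finset.sum_le_card_nsmul _ _ _ fun p hp => hM p (Finset.mem_filter.1 hp).1
  have h3 := card_filter_add_notMem_latticeBox (n := n) hy
  have h4 := card_filter_add_notMem_latticeBox (n := n) (neg_mem_latticeBox hy)
  have hn : (0 : ℝ) ≤ n := by positivity
  calc _ ≤ (((latticeBox d n).filter (fun p => p + y ∉ latticeBox d n)).card * M
        + ((latticeBox d n).filter (fun p => p + -y ∉ latticeBox d n)).card * M) * n := by
        gcongr
        exact (abs_sub _ _).trans (add_le_add h1 h2)
    _ = M * (((latticeBox d n).filter (fun p => p + y ∉ latticeBox d n)).card * n)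
        + M * (((latticeBox d n).filter (fun p => p + -y ∉ latticeBox d n)).card * n) := by ring
    _ ≤ M * (d * m * (latticeBox d n).card) + M * (d * m * (latticeBox d n).card) := by gcongr
    _ = _ := by ring

theorem card_latticeBox_two_mul_le (d n : ℕ) :
    ((latticeBox d (2 * n)).card : ℝ) ≤ 2 ^ d * (latticeBox d n).card := by
  rw [card_latticeBox, card_latticeBox]
  have : (2 * (2 * n) + 1) ^ d ≤ 2 ^ d * (2 * n + 1) ^ d := by
    rw [← mul_pow]
    exact Nat.pow_le_pow_left (by omega) d
  exact_mod_cast this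

theorem sum_latticeBox_add_le {d n : ℕ} {z : Fin d → ℤ} (hz : z ∈ latticeBox d n)
    {h : (Fin d → ℤ) → ℝ} (h0 : ∀ x, 0 ≤ h x) :
    ∑ p ∈ latticeBox d n, h (p + z) ≤ ∑ x ∈ latticeBox d (2 * n), h x := by
  classical
  rw [← Finset.sum_image (g := fun p => p + z) (f := h) (fun x _ y _ h => add_right_cancel h)]
  refine Finset.sum_le_sum_of_subset_of_nonneg (fun x hx => ?_) fun x _ _ => h0 x
  obtain ⟨p, hp, rfl⟩ := Finset.mem_image.1 hx
  rw [two_mul]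
  exact add_mem_latticeBox hp hz

theorem intervalIntegrable_sum_shift {d : ℕ} {F : Env d → ℝ} {ω : Env d}
    (h : ∀ (x : Fin d → ℤ) (a b : ℝ), IntervalIntegrable (fun t => F (ω.shift t x)) volume a b)
    (B : Finset (Fin d → ℤ)) (z : Fin d → ℤ) (a b : ℝ) :
    IntervalIntegrable (fun s => ∑ p ∈ B, F (ω.shift s (p + z))) volume a b := by
  have := IntervalIntegrable.sum B (f := fun p s => F (ω.shift s (p + z)))
    (fun p _ => h (p + z) a b)
  simpa [Finset.sum_fn] using this

/-- The space-time averages of `F` over dyadic parabolic boxes tend to zero, uniformly in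
translations of the box and in shorter time intervals. -/
def HasUniformZeroAverages {d : ℕ} [MeasurableSpace (Env d)] (P : Measure (Env d))
    (F : Env d → ℝ) : Prop :=
  ∀ᵐ ω ∂P, ∀ ε > (0 : ℝ), ∀ᶠ k : ℕ in atTop, ∀ z ∈ latticeBox d (2 ^ k),
    ∀ t ∈ Set.Icc (0 : ℝ) (4 ^ k),
      |∫ s in (0 : ℝ)..t, ∑ p ∈ latticeBox d (2 ^ k), F (ω.shift s (p + z))|
        ≤ ε * (4 ^ k * (latticeBox d (2 ^ k)).card)

/-! ### Stability of vanishing averages, and coboundaries -/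

namespace StationaryErgodicLaw

variable {d : ℕ} [MeasurableSpace (Env d)] {P : Measure (Env d)}

theorem uniformZeroAverages_congr [IsProbabilityMeasure P] (hP : StationaryErgodicLaw P)
    {F G : Env d → ℝ} (h : F =ᵐ[P] G) (hF : HasUniformZeroAverages P F) :
    HasUniformZeroAverages P G := by
  filter_upwards [hF, hP.ae_ae_shift h] with ω h1 h2 ε hε
  filter_upwards [h1 ε hε] with k hk z hz t ht
  convert hk z hz t ht using 2
  refine intervalIntegral.integral_congr_ae ?_
  filter_upwards [h2] with s hs _
  exact Finset.sum_congr rfl fun p _ => (hs _).symm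

theorem uniformZeroAverages_add [IsProbabilityMeasure P] (hP : StationaryErgodicLaw P)
    {F G : Env d → ℝ} (hFi : Integrable F P) (hGi : Integrable G P)
    (hF : HasUniformZeroAverages P F) (hG : HasUniformZeroAverages P G) :
    HasUniformZeroAverages P (fun ω => F ω + G ω) := by
  filter_upwards [hF, hG, hP.ae_intervalIntegrable hFi, hP.ae_intervalIntegrable hGi]
    with ω h1 h2 h3 h4 ε hε
  filter_upwards [h1 (ε / 2) (half_pos hε), h2 (ε / 2) (half_pos hε)] with k hk hk' z hz t ht
  simp only [Finset.sum_add_distrib]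
  rw [intervalIntegral.integral_add (intervalIntegrable_sum_shift h3 _ _ _ _)
    (intervalIntegrable_sum_shift h4 _ _ _ _)]
  refine (abs_add_le _ _).trans ?_
  have := hk z hz t ht
  have := hk' z hz t ht
  linarith

theorem uniformZeroAverages_const_mul {F : Env d → ℝ} (c : ℝ)
    (hF : HasUniformZeroAverages P F) : HasUniformZeroAverages P (fun ω => c * F ω) := by
  filter_upwards [hF] with ω h1 ε hε
  have hc : 0 < |c| + 1 := by positivity
  filter_upwards [h1 (ε / (|c| + 1)) (by positivity)] with k hk z hz t ht
  simp only [← Finset.mul_sum]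
  rw [intervalIntegral.integral_const_mul, abs_mul]
  calc _ ≤ |c| * (ε / (|c| + 1) * (4 ^ k * (latticeBox d (2 ^ k)).card)) := by
        gcongr
        exact hk z hz t ht
    _ ≤ (|c| + 1) * (ε / (|c| + 1) * (4 ^ k * (latticeBox d (2 ^ k)).card)) := by
        gcongr
        linarith
    _ = _ := by field_simp

/-- A spatial shift contributes only at the boundary of the box, a time shift only near the two ends
of the time interval. Both contributions are of lower order than the volume, uniformly in `z` and
`t`, because `g` is bounded. -/
theorem uniformZeroAverages_coboundary [IsProbabilityMeasure P] (hP : StationaryErgodicLaw P)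
    {g : Env d → ℝ} (hg : Measurable g) {C : ℝ} (hC : ∀ ω, |g ω| ≤ C) (a : ℝ) (y : Fin d → ℤ) :
    HasUniformZeroAverages P (fun ω => g (ω.shift a y) - g ω) := by
  refine Eventually.of_forall fun ω ε hε => ?_
  obtain ⟨m, hm⟩ := exists_mem_latticeBox y
  have h0 : 0 ≤ C := (abs_nonneg _).trans (hC ω)
  have hev : ∀ᶠ k : ℕ in atTop, 2 * C * (d * m) + 2 * |a| * C ≤ ε * 2 ^ k :=
    ((tendsto_pow_atTop_atTop_of_one_lt (by norm_num : (1 : ℝ) < 2)).const_mul_atTop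
      hε).eventually_ge_atTop _
  filter_upwards [hev] with k hk z hz t ht
  have hi := hP.intervalIntegrable_of_bounded hg hC ω
  set I : (Fin d → ℤ) → ℝ := fun x => ∫ s in (0 : ℝ)..t, g (ω.shift s x) with hI
  have hbd : ∀ (x : Fin d → ℤ) (b c : ℝ), |∫ s in b..c, g (ω.shift s x)| ≤ C * |c - b| :=
    fun x b c => intervalIntegral.norm_integral_le_of_norm_le_const
      (f := fun s => g (ω.shift s x)) fun s _ => hC _
  have hIb : ∀ x, |I x| ≤ C * 4 ^ k := fun x => by
    refine (hbd x 0 t).trans ?_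
    rw [sub_zero, abs_of_nonneg ht.1]
    exact mul_le_mul_of_nonneg_left ht.2 h0
  -- The shifted and unshifted time integrals differ only by two end pieces of length |a|.
  have hshift : ∀ x, ∫ s in (0 : ℝ)..t, g (ω.shift (s + a) x)
      = I x + ((∫ s in t..t + a, g (ω.shift s x)) - ∫ s in (0 : ℝ)..a, g (ω.shift s x)) := by
    intro x
    rw [intervalIntegral.integral_comp_add_right (fun s => g (ω.shift s x)) a, zero_add]
    have e1 := intervalIntegral.integral_add_adjacent_intervals (hi x 0 a) (hi x a (t + a))
    have e2 := intervalIntegral.integral_add_adjacent_intervals (hi x 0 t) (hi x t (t + a))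
    simp only [hI]
    linarith
  have heq : ∫ s in (0 : ℝ)..t, ∑ p ∈ latticeBox d (2 ^ k),
        (g ((ω.shift s (p + z)).shift a y) - g (ω.shift s (p + z)))
      = (∑ p ∈ latticeBox d (2 ^ k), I (p + y + z) - ∑ p ∈ latticeBox d (2 ^ k), I (p + z))
        + ∑ p ∈ latticeBox d (2 ^ k), ((∫ s in t..t + a, g (ω.shift s (p + y + z)))
          - ∫ s in (0 : ℝ)..a, g (ω.shift s (p + y + z))) := by
    have hi2 : ∀ x, IntervalIntegrable (fun s => g (ω.shift (s + a) x)) volume 0 t := fun x => by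
      have := (hi x (0 + a) (t + a)).comp_add_right a
      simpa using this
    simp only [Env.shift_shift]
    rw [intervalIntegral.integral_finsetSum]
    · rw [← Finset.sum_sub_distrib, ← Finset.sum_add_distrib]
      refine Finset.sum_congr rfl fun p _ => ?_
      have e3 : ∀ s, ω.shift (a + s) (y + (p + z)) = ω.shift (s + a) (p + y + z) := fun s => by
        rw [add_comm a s, add_left_comm, add_assoc]
      simp only [e3]
      rw [intervalIntegral.integral_sub (hi2 _) (hi _ _ _), hshift]
      ring
    · intro p _
      have e3 : ∀ s, ω.shift (a + s) (y + (p + z)) = ω.shift (s + a) (p + y + z) := fun s => by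
        rw [add_comm a s, add_left_comm, add_assoc]
      simp only [e3]
      exact (hi2 _).sub (hi _ _ _)
  rw [heq]
  have hA := abs_sum_add_sub_sum_le (n := 2 ^ k) hm (h := fun x => I (x + z))
    (fun x _ => hIb (x + z))
    (fun x _ => hIb (x + y + z))
  have hB : |∑ p ∈ latticeBox d (2 ^ k), ((∫ s in t..t + a, g (ω.shift s (p + y + z)))
          - ∫ s in (0 : ℝ)..a, g (ω.shift s (p + y + z)))|
      ≤ (latticeBox d (2 ^ k)).card * (2 * |a| * C) := by
    refine (Finset.abs_sum_le_sum_abs _ _).trans ?_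
    rw [← nsmul_eq_mul]
    refine Finset.sum_le_card_nsmul _ _ _ fun p _ => (abs_sub _ _).trans ?_
    have e1 := hbd (p + y + z) t (t + a)
    have e2 := hbd (p + y + z) 0 a
    rw [add_sub_cancel_left] at e1
    rw [sub_zero] at e2
    linarith
  set A := |∑ p ∈ latticeBox d (2 ^ k), I (p + y + z) - ∑ p ∈ latticeBox d (2 ^ k), I (p + z)|
    with hAdef
  have h2 : (0 : ℝ) < 2 ^ k := by positivity
  have h4 : (4 : ℝ) ^ k = 2 ^ k * 2 ^ k := by rw [← mul_pow]; norm_num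
  have h1k : (1 : ℝ) ≤ 2 ^ k := one_le_pow₀ (by norm_num)
  set N : ℝ := ((latticeBox d (2 ^ k)).card : ℝ) with hN
  have hN0 : 0 ≤ N := by positivity
  have hA' : A ≤ 2 ^ k * (2 * C * (d * m)) * N := by
    push_cast at hA
    have : A * 2 ^ k ≤ (2 ^ k * (2 * C * (d * m)) * N) * 2 ^ k := by
      refine hA.trans_eq ?_
      rw [h4]
      ring
    exact le_of_mul_le_mul_right this h2
  refine (abs_add_le _ _).trans ?_
  rw [← hAdef]
  have hC' : 0 ≤ 2 * |a| * C := by positivity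
  calc A + _ ≤ 2 ^ k * (2 * C * (d * m)) * N + N * (2 * |a| * C) := add_le_add hA' hB
    _ ≤ 2 ^ k * (2 * C * (d * m)) * N + (2 ^ k * N) * (2 * |a| * C) := by
      gcongr
      nlinarith
    _ = (2 * C * (d * m) + 2 * |a| * C) * (2 ^ k * N) := by ring
    _ ≤ (ε * 2 ^ k) * (2 ^ k * N) := by gcongr
    _ = _ := by rw [h4]; ring

/-- The class of functions with uniformly vanishing averages is closed in `L¹`. -/
theorem uniformZeroAverages_of_approx [IsProbabilityMeasure P] (hP : StationaryErgodicLaw P)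
    {F : Env d → ℝ} (hF : Integrable F P)
    (h : ∀ ε > (0 : ℝ), ∃ G : Env d → ℝ, Integrable G P ∧ HasUniformZeroAverages P G ∧
      ∫ ω, |F ω - G ω| ∂P ≤ ε) : HasUniformZeroAverages P F := by
  have h' : ∀ m : ℕ, ∃ G : Env d → ℝ, Integrable G P ∧ HasUniformZeroAverages P G ∧
      ∫ ω, |F ω - G ω| ∂P ≤ (1 / 4) ^ m := fun m => h _ (by positivity)
  choose G hGi hG hFG using h'
  have hmax := hP.ae_eventually_average_le (r := fun m ω => F ω - G m ω)
    (fun m => hF.sub (hGi m)) hFG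
  filter_upwards [hmax, ae_all_iff.2 hG, hP.ae_intervalIntegrable hF,
    ae_all_iff.2 fun m => hP.ae_intervalIntegrable (hGi m)] with ω h1 h2 h3 h4 ε hε
  have h5 : ∀ᶠ m : ℕ in atTop, (1 / 2 : ℝ) ^ m * 2 ^ d ≤ ε / 2 := by
    have := (tendsto_pow_atTop_nhds_zero_of_lt_one (by norm_num : (0 : ℝ) ≤ 1 / 2)
      (by norm_num)).mul_const ((2 : ℝ) ^ d)
    rw [zero_mul] at this
    exact (this.eventually_lt_const (half_pos hε)).mono fun _ h => h.le
  obtain ⟨m, hm1, hm2⟩ := (h1.and h5).exists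
  filter_upwards [h2 m (ε / 2) (half_pos hε)] with k hk z hz t ht
  have hsub : ∀ (x : Fin d → ℤ) (a b : ℝ),
      IntervalIntegrable (fun s => F (ω.shift s x) - G m (ω.shift s x)) volume a b :=
    fun x a b => (h3 x a b).sub (h4 m x a b)
  -- A box translated by `z` lies in the doubled box, and [0, t] in [0, 4^k]. One maximal bound on
  -- doubled boxes is therefore uniform in `z` and `t`, at the price of a factor 2^d.
  have hr : |∫ s in (0 : ℝ)..t, ∑ p ∈ latticeBox d (2 ^ k),
      (F (ω.shift s (p + z)) - G m (ω.shift s (p + z)))|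
      ≤ ε / 2 * (4 ^ k * (latticeBox d (2 ^ k)).card) := by
    have hint : ∀ a b, IntervalIntegrable (fun s => ∑ x ∈ latticeBox d (2 * 2 ^ k),
        |F (ω.shift s x) - G m (ω.shift s x)|) volume a b := fun a b => by
      have := intervalIntegrable_sum_shift (F := fun ω => |F ω - G m ω|) (ω := ω)
        (fun x a b => (hsub x a b).abs) (latticeBox d (2 * 2 ^ k)) 0 a b
      simpa using this
    calc _ ≤ ∫ s in (0 : ℝ)..t, |∑ p ∈ latticeBox d (2 ^ k),
          (F (ω.shift s (p + z)) - G m (ω.shift s (p + z)))| :=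
          intervalIntegral.abs_integral_le_integral_abs ht.1
      _ ≤ ∫ s in (0 : ℝ)..t, ∑ x ∈ latticeBox d (2 * 2 ^ k),
          |F (ω.shift s x) - G m (ω.shift s x)| := by
          refine intervalIntegral.integral_mono_on ht.1 ?_ (hint _ _) fun s _ => ?_
          · exact (intervalIntegrable_sum_shift (F := fun ω => F ω - G m ω) hsub _ _ _ _).abs
          · exact (Finset.abs_sum_le_sum_abs _ _).trans
              (sum_latticeBox_add_le hz (h := fun x => |F (ω.shift s x) - G m (ω.shift s x)|)
                fun _ => abs_nonneg _)
      _ ≤ ∫ s in (0 : ℝ)..4 ^ k, ∑ x ∈ latticeBox d (2 * 2 ^ k),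
          |F (ω.shift s x) - G m (ω.shift s x)| := by
          refine intervalIntegral.integral_mono_interval le_rfl ht.1 ht.2 ?_ (hint _ _)
          exact Eventually.of_forall fun s => Finset.sum_nonneg fun _ _ => abs_nonneg _
      _ ≤ (1 / 2) ^ m * (4 ^ k * (latticeBox d (2 * 2 ^ k)).card) := hm1 k
      _ ≤ (1 / 2) ^ m * (4 ^ k * (2 ^ d * (latticeBox d (2 ^ k)).card)) := by
          gcongr
          exact card_latticeBox_two_mul_le d (2 ^ k)
      _ = ((1 / 2) ^ m * 2 ^ d) * (4 ^ k * (latticeBox d (2 ^ k)).card) := by ring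
      _ ≤ _ := by gcongr
  have heq : ∫ s in (0 : ℝ)..t, ∑ p ∈ latticeBox d (2 ^ k), F (ω.shift s (p + z))
      = (∫ s in (0 : ℝ)..t, ∑ p ∈ latticeBox d (2 ^ k),
          (F (ω.shift s (p + z)) - G m (ω.shift s (p + z))))
        + ∫ s in (0 : ℝ)..t, ∑ p ∈ latticeBox d (2 ^ k), G m (ω.shift s (p + z)) := by
    rw [← intervalIntegral.integral_add
      (intervalIntegrable_sum_shift (F := fun ω => F ω - G m ω) hsub _ _ _ _)
      (intervalIntegrable_sum_shift (h4 m) _ _ _ _)]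
    simp only [← Finset.sum_add_distrib, sub_add_cancel]
  rw [heq]
  refine (abs_add_le _ _).trans ?_
  have := hk z hz t ht
  linarith

end StationaryErgodicLaw

/-! ### From coboundaries to all centred functions -/

namespace StationaryErgodicLaw

variable {d : ℕ} [MeasurableSpace (Env d)] {P : Measure (Env d)}

/-- Invariant functions are constant. -/
theorem ae_eq_const_of_invariant [IsProbabilityMeasure P] (hP : StationaryErgodicLaw P)
    {f : Env d → ℝ} (hf : AEStronglyMeasurable f P)
    (hinv : ∀ (t : ℝ) (x : Fin d → ℤ), (fun ω => f (ω.shift t x)) =ᵐ[P] f) :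
    ∃ c, f =ᵐ[P] fun _ => c := by
  set f' := hf.mk f with hf'
  have hm : Measurable f' := hf.stronglyMeasurable_mk.measurable
  have hff' : f =ᵐ[P] f' := hf.ae_eq_mk
  have hinv' : ∀ (t : ℝ) (x : Fin d → ℤ), (fun ω => f' (ω.shift t x)) =ᵐ[P] f' := by
    intro t x
    have h1 := (hP.measurePreserving t x).quasiMeasurePreserving.ae_eq_comp hff'
    exact h1.symm.trans ((hinv t x).trans hff')
  -- The preimage of each measurable set is invariant, so has probability 0 or 1. As such sets
  -- separate the points of ℝ, the function is a.e. constant.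
  obtain ⟨c, hc⟩ := exists_eventuallyEq_const_of_forall_separating (f := f') (l := ae P)
    MeasurableSet (fun U hU => by
      have hA : MeasurableSet (f' ⁻¹' U) := hm hU
      rcases hP.ergodic _ hA (fun t x => by
        rw [Env.shift_image]
        have : (Env.shift (-t) (-x) ⁻¹' (f' ⁻¹' U) : Set (Env d))
            =ᵐ[P] (f' ⁻¹' U : Set (Env d)) := by
          filter_upwards [hinv' (-t) (-x)] with ω hω
          change (f' (ω.shift (-t) (-x)) ∈ U) = (f' ω ∈ U)
          rw [hω]
        exact measure_symmDiff_eq_zero_iff.2 this.symm) with h | h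
      · right
        exact measure_eq_zero_iff_ae_notMem.1 h
      · left
        exact (prob_compl_eq_zero_iff hA).2 h)
  exact ⟨c, hff'.trans hc⟩

/-- Orthogonality to the coboundary of an indicator, with the shift moved to `f` by stationarity,
equates the integrals of `f` and of its shift over every measurable set. -/
theorem invariant_of_integral_coboundary [IsProbabilityMeasure P] (hP : StationaryErgodicLaw P)
    {f : Env d → ℝ} (hf : Integrable f P)
    (h : ∀ (g : Env d → ℝ), Measurable g → (∃ C, ∀ ω, |g ω| ≤ C) → ∀ (t : ℝ) (x : Fin d → ℤ),
      ∫ ω, f ω * (g (ω.shift t x) - g ω) ∂P = 0) (t : ℝ) (x : Fin d → ℤ) :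
    (fun ω => f (ω.shift t x)) =ᵐ[P] f := by
  refine Integrable.ae_eq_of_forall_setIntegral_eq _ _ (hP.integrable_comp_shift hf t x) hf ?_
  intro A hA _
  have hgm : Measurable (A.indicator (fun _ => (1 : ℝ))) := measurable_const.indicator hA
  have hgb : ∀ ω, |A.indicator (fun _ => (1 : ℝ)) ω| ≤ 1 := fun ω => by
    by_cases hω : ω ∈ A <;> simp [hω]
  have h1 := h _ hgm ⟨1, hgb⟩ (-t) (-x)
  have hmul : ∀ (F : Env d → ℝ), Integrable F P → ∀ s y,
      Integrable (fun ω => F ω * A.indicator (fun _ => (1 : ℝ)) (ω.shift s y)) P := by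
    intro F hF s y
    refine hF.mul_bdd (c := 1) ((hgm.comp (hP.measurable_shift_fixed s y)).aestronglyMeasurable) ?_
    exact Eventually.of_forall fun ω => by simpa using hgb _
  simp only [mul_sub] at h1
  rw [integral_sub (hmul f hf _ _) (by simpa using hmul f hf 0 0)] at h1
  have h2 := hP.integral_comp_shift (hmul f hf (-t) (-x)).aestronglyMeasurable t x
  simp only [Env.shift_shift, neg_add_cancel, Env.shift_zero] at h2
  have h3 : ∀ F : Env d → ℝ, ∫ ω, F ω * A.indicator (fun _ => (1 : ℝ)) ω ∂P = ∫ ω in A, F ω ∂P := by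
    intro F
    rw [← integral_indicator hA]
    congr 1
    ext ω
    by_cases hω : ω ∈ A <;> simp [hω]
  rw [← h2, h3, h3] at h1
  linarith

/-- Mean zero square integrable functions have vanishing averages. -/
theorem uniformZeroAverages_of_memLp [IsProbabilityMeasure P] (hP : StationaryErgodicLaw P)
    {F : Env d → ℝ} (hF : MemLp F 2 P) (h0 : ∫ ω, F ω ∂P = 0) : HasUniformZeroAverages P F := by
  have hint : ∀ f : Lp ℝ 2 P, Integrable f P := fun f => (Lp.memLp f).integrable (by norm_num)
  -- Von Neumann's argument: the good functions form a closed subspace of L² containing the bounded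
  -- coboundaries. A vector orthogonal to it is invariant, hence constant, hence orthogonal to the
  -- centred function `F`. So `F` lies in the double orthogonal complement, which is `W`.
  let W : Submodule ℝ (Lp ℝ 2 P) :=
    { carrier := {f | HasUniformZeroAverages P f}
      add_mem' := fun {f g} hf hg => hP.uniformZeroAverages_congr
        (by filter_upwards [Lp.coeFn_add f g] with ω hω; rw [hω]; rfl)
        (hP.uniformZeroAverages_add (hint f) (hint g) hf hg)
      zero_mem' := hP.uniformZeroAverages_congr (F := fun ω => 0 * (0 : Lp ℝ 2 P) ω)
        (by filter_upwards [Lp.coeFn_zero ℝ 2 P] with ω hω; rw [hω]; simp)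
        (hP.uniformZeroAverages_congr
          (F := fun ω => (fun _ => (0 : ℝ)) (ω.shift 0 0) - (fun _ => (0 : ℝ)) ω)
          (Eventually.of_forall fun ω => by simp)
          (hP.uniformZeroAverages_coboundary (g := fun _ => (0 : ℝ)) measurable_const (C := 0)
            (by simp) 0 0))
      smul_mem' := fun c f hf => hP.uniformZeroAverages_congr
        (by filter_upwards [Lp.coeFn_smul c f] with ω hω; rw [hω]; rfl)
        (uniformZeroAverages_const_mul c hf) }
  have hclosed : IsClosed (W : Set (Lp ℝ 2 P)) := by
    rw [isClosed_iff_clusterPt]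
    intro f hf
    have hf' : f ∈ closure (W : Set (Lp ℝ 2 P)) := mem_closure_iff_clusterPt.2 hf
    refine hP.uniformZeroAverages_of_approx (hint f) fun ε hε => ?_
    obtain ⟨g, hg, hfg⟩ := Metric.mem_closure_iff.1 hf' ε hε
    refine ⟨g, hint g, hg, ?_⟩
    have h1 : ∫ ω, |f ω - g ω| ∂P = (eLpNorm (fun ω => (f - g : Lp ℝ 2 P) ω) 1 P).toReal := by
      rw [eLpNorm_one_eq_lintegral_enorm, ← integral_norm_eq_lintegral_enorm
        (Lp.aestronglyMeasurable _)]
      refine integral_congr_ae ?_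
      filter_upwards [Lp.coeFn_sub f g] with ω hω
      rw [hω]
      rfl
    rw [h1]
    have h2 : eLpNorm (fun ω => (f - g : Lp ℝ 2 P) ω) 1 P
        ≤ eLpNorm (fun ω => (f - g : Lp ℝ 2 P) ω) 2 P :=
      eLpNorm_le_eLpNorm_of_exponent_le (by norm_num) (Lp.aestronglyMeasurable _)
    refine (ENNReal.toReal_mono (Lp.eLpNorm_ne_top _) h2).trans ?_
    rw [← Lp.norm_def, ← dist_eq_norm]
    exact hfg.le
  have hmem : hF.toLp F ∈ W := by
    have hW : W.topologicalClosure = W := hclosed.submodule_topologicalClosure_eq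
    rw [← hW, ← Submodule.orthogonal_orthogonal_eq_closure, Submodule.mem_orthogonal]
    intro u hu
    rw [Submodule.mem_orthogonal'] at hu
    have hinv : ∀ (t : ℝ) (x : Fin d → ℤ), (fun ω => u (ω.shift t x)) =ᵐ[P] u := by
      refine hP.invariant_of_integral_coboundary (hint u) ?_
      rintro g hg ⟨C, hC⟩ t x
      have hgL : MemLp (fun ω => g (ω.shift t x) - g ω) 2 P := by
        refine MemLp.of_bound ((hg.comp (hP.measurable_shift_fixed t x)).sub
          hg).aestronglyMeasurable (C + C) (Eventually.of_forall fun ω => ?_)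
        exact (abs_sub _ _).trans (add_le_add (hC _) (hC _))
      have hgW : hgL.toLp _ ∈ W := hP.uniformZeroAverages_congr hgL.coeFn_toLp.symm
        (hP.uniformZeroAverages_coboundary hg hC t x)
      have := hu _ hgW
      rw [L2.inner_def] at this
      rw [← this]
      refine integral_congr_ae ?_
      filter_upwards [hgL.coeFn_toLp] with ω hω
      rw [hω]
      simp [mul_comm]
    obtain ⟨c, hc⟩ := hP.ae_eq_const_of_invariant (Lp.aestronglyMeasurable u) hinv
    rw [L2.inner_def]
    have : ∫ ω, inner ℝ (u ω) (hF.toLp F ω) ∂P = ∫ ω, c * F ω ∂P := by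
      refine integral_congr_ae ?_
      filter_upwards [hc, hF.coeFn_toLp] with ω h1 h2
      rw [h1, h2]
      simp [mul_comm]
    rw [this, integral_const_mul, h0, mul_zero]
  exact hP.uniformZeroAverages_congr hF.coeFn_toLp hmem

/-- The ergodic theorem over dyadic parabolic boxes. -/
theorem uniformZeroAverages_of_integrable [IsProbabilityMeasure P] (hP : StationaryErgodicLaw P)
    {F : Env d → ℝ} (hF : Integrable F P) (h0 : ∫ ω, F ω ∂P = 0) :
    HasUniformZeroAverages P F := by
  refine hP.uniformZeroAverages_of_approx hF fun ε hε => ?_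
  obtain ⟨g, hg, hgm⟩ := (memLp_one_iff_integrable.2 hF).exists_simpleFunc_eLpNorm_sub_lt
    (by norm_num) (ε := ENNReal.ofReal (ε / 2)) (by simpa using half_pos hε)
  have hgi : Integrable g P := memLp_one_iff_integrable.1 hgm
  have hg2 : MemLp g 2 P := g.memLp_of_isFiniteMeasure 2 P
  set c := ∫ ω, g ω ∂P with hc
  have hfg : ∫ ω, |F ω - g ω| ∂P ≤ ε / 2 := by
    have h1 : ∫ ω, |F ω - g ω| ∂P = (eLpNorm (F - ⇑g) 1 P).toReal := by
      rw [eLpNorm_one_eq_lintegral_enorm, ← integral_norm_eq_lintegral_enorm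
        (hF.sub hgi).aestronglyMeasurable]
      rfl
    rw [h1]
    exact ENNReal.toReal_le_of_le_ofReal (half_pos hε).le hg.le
  -- As `F` has mean zero, recentring the approximant costs no more than the approximation error.
  have hcb : |c| ≤ ε / 2 := by
    have : c = -∫ ω, (F ω - g ω) ∂P := by
      rw [integral_sub hF hgi, h0]
      simp [hc]
    rw [this, abs_neg]
    exact (abs_integral_le_integral_abs).trans hfg
  refine ⟨fun ω => g ω - c, hgi.sub (integrable_const c), ?_, ?_⟩
  · refine hP.uniformZeroAverages_of_memLp (hg2.sub (memLp_const c)) ?_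
    rw [integral_sub hgi (integrable_const c)]
    simp [hc]
  · calc ∫ ω, |F ω - (g ω - c)| ∂P ≤ ∫ ω, (|F ω - g ω| + |c|) ∂P := by
          refine integral_mono (hF.sub (hgi.sub (integrable_const c))).abs
            ((hF.sub hgi).abs.add (integrable_const _)) fun ω => ?_
          have : F ω - (g ω - c) = (F ω - g ω) + c := by ring
          simp only [this]
          exact abs_add_le _ _
      _ = ∫ ω, |F ω - g ω| ∂P + |c| := by
          rw [integral_add (f := fun ω => |F ω - g ω|) (hF.sub hgi).abs (integrable_const _)]
          simp
      _ ≤ ε := by linarith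

end StationaryErgodicLaw

/-! ### Poincaré inequality on boxes -/

theorem abs_sub_le_sum_abs_sub {n : ℕ} (f : ℤ → ℝ) {v w : ℤ}
    (hv : v ∈ Finset.Icc (-(n : ℤ)) n) (hw : w ∈ Finset.Icc (-(n : ℤ)) n) :
    |f v - f w| ≤ ∑ u ∈ Finset.Icc (-(n : ℤ)) n, |f (u + 1) - f u| := by
  wlog hvw : v ≤ w generalizing v w
  · rw [abs_sub_comm]
    exact this hw hv (le_of_not_ge hvw)
  have key : ∀ w, v ≤ w → |f v - f w| ≤ ∑ u ∈ Finset.Ico v w, |f (u + 1) - f u| := by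
    intro w hw
    induction w, hw using Int.leInduction with
    | base => simp
    | succ w hw ih =>
      have : Finset.Ico v (w + 1) = insert w (Finset.Ico v w) := by
        ext a
        simp only [Finset.mem_Ico, Finset.mem_insert]
        omega
      rw [this, Finset.sum_insert (by simp)]
      calc |f v - f (w + 1)| ≤ |f v - f w| + |f w - f (w + 1)| := abs_sub_le _ _ _
        _ ≤ _ := by
          rw [abs_sub_comm (f w)]
          linarith
  refine (key w hvw).trans (Finset.sum_le_sum_of_subset_of_nonneg ?_ fun _ _ _ => abs_nonneg _)
  intro a ha
  rw [Finset.mem_Icc] at *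
  rw [Finset.mem_Ico] at ha
  omega

theorem update_mem_latticeBox {d n : ℕ} {x : Fin d → ℤ} (hx : x ∈ latticeBox d n) (i : Fin d)
    {u : ℤ} (hu : u ∈ Finset.Icc (-(n : ℤ)) n) : Function.update x i u ∈ latticeBox d n := by
  rw [mem_latticeBox] at *
  rw [Finset.mem_Icc] at hu
  intro j
  by_cases hj : j = i
  · subst hj
    simpa using hu
  · simpa [hj] using hx j

theorem apply_mem_Icc_of_mem_latticeBox {d n : ℕ} {x : Fin d → ℤ} (hx : x ∈ latticeBox d n)
    (i : Fin d) : x i ∈ Finset.Icc (-(n : ℤ)) n := by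
  rw [Finset.mem_Icc]
  exact mem_latticeBox.1 hx i

theorem piecewise_mem_latticeBox {d n : ℕ} {x y : Fin d → ℤ} (hx : x ∈ latticeBox d n)
    (hy : y ∈ latticeBox d n) (s : Finset (Fin d)) : s.piecewise x y ∈ latticeBox d n := by
  rw [mem_latticeBox] at *
  intro i
  by_cases hi : i ∈ s
  · simpa [hi] using hx i
  · simpa [hi] using hy i

/-- Exchanging the i-th coordinate of `w` with `u` is an involution of the index set, so each point
is counted once per value of the discarded coordinate. -/
theorem sum_sum_update_eq {d n : ℕ} (i : Fin d) (D : (Fin d → ℤ) → ℝ) :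
    ∑ w ∈ latticeBox d n, ∑ u ∈ Finset.Icc (-(n : ℤ)) n, D (Function.update w i u)
      = (2 * n + 1) * ∑ x ∈ latticeBox d n, D x := by
  rw [← Finset.sum_product']
  have h1 : ∑ q ∈ latticeBox d n ×ˢ Finset.Icc (-(n : ℤ)) n, D (Function.update q.1 i q.2)
      = ∑ q ∈ latticeBox d n ×ˢ Finset.Icc (-(n : ℤ)) n, D q.1 := by
    refine Finset.sum_nbij' (fun q => (Function.update q.1 i q.2, q.1 i))
      (fun q => (Function.update q.1 i q.2, q.1 i)) ?_ ?_ ?_ ?_ ?_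
    · intro q hq
      rw [Finset.mem_product] at hq ⊢
      exact ⟨update_mem_latticeBox hq.1 i hq.2, apply_mem_Icc_of_mem_latticeBox hq.1 i⟩
    · intro q hq
      rw [Finset.mem_product] at hq ⊢
      exact ⟨update_mem_latticeBox hq.1 i hq.2, apply_mem_Icc_of_mem_latticeBox hq.1 i⟩
    · intro q _
      simp
    · intro q _
      simp
    · intro q _
      rfl
  rw [h1, Finset.sum_product, Finset.mul_sum]
  refine Finset.sum_congr rfl fun x _ => ?_
  simp only
  rw [Finset.sum_const, Int.card_Icc, nsmul_eq_mul]
  congr 1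
  have : ((n : ℤ) + 1 - -(n : ℤ)).toNat = 2 * n + 1 := by omega
  rw [this]
  push_cast
  ring

/-- Move from `x` to `y` one coordinate of `s` at a time. Each move is bounded by the total
variation along a coordinate line. Induction over `s` avoids choosing paths. -/
theorem sum_sum_abs_sub_piecewise_le {d n : ℕ} (h : (Fin d → ℤ) → ℝ) (s : Finset (Fin d)) :
    ∑ x ∈ latticeBox d n, ∑ y ∈ latticeBox d n, |h x - h (s.piecewise y x)|
      ≤ (latticeBox d n).card * (2 * n + 1) *
        ∑ i ∈ s, ∑ x ∈ latticeBox d n, |h (x + Pi.single i 1) - h x| := by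
  induction s using Finset.induction_on with
  | empty => simp
  | insert a s ha ih =>
    rw [Finset.sum_insert ha]
    set V : (Fin d → ℤ) → ℝ := fun w => ∑ u ∈ Finset.Icc (-(n : ℤ)) n,
      |h (Function.update w a (u + 1)) - h (Function.update w a u)| with hV
    have hstep : ∀ x ∈ latticeBox d n, ∀ y ∈ latticeBox d n,
        |h x - h ((insert a s).piecewise y x)| ≤ |h x - h (s.piecewise y x)|
          + V (s.piecewise y x) := by
      intro x hx y hy
      refine (abs_sub_le _ (h (s.piecewise y x)) _).trans (add_le_add le_rfl ?_)
      rw [Finset.piecewise_insert]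
      have := abs_sub_le_sum_abs_sub (n := n)
        (fun u => h (Function.update (s.piecewise y x) a u))
        (apply_mem_Icc_of_mem_latticeBox (piecewise_mem_latticeBox hy hx s) a)
        (apply_mem_Icc_of_mem_latticeBox hy a)
      simpa only [Function.update_eq_self] using this
    -- Exchanging the coordinates in `s` between `x` and `y` is an involution on pairs, so the
    -- intermediate point can be replaced by `x`.
    have hswap : ∑ x ∈ latticeBox d n, ∑ y ∈ latticeBox d n, V (s.piecewise y x)
        = (latticeBox d n).card * ∑ x ∈ latticeBox d n, V x := by
      rw [← Finset.sum_product']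
      have h1 : ∑ q ∈ latticeBox d n ×ˢ latticeBox d n, V (s.piecewise q.2 q.1)
          = ∑ q ∈ latticeBox d n ×ˢ latticeBox d n, V q.1 := by
        have hpw : ∀ x y : Fin d → ℤ,
            s.piecewise (s.piecewise x y) (s.piecewise y x) = x := by
          intro x y
          ext i
          by_cases hi : i ∈ s <;> simp [hi]
        refine Finset.sum_nbij' (fun q => (s.piecewise q.2 q.1, s.piecewise q.1 q.2))
          (fun q => (s.piecewise q.2 q.1, s.piecewise q.1 q.2)) ?_ ?_ ?_ ?_ ?_
        · intro q hq
          rw [Finset.mem_product] at hq ⊢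
          exact ⟨piecewise_mem_latticeBox hq.2 hq.1 s, piecewise_mem_latticeBox hq.1 hq.2 s⟩
        · intro q hq
          rw [Finset.mem_product] at hq ⊢
          exact ⟨piecewise_mem_latticeBox hq.2 hq.1 s, piecewise_mem_latticeBox hq.1 hq.2 s⟩
        · intro q _
          simp only [hpw]
        · intro q _
          simp only [hpw]
        · intro q _
          rfl
      rw [h1, Finset.sum_product, Finset.mul_sum]
      refine Finset.sum_congr rfl fun x _ => ?_
      simp only
      rw [Finset.sum_const, nsmul_eq_mul]
    have hVsum : ∑ x ∈ latticeBox d n, V x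
        = (2 * n + 1) * ∑ x ∈ latticeBox d n, |h (x + Pi.single a 1) - h x| := by
      rw [← sum_sum_update_eq a]
      refine Finset.sum_congr rfl fun w _ => Finset.sum_congr rfl fun u _ => ?_
      congr 3
      ext i
      by_cases hi : i = a
      · subst hi
        simp
      · simp [hi]
    calc _ ≤ ∑ x ∈ latticeBox d n, ∑ y ∈ latticeBox d n,
          (|h x - h (s.piecewise y x)| + V (s.piecewise y x)) :=
          Finset.sum_le_sum fun x hx => Finset.sum_le_sum fun y hy => hstep x hx y hy
      _ = (∑ x ∈ latticeBox d n, ∑ y ∈ latticeBox d n, |h x - h (s.piecewise y x)|)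
          + (latticeBox d n).card * ((2 * n + 1) *
            ∑ x ∈ latticeBox d n, |h (x + Pi.single a 1) - h x|) := by
          simp only [Finset.sum_add_distrib]
          rw [hswap, hVsum]
      _ ≤ _ := by
          rw [mul_add]
          linarith

/-- The Poincaré inequality in `ℓ¹` on a box. -/
theorem sum_sum_abs_sub_le {d n : ℕ} (h : (Fin d → ℤ) → ℝ) :
    ∑ x ∈ latticeBox d n, ∑ y ∈ latticeBox d n, |h x - h y|
      ≤ (latticeBox d n).card * (2 * n + 1) *
        ∑ i, ∑ x ∈ latticeBox d n, |h (x + Pi.single i 1) - h x| := by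
  simpa using sum_sum_abs_sub_piecewise_le (n := n) h Finset.univ

/-! ### Sublinearity from spatial and temporal oscillation bounds -/

/-- The powers of 2 below 2^k sum to less than 2^k, so small increments accumulate to a small
multiple of 2^k; the value at the initial scale is eventually negligible. -/
theorem eventually_abs_le_of_dyadic_increments {a : ℕ → ℝ}
    (h : ∀ ε > (0 : ℝ), ∀ᶠ k : ℕ in atTop, |a (k + 1) - a k| ≤ ε * 2 ^ k) :
    ∀ ε > (0 : ℝ), ∀ᶠ k : ℕ in atTop, |a k| ≤ ε * 2 ^ k := by
  intro ε hε
  obtain ⟨K, hK⟩ := eventually_atTop.1 (h (ε / 2) (half_pos hε))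
  have hind : ∀ k, K ≤ k → |a k| ≤ |a K| + ε / 2 * 2 ^ k := by
    intro k hk
    induction k, hk using Nat.le_induction with
    | base =>
      have : (0 : ℝ) ≤ ε / 2 * 2 ^ K := by positivity
      linarith
    | succ k hk ih =>
      have h1 := hK k hk
      have h2 : |a (k + 1)| ≤ |a (k + 1) - a k| + |a k| := by
        simpa using abs_add_le (a (k + 1) - a k) (a k)
      rw [pow_succ]
      linarith
  have hev : ∀ᶠ k : ℕ in atTop, |a K| ≤ ε / 2 * 2 ^ k :=
    ((tendsto_pow_atTop_atTop_of_one_lt (by norm_num : (1 : ℝ) < 2)).const_mul_atTop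
      (half_pos hε)).eventually_ge_atTop _
  filter_upwards [hev, eventually_ge_atTop K] with k h1 h2
  have := hind k h2
  linarith

/-- Small oscillation in space at each scale, together with small motion in time of a spatial
average, places `X` close to a constant on each cylinder. The constants of consecutive scales are
compared on the smaller cylinder, so no normalization at a single point is needed. -/
theorem eventually_integral_le_of_oscillation {d : ℕ} {X : (Fin d → ℤ) → ℝ → ℝ}
    (hc : ∀ x, Continuous (X x))
    (hspace : ∀ ε > (0 : ℝ), ∀ᶠ k : ℕ in atTop,
      ∫ t in (0 : ℝ)..4 ^ k, ∑ x ∈ latticeBox d (2 * 2 ^ k), ∑ y ∈ latticeBox d (2 * 2 ^ k),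
        |X x t - X y t| ≤ ε * (2 ^ k * 4 ^ k * ((latticeBox d (2 * 2 ^ k)).card : ℝ) ^ 2))
    (htime : ∀ ε > (0 : ℝ), ∀ᶠ k : ℕ in atTop, ∀ t ∈ Set.Icc (0 : ℝ) (4 ^ k),
      |∑ q ∈ latticeBox d (2 ^ k), ∑ p ∈ latticeBox d (2 ^ k), (X (p + q) t - X (p + q) 0)|
        ≤ ε * (2 ^ k * ((latticeBox d (2 ^ k)).card : ℝ) ^ 2)) :
    ∀ ε > (0 : ℝ), ∀ᶠ k : ℕ in atTop,
      ∫ t in (0 : ℝ)..4 ^ k, ∑ x ∈ latticeBox d (2 * 2 ^ k), |X x t|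
        ≤ ε * (2 ^ k * 4 ^ k * (latticeBox d (2 * 2 ^ k)).card) := by
  have hcard : ∀ n, (0 : ℝ) < (latticeBox d n).card := fun n => by
    exact_mod_cast Finset.card_pos.2 ⟨0, zero_mem_latticeBox d n⟩
  -- The average is taken twice because `htime` controls only this double sum. The points p + q stay
  -- in the doubled box, on which the spatial oscillation is controlled.
  set M : ℕ → ℝ → ℝ := fun k t =>
    (∑ q ∈ latticeBox d (2 ^ k), ∑ p ∈ latticeBox d (2 ^ k), X (p + q) t)
      / ((latticeBox d (2 ^ k)).card : ℝ) ^ 2 with hM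
  have hint : ∀ (k : ℕ) (c : ℝ) (a b : ℝ), IntervalIntegrable
      (fun t => ∑ x ∈ latticeBox d (2 * 2 ^ k), |X x t - c|) volume a b := fun k c a b =>
    (continuous_finsetSum _ fun x _ => ((hc x).sub continuous_const).abs).intervalIntegrable _ _
  -- oscillation around the spatial average at the same time
  have hosc : ∀ (k : ℕ) (t : ℝ), ∑ x ∈ latticeBox d (2 * 2 ^ k), |X x t - M k t|
      ≤ 2 ^ d / (latticeBox d (2 * 2 ^ k)).card * ∑ x ∈ latticeBox d (2 * 2 ^ k),
        ∑ y ∈ latticeBox d (2 * 2 ^ k), |X x t - X y t| := by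
    intro k t
    rw [Finset.mul_sum]
    refine Finset.sum_le_sum fun x _ => ?_
    have hB := hcard (2 ^ k)
    have hB' := hcard (2 * 2 ^ k)
    have h1 : X x t - M k t = (∑ q ∈ latticeBox d (2 ^ k), ∑ p ∈ latticeBox d (2 ^ k),
        (X x t - X (p + q) t)) / ((latticeBox d (2 ^ k)).card : ℝ) ^ 2 := by
      rw [hM]
      simp only [Finset.sum_sub_distrib, Finset.sum_const, nsmul_eq_mul]
      field_simp
    have h2 : |∑ q ∈ latticeBox d (2 ^ k), ∑ p ∈ latticeBox d (2 ^ k), (X x t - X (p + q) t)|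
        ≤ (latticeBox d (2 ^ k)).card * ∑ y ∈ latticeBox d (2 * 2 ^ k), |X x t - X y t| := by
      refine (Finset.abs_sum_le_sum_abs _ _).trans ?_
      rw [← nsmul_eq_mul]
      refine Finset.sum_le_card_nsmul _ _ _ fun q hq => ?_
      exact (Finset.abs_sum_le_sum_abs _ _).trans
        (sum_latticeBox_add_le hq (h := fun y => |X x t - X y t|) fun _ => abs_nonneg _)
    rw [h1, abs_div, abs_of_pos (by positivity : (0 : ℝ) < ((latticeBox d (2 ^ k)).card : ℝ) ^ 2),
      div_le_iff₀ (by positivity)]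
    refine h2.trans ?_
    set osc := ∑ y ∈ latticeBox d (2 * 2 ^ k), |X x t - X y t|
    have h_osc : 0 ≤ osc := Finset.sum_nonneg fun _ _ => abs_nonneg _
    have h3 := card_latticeBox_two_mul_le d (2 ^ k)
    have h4 : (1 : ℝ) ≤ 2 ^ d / (latticeBox d (2 * 2 ^ k)).card * (latticeBox d (2 ^ k)).card := by
      rw [div_mul_eq_mul_div, le_div_iff₀ hB']
      linarith
    calc _ = 1 * ((latticeBox d (2 ^ k)).card * osc) := by ring
      _ ≤ (2 ^ d / (latticeBox d (2 * 2 ^ k)).card * (latticeBox d (2 ^ k)).card)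
          * ((latticeBox d (2 ^ k)).card * osc) := by gcongr
      _ = _ := by ring
  have hdev : ∀ ε > (0 : ℝ), ∀ᶠ k : ℕ in atTop,
      ∫ t in (0 : ℝ)..4 ^ k, ∑ x ∈ latticeBox d (2 * 2 ^ k), |X x t - M k 0|
        ≤ ε * (2 ^ k * 4 ^ k * (latticeBox d (2 * 2 ^ k)).card) := by
    intro ε hε
    filter_upwards [hspace (ε / 2 / 2 ^ d) (by positivity), htime (ε / 2) (half_pos hε)]
      with k h1 h2
    have h4 : (0 : ℝ) ≤ 4 ^ k := by positivity
    have hB' := hcard (2 * 2 ^ k)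
    have hB := hcard (2 ^ k)
    set A : ℝ → ℝ := fun t => ∑ x ∈ latticeBox d (2 * 2 ^ k),
        ∑ y ∈ latticeBox d (2 * 2 ^ k), |X x t - X y t| with hA
    have hAc : Continuous A := continuous_finsetSum _ fun x _ => continuous_finsetSum _ fun y _ =>
      ((hc x).sub (hc y)).abs
    have hAc' : Continuous fun t => 2 ^ d / ((latticeBox d (2 * 2 ^ k)).card : ℝ) * A t :=
      continuous_const.mul hAc
    have hpt : ∀ t ∈ Set.Icc (0 : ℝ) (4 ^ k), ∑ x ∈ latticeBox d (2 * 2 ^ k), |X x t - M k 0|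
        ≤ 2 ^ d / (latticeBox d (2 * 2 ^ k)).card * A t
          + (latticeBox d (2 * 2 ^ k)).card * (ε / 2 * 2 ^ k) := by
      intro t ht
      have hMt : |M k t - M k 0| ≤ ε / 2 * 2 ^ k := by
        have h3 := h2 t ht
        simp only [Finset.sum_sub_distrib] at h3
        rw [hM]
        simp only
        rw [← sub_div, abs_div,
          abs_of_pos (by positivity : (0 : ℝ) < ((latticeBox d (2 ^ k)).card : ℝ) ^ 2),
          div_le_iff₀ (by positivity)]
        linarith
      calc _ ≤ ∑ x ∈ latticeBox d (2 * 2 ^ k), (|X x t - M k t| + ε / 2 * 2 ^ k) := by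
            refine Finset.sum_le_sum fun x _ => ?_
            exact (abs_sub_le _ (M k t) _).trans (by linarith)
        _ ≤ _ := by
            rw [Finset.sum_add_distrib, Finset.sum_const, nsmul_eq_mul]
            linarith [hosc k t]
    calc _ ≤ ∫ t in (0 : ℝ)..4 ^ k, (2 ^ d / (latticeBox d (2 * 2 ^ k)).card * A t
          + (latticeBox d (2 * 2 ^ k)).card * (ε / 2 * 2 ^ k)) :=
          intervalIntegral.integral_mono_on h4 (hint k _ _ _)
            ((hAc'.add continuous_const).intervalIntegrable _ _) hpt
      _ = 2 ^ d / (latticeBox d (2 * 2 ^ k)).card * (∫ t in (0 : ℝ)..4 ^ k, A t)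
          + 4 ^ k * ((latticeBox d (2 * 2 ^ k)).card * (ε / 2 * 2 ^ k)) := by
          rw [intervalIntegral.integral_add (hAc'.intervalIntegrable _ _)
            (continuous_const.intervalIntegrable _ _), intervalIntegral.integral_const_mul,
            intervalIntegral.integral_const, sub_zero, smul_eq_mul]
      _ ≤ 2 ^ d / (latticeBox d (2 * 2 ^ k)).card *
            (ε / 2 / 2 ^ d * (2 ^ k * 4 ^ k * ((latticeBox d (2 * 2 ^ k)).card : ℝ) ^ 2))
          + 4 ^ k * ((latticeBox d (2 * 2 ^ k)).card * (ε / 2 * 2 ^ k)) := by gcongr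
      _ = _ := by
          field_simp
          ring
  have hmean : ∀ ε > (0 : ℝ), ∀ᶠ k : ℕ in atTop, |M k 0| ≤ ε * 2 ^ k := by
    refine eventually_abs_le_of_dyadic_increments (a := fun k => M k 0) fun ε hε => ?_
    -- The error at scale k counts once. The error at scale k + 1 is normalized by a volume larger
    -- by at most 4·2^d and by a length larger by 2, hence 8·2^d.
    have hδ : 0 < ε / (1 + 8 * 2 ^ d) := by positivity
    have hd1 := hdev _ hδ
    have hd2 := (tendsto_add_atTop_nat 1).eventually hd1
    filter_upwards [hd1, hd2] with k h1 h2
    have hB' := hcard (2 * 2 ^ k)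
    have h4 : (0 : ℝ) < 4 ^ k := by positivity
    have hbox : latticeBox d (2 * 2 ^ k) ⊆ latticeBox d (2 * 2 ^ (k + 1)) :=
      latticeBox_mono (Nat.mul_le_mul_left 2 (Nat.pow_le_pow_right (by norm_num) k.le_succ))
    have h3 : ∫ t in (0 : ℝ)..4 ^ k, ∑ x ∈ latticeBox d (2 * 2 ^ k), |X x t - M (k + 1) 0|
        ≤ ∫ t in (0 : ℝ)..4 ^ (k + 1), ∑ x ∈ latticeBox d (2 * 2 ^ (k + 1)),
          |X x t - M (k + 1) 0| := by
      calc _ ≤ ∫ t in (0 : ℝ)..4 ^ k, ∑ x ∈ latticeBox d (2 * 2 ^ (k + 1)),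
            |X x t - M (k + 1) 0| :=
            intervalIntegral.integral_mono_on h4.le (hint k _ _ _) (hint (k + 1) _ _ _)
              fun t _ => Finset.sum_le_sum_of_subset_of_nonneg hbox fun _ _ _ => abs_nonneg _
        _ ≤ _ := by
            refine intervalIntegral.integral_mono_interval le_rfl h4.le
              (pow_le_pow_right₀ (by norm_num) k.le_succ) ?_ (hint (k + 1) _ _ _)
            exact Eventually.of_forall fun s => Finset.sum_nonneg fun _ _ => abs_nonneg _
    have h5 : 4 ^ k * ((latticeBox d (2 * 2 ^ k)).card * |M (k + 1) 0 - M k 0|)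
        ≤ (∫ t in (0 : ℝ)..4 ^ k, ∑ x ∈ latticeBox d (2 * 2 ^ k), |X x t - M k 0|)
          + ∫ t in (0 : ℝ)..4 ^ k, ∑ x ∈ latticeBox d (2 * 2 ^ k), |X x t - M (k + 1) 0| := by
      rw [← intervalIntegral.integral_add (hint k _ _ _) (hint k _ _ _)]
      have : 4 ^ k * ((latticeBox d (2 * 2 ^ k)).card * |M (k + 1) 0 - M k 0|)
          = ∫ t in (0 : ℝ)..4 ^ k, ∑ x ∈ latticeBox d (2 * 2 ^ k), |M (k + 1) 0 - M k 0| := by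
        rw [intervalIntegral.integral_const, Finset.sum_const]
        simp
      rw [this]
      refine intervalIntegral.integral_mono_on h4.le (continuous_const.intervalIntegrable _ _)
        ((hint k _ _ _).add (hint k _ _ _)) fun t _ => ?_
      rw [← Finset.sum_add_distrib]
      refine Finset.sum_le_sum fun x _ => ?_
      have := abs_sub_le (M (k + 1) 0) (X x t) (M k 0)
      rw [abs_sub_comm (M (k + 1) 0) (X x t)] at this
      linarith
    have h6 : ((latticeBox d (2 * 2 ^ (k + 1))).card : ℝ)
        ≤ 2 ^ d * (latticeBox d (2 * 2 ^ k)).card := by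
      have := card_latticeBox_two_mul_le d (2 * 2 ^ k)
      rwa [← mul_assoc, mul_comm (2 * 2) (2 ^ k), ← mul_assoc, ← pow_succ, mul_comm _ 2] at this
    set N : ℝ := ((latticeBox d (2 * 2 ^ k)).card : ℝ) with hN
    set δ := ε / (1 + 8 * 2 ^ d) with hδdef
    have h7 : (4 ^ k * N) * |M (k + 1) 0 - M k 0| ≤ (4 ^ k * N) * (ε * 2 ^ k) := by
      calc _ = 4 ^ k * (N * |M (k + 1) 0 - M k 0|) := by ring
        _ ≤ δ * (2 ^ k * 4 ^ k * N) + δ * (2 ^ (k + 1) * 4 ^ (k + 1)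
            * (latticeBox d (2 * 2 ^ (k + 1))).card) := h5.trans (add_le_add h1 (h3.trans h2))
        _ ≤ δ * (2 ^ k * 4 ^ k * N) + δ * (2 ^ (k + 1) * 4 ^ (k + 1) * (2 ^ d * N)) := by gcongr
        _ = (4 ^ k * N) * ((δ * (1 + 8 * 2 ^ d)) * 2 ^ k) := by ring
        _ = _ := by rw [hδdef, div_mul_cancel₀ _ (by positivity)]
    exact le_of_mul_le_mul_left h7 (by positivity)
  intro ε hε
  filter_upwards [hdev (ε / 2) (half_pos hε), hmean (ε / 2) (half_pos hε)] with k h1 h2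
  have h4 : (0 : ℝ) ≤ 4 ^ k := by positivity
  calc _ ≤ ∫ t in (0 : ℝ)..4 ^ k, ((∑ x ∈ latticeBox d (2 * 2 ^ k), |X x t - M k 0|)
        + (latticeBox d (2 * 2 ^ k)).card * |M k 0|) := by
        refine intervalIntegral.integral_mono_on h4 (by simpa using hint k 0 0 (4 ^ k))
          ((hint k _ _ _).add (continuous_const.intervalIntegrable _ _)) fun t _ => ?_
        rw [← nsmul_eq_mul, ← Finset.sum_const, ← Finset.sum_add_distrib]
        refine Finset.sum_le_sum fun x _ => ?_
        simpa using abs_add_le (X x t - M k 0) (M k 0)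
    _ = (∫ t in (0 : ℝ)..4 ^ k, ∑ x ∈ latticeBox d (2 * 2 ^ k), |X x t - M k 0|)
        + 4 ^ k * ((latticeBox d (2 * 2 ^ k)).card * |M k 0|) := by
        rw [intervalIntegral.integral_add (hint k _ _ _)
          (continuous_const.intervalIntegrable _ _), intervalIntegral.integral_const]
        simp
    _ ≤ ε / 2 * (2 ^ k * 4 ^ k * (latticeBox d (2 * 2 ^ k)).card)
        + 4 ^ k * ((latticeBox d (2 * 2 ^ k)).card * (ε / 2 * 2 ^ k)) := by gcongr
    _ = _ := by ring

/-! ### The measure on gradient fields -/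

section GradMeasure

variable {d : ℕ} [MeasurableSpace (Env d)] {P : Measure (Env d)}

theorem StationaryErgodicLaw.integrable_cond_apply (hP : StationaryErgodicLaw P)
    (t : ℝ) (x y : Fin d → ℤ) : Integrable (fun ω : Env d => ω.cond t x y) P := by
  by_cases h : (latticeGraph d).Adj x y
  · convert hP.integrable_cond t ⟨s(x, y), h⟩ using 2 with ω
    simp [Env.cond, h]
  · simp [Env.cond, h]

theorem StationaryErgodicLaw.integrable_inv_cond_apply (hP : StationaryErgodicLaw P)
    (t : ℝ) (x y : Fin d → ℤ) : Integrable (fun ω : Env d => (ω.cond t x y)⁻¹) P := by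
  by_cases h : (latticeGraph d).Adj x y
  · convert hP.integrable_inv_cond t ⟨s(x, y), h⟩ using 2 with ω
    simp [Env.cond, h]
  · simp [Env.cond, h]

/-- The restriction of the gradient measure to the fields in direction `z`. -/
noncomputable def gradComponent (P : Measure (Env d)) (z : Fin d → ℤ) :
    Measure (Env d × (Fin d → ℤ)) :=
  (P.withDensity fun ω => ENNReal.ofReal (ω.cond 0 0 z)).map fun ω => (ω, z)

theorem gradComponent_eq_zero {z : Fin d → ℤ} (h : ¬ (latticeGraph d).Adj 0 z) :
    gradComponent P z = 0 := by
  simp [gradComponent, Env.cond, h]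

theorem gradMeasure_eq_sum [IsProbabilityMeasure P] :
    gradMeasure P = ∑ z ∈ latticeBall (0 : Fin d → ℤ) 1, gradComponent P z := by
  have h1 : gradMeasure P = Measure.sum fun z : Fin d → ℤ => gradComponent P z := by
    simp only [gradMeasure, gradComponent, Measure.prod_dirac]
  rw [h1]
  ext s hs
  rw [Measure.sum_apply _ hs, Measure.finsetSum_apply, tsum_eq_sum]
  intro z hz
  rw [gradComponent_eq_zero fun h => hz (mem_latticeBall_zero_one h)]
  simp

/-- Conductances of edges are strictly positive, so the weighted measure in the direction of an edge
has the same null sets as `P`. -/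
theorem ae_gradComponent_iff (hP : StationaryErgodicLaw P) {z : Fin d → ℤ}
    (hz : (latticeGraph d).Adj 0 z) {q : Env d × (Fin d → ℤ) → Prop} :
    (∀ᵐ p ∂gradComponent P z, q p) ↔ ∀ᵐ ω ∂P, q (ω, z) := by
  rw [gradComponent, (measurableEmbedding_prod_mk_right z).ae_map_iff,
    ae_withDensity_iff' (hP.integrable_cond_apply 0 0 z).aemeasurable.ennreal_ofReal]
  refine eventually_congr (Eventually.of_forall fun ω => ?_)
  have : ENNReal.ofReal (ω.cond 0 0 z) ≠ 0 := by
    simpa using ω.cond_pos 0 hz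
  simp [this]

theorem ae_gradMeasure_iff [IsProbabilityMeasure P] (hP : StationaryErgodicLaw P)
    {q : Env d × (Fin d → ℤ) → Prop} :
    (∀ᵐ p ∂gradMeasure P, q p) ↔ ∀ z, (latticeGraph d).Adj 0 z → ∀ᵐ ω ∂P, q (ω, z) := by
  have h1 : (∀ᵐ p ∂gradMeasure P, q p) ↔ ∀ z ∈ latticeBall (0 : Fin d → ℤ) 1,
      ∀ᵐ p ∂gradComponent P z, q p := by
    simp only [ae_iff, gradMeasure_eq_sum, Measure.finsetSum_apply, Finset.sum_eq_zero_iff]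
  rw [h1]
  constructor
  · intro h z hz
    exact (ae_gradComponent_iff hP hz).1 (h z (mem_latticeBall_zero_one hz))
  · intro h z _
    by_cases hz : (latticeGraph d).Adj 0 z
    · exact (ae_gradComponent_iff hP hz).2 (h z hz)
    · rw [gradComponent_eq_zero hz]
      simp

theorem integrable_gradComponent_iff (hP : StationaryErgodicLaw P) {z : Fin d → ℤ}
    {f : Env d × (Fin d → ℤ) → ℝ} :
    Integrable f (gradComponent P z) ↔ Integrable (fun ω => ω.cond 0 0 z * f (ω, z)) P := by
  rw [gradComponent, (measurableEmbedding_prod_mk_right z).integrable_map_iff,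
    integrable_withDensity_iff_integrable_smul₀'
      (hP.integrable_cond_apply 0 0 z).aemeasurable.ennreal_ofReal (by simp)]
  simp [ENNReal.toReal_ofReal (Env.cond_nonneg _ _ _ _)]

theorem integral_gradComponent (hP : StationaryErgodicLaw P) (z : Fin d → ℤ)
    (f : Env d × (Fin d → ℤ) → ℝ) :
    ∫ p, f p ∂gradComponent P z = ∫ ω, ω.cond 0 0 z * f (ω, z) ∂P := by
  rw [gradComponent, (measurableEmbedding_prod_mk_right z).integral_map,
    integral_withDensity_eq_integral_toReal_smul₀
      (hP.integrable_cond_apply 0 0 z).aemeasurable.ennreal_ofReal (by simp)]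
  simp [ENNReal.toReal_ofReal (Env.cond_nonneg _ _ _ _)]

theorem integrable_gradMeasure_iff [IsProbabilityMeasure P] (hP : StationaryErgodicLaw P)
    {f : Env d × (Fin d → ℤ) → ℝ} :
    Integrable f (gradMeasure P) ↔
      ∀ z ∈ latticeBall (0 : Fin d → ℤ) 1, Integrable (fun ω => ω.cond 0 0 z * f (ω, z)) P := by
  rw [gradMeasure_eq_sum, integrable_finsetSum_measure]
  simp only [integrable_gradComponent_iff hP]

theorem integral_gradMeasure [IsProbabilityMeasure P] (hP : StationaryErgodicLaw P)
    {f : Env d × (Fin d → ℤ) → ℝ} (hf : Integrable f (gradMeasure P)) :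
    ∫ p, f p ∂gradMeasure P
      = ∑ z ∈ latticeBall (0 : Fin d → ℤ) 1, ∫ ω, ω.cond 0 0 z * f (ω, z) ∂P := by
  rw [gradMeasure_eq_sum, integrable_finsetSum_measure] at hf
  rw [gradMeasure_eq_sum, integral_finsetSum_measure hf]
  simp only [integral_gradComponent hP]

theorem aestronglyMeasurable_gradMeasure_iff [IsProbabilityMeasure P]
    (hP : StationaryErgodicLaw P) {f : Env d × (Fin d → ℤ) → ℝ} :
    AEStronglyMeasurable f (gradMeasure P) ↔
      ∀ z, (latticeGraph d).Adj 0 z → AEStronglyMeasurable (fun ω => f (ω, z)) P := by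
  have hac : ∀ z, (latticeGraph d).Adj 0 z →
      (AEStronglyMeasurable f (gradComponent P z) ↔
        AEStronglyMeasurable (fun ω => f (ω, z)) P) := by
    intro z hz
    rw [gradComponent, (measurableEmbedding_prod_mk_right z).aestronglyMeasurable_map_iff]
    refine ⟨fun h => h.mono_ac (withDensity_absolutelyContinuous'
      (hP.integrable_cond_apply 0 0 z).aemeasurable.ennreal_ofReal ?_),
      fun h => h.mono_ac (withDensity_absolutelyContinuous _ _)⟩
    exact Eventually.of_forall fun ω => by simpa using ω.cond_pos 0 hz
  constructor
  · intro h z hz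
    refine (hac z hz).1 (h.mono_measure ?_)
    rw [gradMeasure_eq_sum]
    exact Measure.le_iff.2 fun s _ => by
      rw [Measure.finsetSum_apply]
      exact Finset.single_le_sum (f := fun z => gradComponent P z s) (fun _ _ => zero_le)
        (mem_latticeBall_zero_one hz)
  · intro h
    have h1 : gradMeasure P = Measure.sum fun z : Fin d → ℤ => gradComponent P z := by
      simp only [gradMeasure, gradComponent, Measure.prod_dirac]
    rw [h1, aestronglyMeasurable_sum_measure_iff]
    intro z
    by_cases hz : (latticeGraph d).Adj 0 z
    · exact (hac z hz).2 (h z hz)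
    · rw [gradComponent_eq_zero hz]
      exact aestronglyMeasurable_zero_measure _

theorem memLp_two_gradMeasure [IsProbabilityMeasure P] (hP : StationaryErgodicLaw P)
    {f : Env d × (Fin d → ℤ) → ℝ}
    (hm : ∀ z, (latticeGraph d).Adj 0 z → AEStronglyMeasurable (fun ω => f (ω, z)) P)
    (hi : ∀ z, (latticeGraph d).Adj 0 z → Integrable (fun ω => ω.cond 0 0 z * f (ω, z) ^ 2) P) :
    MemLp f 2 (gradMeasure P) := by
  rw [memLp_two_iff_integrable_sq ((aestronglyMeasurable_gradMeasure_iff hP).2 hm),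
    integrable_gradMeasure_iff hP]
  intro z _
  by_cases hz : (latticeGraph d).Adj 0 z
  · exact hi z hz
  · simp [Env.cond_eq_zero _ _ hz]

/-- The arithmetic-geometric mean inequality with a free parameter. It is how the integrability of
the inverse conductances turns weighted L² bounds into L¹ bounds. -/
theorem abs_le_inv_add_mul_sq {c r δ : ℝ} (hc : 0 < c) (hδ : 0 < δ) :
    |r| ≤ δ * c⁻¹ + δ⁻¹ * (c * r ^ 2) := by
  have h1 : 0 ≤ δ * c⁻¹ := by positivity
  have h2 : 0 ≤ δ⁻¹ * (c * r ^ 2) := by positivity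
  have h3 : (δ * c⁻¹) * (δ⁻¹ * (c * r ^ 2)) = |r| ^ 2 := by
    rw [sq_abs]
    field_simp
  nlinarith [abs_nonneg r, sq_nonneg (δ * c⁻¹ - δ⁻¹ * (c * r ^ 2))]

theorem integrable_of_integrable_mul_sq (hP : StationaryErgodicLaw P) {z : Fin d → ℤ}
    (hz : (latticeGraph d).Adj 0 z) {r : Env d → ℝ} (hr : AEStronglyMeasurable r P)
    (hi : Integrable (fun ω => ω.cond 0 0 z * r ω ^ 2) P) : Integrable r P := by
  refine Integrable.mono' (((hP.integrable_inv_cond_apply 0 0 z).const_mul 1).add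
    (hi.const_mul 1⁻¹)) hr ?_
  exact Eventually.of_forall fun ω => abs_le_inv_add_mul_sq (ω.cond_pos 0 hz) one_pos

theorem integral_norm_sq_eq_sum [IsProbabilityMeasure P] (hP : StationaryErgodicLaw P)
    (f : Lp ℝ 2 (gradMeasure P)) :
    ‖f‖ ^ 2 = ∑ z ∈ latticeBall (0 : Fin d → ℤ) 1, ∫ ω, ω.cond 0 0 z * f (ω, z) ^ 2 ∂P := by
  have h1 := L2.integrable_inner (𝕜 := ℝ) f f
  rw [← real_inner_self_eq_norm_sq, L2.inner_def, integral_gradMeasure hP h1]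
  simp [pow_two]

theorem integrable_mul_sq_of_Lp [IsProbabilityMeasure P] (hP : StationaryErgodicLaw P)
    (f : Lp ℝ 2 (gradMeasure P)) {z : Fin d → ℤ} (hz : (latticeGraph d).Adj 0 z) :
    Integrable (fun ω => ω.cond 0 0 z * f (ω, z) ^ 2) P := by
  have h1 := (integrable_gradMeasure_iff hP).1 (L2.integrable_inner (𝕜 := ℝ) f f) z
    (mem_latticeBall_zero_one hz)
  simpa [pow_two] using h1

theorem aestronglyMeasurable_Lp_component [IsProbabilityMeasure P] (hP : StationaryErgodicLaw P)
    (f : Lp ℝ 2 (gradMeasure P)) {z : Fin d → ℤ} (hz : (latticeGraph d).Adj 0 z) :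
    AEStronglyMeasurable (fun ω => f (ω, z)) P :=
  (aestronglyMeasurable_gradMeasure_iff hP).1 (Lp.aestronglyMeasurable f) z hz

theorem integrable_Lp_component [IsProbabilityMeasure P] (hP : StationaryErgodicLaw P)
    (f : Lp ℝ 2 (gradMeasure P)) {z : Fin d → ℤ} (hz : (latticeGraph d).Adj 0 z) :
    Integrable (fun ω => f (ω, z)) P :=
  integrable_of_integrable_mul_sq hP hz (aestronglyMeasurable_Lp_component hP f hz)
    (integrable_mul_sq_of_Lp hP f hz)

/-- The components of a field are controlled in `L¹(P)` by its norm in `L²(m)`. -/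
theorem exists_integral_abs_component_le [IsProbabilityMeasure P] (hP : StationaryErgodicLaw P)
    {ε : ℝ} (hε : 0 < ε) : ∃ η > (0 : ℝ), ∀ f : Lp ℝ 2 (gradMeasure P), ‖f‖ ≤ η →
      ∀ z, (latticeGraph d).Adj 0 z → ∫ ω, |f (ω, z)| ∂P ≤ ε := by
  set K : ℝ := ∑ z ∈ latticeBall (0 : Fin d → ℤ) 1, ∫ ω, (ω.cond 0 0 z)⁻¹ ∂P with hK
  have hnn : ∀ z, 0 ≤ ∫ ω : Env d, (ω.cond 0 0 z)⁻¹ ∂P := fun z =>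
    integral_nonneg fun ω => inv_nonneg.2 (ω.cond_nonneg _ _ _)
  have hK0 : 0 ≤ K := Finset.sum_nonneg fun z _ => hnn z
  -- This makes δ (K + 1) = ε/2. The norm bound, with square δ ε/2, makes the other term at most
  -- ε/2.
  set δ : ℝ := ε / (2 * (K + 1)) with hδ
  have hδ0 : 0 < δ := by positivity
  refine ⟨Real.sqrt (δ * (ε / 2)), Real.sqrt_pos.2 (by positivity), fun f hf z hz => ?_⟩
  have hzb := mem_latticeBall_zero_one hz
  have h1 : ∫ ω, ω.cond 0 0 z * f (ω, z) ^ 2 ∂P ≤ δ * (ε / 2) := by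
    calc _ ≤ ‖f‖ ^ 2 := by
          rw [integral_norm_sq_eq_sum hP]
          exact Finset.single_le_sum
            (f := fun z => ∫ ω : Env d, ω.cond 0 0 z * f (ω, z) ^ 2 ∂P)
            (fun z _ => integral_nonneg fun ω => mul_nonneg (ω.cond_nonneg _ _ _) (sq_nonneg _))
            hzb
      _ ≤ Real.sqrt (δ * (ε / 2)) ^ 2 := by gcongr
      _ = _ := Real.sq_sqrt (by positivity)
  have h2 : ∫ ω : Env d, (ω.cond 0 0 z)⁻¹ ∂P ≤ K :=
    Finset.single_le_sum (f := fun z => ∫ ω : Env d, (ω.cond 0 0 z)⁻¹ ∂P) (fun z _ => hnn z) hzb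
  calc ∫ ω, |f (ω, z)| ∂P
      ≤ ∫ ω, (δ * (ω.cond 0 0 z)⁻¹ + δ⁻¹ * (ω.cond 0 0 z * f (ω, z) ^ 2)) ∂P := by
        refine integral_mono (integrable_Lp_component hP f hz).abs
          (((hP.integrable_inv_cond_apply 0 0 z).const_mul _).add
            ((integrable_mul_sq_of_Lp hP f hz).const_mul _)) fun ω => ?_
        exact abs_le_inv_add_mul_sq (ω.cond_pos 0 hz) hδ0
    _ = δ * ∫ ω : Env d, (ω.cond 0 0 z)⁻¹ ∂P + δ⁻¹ * ∫ ω, ω.cond 0 0 z * f (ω, z) ^ 2 ∂P := by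
        rw [integral_add ((hP.integrable_inv_cond_apply 0 0 z).const_mul _)
          ((integrable_mul_sq_of_Lp hP f hz).const_mul _), integral_const_mul, integral_const_mul]
    _ ≤ δ * (K + 1) + δ⁻¹ * (δ * (ε / 2)) := by
        gcongr
        linarith
    _ = ε := by
        rw [hδ]
        field_simp
        ring

theorem exists_gradient_approx [IsProbabilityMeasure P] (hP : StationaryErgodicLaw P)
    {ψ : Lp ℝ 2 (gradMeasure P)} (hψ : ψ ∈ L2pot P) {ε : ℝ} (hε : 0 < ε) :
    ∃ φ : Env d → ℝ, Measurable φ ∧ (∃ C, ∀ ω, |φ ω| ≤ C) ∧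
      ∀ z, (latticeGraph d).Adj 0 z → ∫ ω, |ψ (ω, z) - horizGrad φ (ω, z)| ∂P ≤ ε := by
  obtain ⟨η, hη, h⟩ := exists_integral_abs_component_le hP hε
  obtain ⟨g, ⟨φ, hφ, hC, hg⟩, hd⟩ := Metric.mem_closure_iff.1 hψ η hη
  refine ⟨φ, hφ, hC, fun z hz => ?_⟩
  have h1 := h (ψ - g) (by rw [← dist_eq_norm]; exact hd.le) z hz
  refine (integral_congr_ae ?_).trans_le h1
  filter_upwards [(ae_gradMeasure_iff hP).1 (Lp.coeFn_sub ψ g) z hz,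
    (ae_gradMeasure_iff hP).1 hg z hz] with ω h2 h3
  rw [h2, Pi.sub_apply, h3]

end GradMeasure

theorem mem_latticeBox_of_mem_latticeBall {d n : ℕ} {z : Fin d → ℤ}
    (hz : z ∈ latticeBall (0 : Fin d → ℤ) n) : z ∈ latticeBox d n := by
  rw [mem_latticeBall] at hz
  rw [mem_latticeBox]
  intro i
  have h1 := (Finset.single_le_sum (f := fun i => |z i - (0 : Fin d → ℤ) i|)
    (fun _ _ => abs_nonneg _) (Finset.mem_univ i)).trans hz
  simp only [Pi.zero_apply, sub_zero] at h1
  exact abs_le.1 h1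

/-! ### Flux and drift of a cocycle -/

/-- The flux `ω_0(0, z) Ψ(ω, z)`. -/
noncomputable def flux {d : ℕ} (Ψ : Env d → (Fin d → ℤ) → ℝ) (z : Fin d → ℤ) (ω : Env d) : ℝ :=
  ω.cond 0 0 z * Ψ ω z

/-- The drift `(L_0^ω Ψ)(0)` of a cocycle. -/
noncomputable def drift {d : ℕ} (Ψ : Env d → (Fin d → ℤ) → ℝ) (ω : Env d) : ℝ :=
  ∑ z ∈ latticeBall (0 : Fin d → ℤ) 1, flux Ψ z ω

/-- The cocycle property at the environment `ω`. -/
def IsCocycleAt {d : ℕ} (Ψ : Env d → (Fin d → ℤ) → ℝ) (ω : Env d) : Prop :=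
  ∀ x y : Fin d → ℤ, Ψ (ω.shift 0 x) (y - x) = Ψ ω y - Ψ ω x

section Cocycle

variable {d : ℕ} {Ψ : Env d → (Fin d → ℤ) → ℝ} {ω : Env d}

theorem IsCocycleAt.apply_zero (h : IsCocycleAt Ψ ω) : Ψ ω 0 = 0 := by
  have := h 0 0
  simpa using this

theorem IsCocycleAt.apply_add (h : IsCocycleAt Ψ ω) (x z : Fin d → ℤ) :
    Ψ (ω.shift 0 x) z = Ψ ω (x + z) - Ψ ω x := by
  have := h x (x + z)
  rwa [add_sub_cancel_left] at this

theorem IsCocycleAt.apply_shift_add {s : ℝ} (h : IsCocycleAt Ψ (ω.shift s 0)) (x z : Fin d → ℤ) :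
    Ψ (ω.shift s x) z = Ψ (ω.shift s 0) (x + z) - Ψ (ω.shift s 0) x := by
  have := h.apply_add x z
  rwa [Env.shift_shift, zero_add, add_zero] at this

/-- The symmetry of the conductances and the antisymmetry of cocycle increments: an edge crossed
backwards carries the opposite flux. -/
theorem flux_neg (h : IsCocycleAt Ψ ω) (z : Fin d → ℤ) :
    flux Ψ (-z) ω = -flux Ψ z (ω.shift 0 (-z)) := by
  unfold flux
  rw [h.apply_add, neg_add_cancel, h.apply_zero, Env.cond_shift, Env.cond_comm ω 0 0 (-z)]
  simp

theorem neg_mem_latticeBall_zero {n : ℕ} {z : Fin d → ℤ} :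
    -z ∈ latticeBall (0 : Fin d → ℤ) n ↔ z ∈ latticeBall (0 : Fin d → ℤ) n := by
  simp [mem_latticeBall]

/-- Pairing opposite directions exhibits the drift as a discrete divergence of stationary fluxes.
Each summand is a difference, so fluxes may be centred without changing it. -/
theorem drift_eq_half_sum (h : IsCocycleAt Ψ ω) :
    drift Ψ ω = 1 / 2 * ∑ z ∈ latticeBall (0 : Fin d → ℤ) 1,
      (flux Ψ z ω - flux Ψ z (ω.shift 0 (-z))) := by
  have h1 : drift Ψ ω = ∑ z ∈ latticeBall (0 : Fin d → ℤ) 1, -flux Ψ z (ω.shift 0 (-z)) := by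
    unfold drift
    rw [← Finset.sum_congr rfl fun z _ => flux_neg h z]
    exact Finset.sum_nbij' (fun z => -z) (fun z => -z)
      (fun z hz => neg_mem_latticeBall_zero.2 hz) (fun z hz => neg_mem_latticeBall_zero.2 hz)
      (fun z _ => neg_neg z) (fun z _ => neg_neg z) (fun z _ => by simp)
  have h2 : ∑ z ∈ latticeBall (0 : Fin d → ℤ) 1, (flux Ψ z ω - flux Ψ z (ω.shift 0 (-z)))
      = drift Ψ ω + drift Ψ ω := by
    nth_rewrite 2 [h1]
    rw [drift, ← Finset.sum_add_distrib]
    simp [sub_eq_add_neg]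
  rw [h2]
  ring

/-- The generator sees only increments. The constant `c` covers the time integral subtracted in
`harmonicCoord`, which does not depend on the lattice point. -/
theorem gen_eq_drift {s : ℝ} (h : IsCocycleAt Ψ (ω.shift s 0)) (c : ℝ) (x : Fin d → ℤ) :
    ω.gen s (fun y => Ψ (ω.shift s 0) y - c) x = drift Ψ (ω.shift s x) := by
  rw [Env.gen_eq_sum]
  unfold drift flux
  refine Finset.sum_congr rfl fun z _ => ?_
  rw [h.apply_shift_add x z, Env.cond_shift, zero_add, zero_add, add_comm z x]
  ring

variable [MeasurableSpace (Env d)] {P : Measure (Env d)}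

theorem IsL2Cov.integrable_mul_sq (hP : StationaryErgodicLaw P) (hΨ : IsL2Cov P Ψ)
    (z : Fin d → ℤ) : Integrable (fun ω => ω.cond 0 0 z * Ψ ω z ^ 2) P := by
  rw [← lintegral_ofReal_ne_top_iff_integrable]
  · refine ne_top_of_le_ne_top hΨ.norm_lt_top.ne (lintegral_mono fun ω => ?_)
    exact ENNReal.le_tsum (f := fun z => ENNReal.ofReal (ω.cond 0 0 z * Ψ ω z ^ 2)) z
  · exact (hP.integrable_cond_apply 0 0 z).aestronglyMeasurable.mul
      ((hΨ.measurable z).pow_const 2).aestronglyMeasurable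
  · exact Eventually.of_forall fun ω => mul_nonneg (ω.cond_nonneg _ _ _) (sq_nonneg _)

theorem integrable_flux_of_integrable_mul_sq (hP : StationaryErgodicLaw P) {z : Fin d → ℤ}
    (hm : AEStronglyMeasurable (fun ω => Ψ ω z) P)
    (hi : Integrable (fun ω => ω.cond 0 0 z * Ψ ω z ^ 2) P) : Integrable (flux Ψ z) P := by
  refine Integrable.mono' ((hP.integrable_cond_apply 0 0 z).add hi)
    ((hP.integrable_cond_apply 0 0 z).aestronglyMeasurable.mul hm) ?_
  refine Eventually.of_forall fun ω => ?_
  have hc := ω.cond_nonneg 0 0 z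
  rw [flux, Real.norm_eq_abs, abs_mul, abs_of_nonneg hc, Pi.add_apply]
  nlinarith [mul_nonneg hc (sq_nonneg (|Ψ ω z| - 1)), sq_abs (Ψ ω z),
    mul_nonneg hc (sq_nonneg (Ψ ω z))]

theorem IsL2Cov.integrable_flux (hP : StationaryErgodicLaw P) (hΨ : IsL2Cov P Ψ)
    (z : Fin d → ℤ) : Integrable (flux Ψ z) P :=
  integrable_flux_of_integrable_mul_sq hP (hΨ.measurable z).aestronglyMeasurable
    (hΨ.integrable_mul_sq hP z)

end Cocycle

/-! ### Oscillations of the corrector -/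

section Corrector

variable {d : ℕ} [MeasurableSpace (Env d)] {P : Measure (Env d)}
  {Φ₀ : Fin d → Env d → (Fin d → ℤ) → ℝ}

theorem GeneratesHarmonicCoord.continuous_coord (hΦ : GeneratesHarmonicCoord P Φ₀) :
    ∀ᵐ ω ∂P, ∀ (j : Fin d) (x : Fin d → ℤ),
      Continuous fun t => harmonicCoord Φ₀ j ω t x := by
  filter_upwards [hΦ.abs_cont] with ω hω j x
  rw [continuous_iff_continuousAt]
  intro t
  refine ((hω j x (t - 1) (t + 1)).continuousOn).continuousAt ?_
  rw [Set.uIcc_of_le (by linarith)]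
  exact Icc_mem_nhds (by linarith) (by linarith)

/-- Subtracting a bounded potential leaves a function whose gradient is a stationary field of small
L¹ norm. The Poincaré inequality costs one factor 2^k, and the bounded part only O(1). -/
theorem GeneratesHarmonicCoord.spatial_oscillation [IsProbabilityMeasure P]
    (hP : StationaryErgodicLaw P) (hΦ : GeneratesHarmonicCoord P Φ₀) (j : Fin d) :
    ∀ᵐ ω ∂P, ∀ ε > (0 : ℝ), ∀ᶠ k : ℕ in atTop,
      ∫ t in (0 : ℝ)..4 ^ k, ∑ x ∈ latticeBox d (2 * 2 ^ k), ∑ y ∈ latticeBox d (2 * 2 ^ k),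
        |((x j : ℝ) - harmonicCoord Φ₀ j ω t x) - ((y j : ℝ) - harmonicCoord Φ₀ j ω t y)|
        ≤ ε * (2 ^ k * 4 ^ k * ((latticeBox d (2 * 2 ^ k)).card : ℝ) ^ 2) := by
  obtain ⟨ψ, hψ, hext⟩ := hΦ.potential j
  have happ : ∀ m : ℕ, ∃ φ : Env d → ℝ, Measurable φ ∧ (∃ C, ∀ ω, |φ ω| ≤ C) ∧
      ∀ z, (latticeGraph d).Adj 0 z →
        ∫ ω, |ψ (ω, z) - horizGrad φ (ω, z)| ∂P ≤ (1 / 4) ^ m / (d + 1) :=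
    fun m => exists_gradient_approx hP hψ (by positivity)
  choose φ hφm hφb hφ using happ
  set e : Fin d → (Fin d → ℤ) := fun i => Pi.single i 1 with he
  have hφi : ∀ m i, Integrable (fun ω => ψ (ω, e i) - horizGrad (φ m) (ω, e i)) P := by
    intro m i
    obtain ⟨C, hC⟩ := hφb m
    refine (integrable_Lp_component hP ψ (latticeGraph_adj_single i)).sub ?_
    refine Integrable.of_bound (C := C + C) (((hφm m).comp
      (hP.measurable_shift_fixed 0 (e i))).sub (hφm m)).aestronglyMeasurable
      (Eventually.of_forall fun ω => ?_)
    exact (abs_sub _ _).trans (add_le_add (hC _) (hC _))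
  set r : ℕ → Env d → ℝ := fun m ω => ∑ i, |ψ (ω, e i) - horizGrad (φ m) (ω, e i)| with hr
  have hri : ∀ m, Integrable (r m) P := fun m => integrable_finsetSum _ fun i _ => (hφi m i).abs
  have hr0 : ∀ m ω, 0 ≤ r m ω := fun m ω => Finset.sum_nonneg fun _ _ => abs_nonneg _
  have hrb : ∀ m, ∫ ω, |r m ω| ∂P ≤ (1 / 4) ^ m := by
    intro m
    simp only [abs_of_nonneg (hr0 m _)]
    rw [hr]
    simp only
    rw [integral_finsetSum _ fun i _ => (hφi m i).abs]
    calc _ ≤ ∑ _i : Fin d, (1 / 4 : ℝ) ^ m / (d + 1) :=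
          Finset.sum_le_sum fun i _ => hφ m (e i) (latticeGraph_adj_single i)
      _ = (1 / 4 : ℝ) ^ m * (d / (d + 1)) := by
          rw [Finset.sum_const, Finset.card_univ, Fintype.card_fin, nsmul_eq_mul]
          ring
      _ ≤ (1 / 4 : ℝ) ^ m * 1 := by
          gcongr
          rw [div_le_one (by positivity)]
          linarith
      _ = _ := mul_one _
  have hstep : ∀ᵐ ω ∂P, ∀ i, (e i j : ℝ) - Φ₀ j ω (e i) = ψ (ω, e i) := by
    filter_upwards [hext] with ω hω i
    have := hω (e i) (SimpleGraph.Walk.cons (latticeGraph_adj_single i) SimpleGraph.Walk.nil)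
    simpa using this
  filter_upwards [hP.ae_eventually_average_le hri hrb, hΦ.continuous_coord,
    ae_all_iff.2 fun m => hP.ae_intervalIntegrable (hri m),
    hP.ae_ae_shift hstep, hP.ae_ae_shift (hΦ.mem_cov j).cocycle] with ω h1 hcont h2 h3 h4 ε hε
  -- The 5 bounds the side length in the Poincaré inequality: 2·(2·2^k) + 1 ≤ 5·2^k.
  have h5 : ∀ᶠ m : ℕ in atTop, (1 / 2 : ℝ) ^ m * 5 ≤ ε / 2 := by
    have := (tendsto_pow_atTop_nhds_zero_of_lt_one (by norm_num : (0 : ℝ) ≤ 1 / 2)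
      (by norm_num)).mul_const (5 : ℝ)
    rw [zero_mul] at this
    exact (this.eventually_lt_const (half_pos hε)).mono fun _ h => h.le
  -- The approximation is fixed before the scale: `hm1` holds for all k, and the bound `C` of the
  -- chosen potential is then absorbed by large k.
  obtain ⟨m, hm1, hm2⟩ := (h1.and h5).exists
  obtain ⟨C, hC⟩ := hφb m
  have hev : ∀ᶠ k : ℕ in atTop, C + C ≤ ε / 2 * 2 ^ k :=
    ((tendsto_pow_atTop_atTop_of_one_lt (by norm_num : (1 : ℝ) < 2)).const_mul_atTop
      (half_pos hε)).eventually_ge_atTop _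
  filter_upwards [hev] with k hk
  set N : ℝ := ((latticeBox d (2 * 2 ^ k)).card : ℝ) with hN
  have h4k : (0 : ℝ) ≤ 4 ^ k := by positivity
  have h1k : (1 : ℝ) ≤ 2 ^ k := one_le_pow₀ (by norm_num)
  have hrint : IntervalIntegrable (fun t => ∑ x ∈ latticeBox d (2 * 2 ^ k), |r m (ω.shift t x)|)
      volume 0 (4 ^ k) := by
    have := intervalIntegrable_sum_shift (F := fun ω => |r m ω|) (ω := ω)
      (fun x a b => (h2 m x a b).abs) (latticeBox d (2 * 2 ^ k)) 0 0 (4 ^ k)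
    simpa using this
  have hpt : ∀ᵐ t : ℝ, ∑ x ∈ latticeBox d (2 * 2 ^ k), ∑ y ∈ latticeBox d (2 * 2 ^ k),
        |((x j : ℝ) - harmonicCoord Φ₀ j ω t x) - ((y j : ℝ) - harmonicCoord Φ₀ j ω t y)|
      ≤ N * (5 * 2 ^ k) * (∑ x ∈ latticeBox d (2 * 2 ^ k), |r m (ω.shift t x)|)
        + N * (N * (C + C)) := by
    filter_upwards [h3, h4] with t h3 h4
    set h : (Fin d → ℤ) → ℝ := fun x =>
      ((x j : ℝ) - harmonicCoord Φ₀ j ω t x) - φ m (ω.shift t x) with hh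
    have hco : IsCocycleAt (Φ₀ j) (ω.shift t 0) := h4 0
    have hgrad : ∀ x i, |h (x + e i) - h x|
        = |ψ (ω.shift t x, e i) - horizGrad (φ m) (ω.shift t x, e i)| := by
      intro x i
      rw [← h3 x i, hco.apply_shift_add, horizGrad]
      simp only [hh, harmonicCoord, Env.shift_shift, zero_add, Pi.add_apply, add_comm (e i) x]
      push_cast
      congr 1
      ring
    have hpoin := sum_sum_abs_sub_le (n := 2 * 2 ^ k) h
    have hcomm : ∑ i, ∑ x ∈ latticeBox d (2 * 2 ^ k), |h (x + Pi.single i 1) - h x|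
        = ∑ x ∈ latticeBox d (2 * 2 ^ k), |r m (ω.shift t x)| := by
      rw [Finset.sum_comm]
      refine Finset.sum_congr rfl fun x _ => ?_
      rw [abs_of_nonneg (hr0 m _)]
      exact Finset.sum_congr rfl fun i _ => hgrad x i
    rw [hcomm] at hpoin
    have hS : 0 ≤ ∑ x ∈ latticeBox d (2 * 2 ^ k), |r m (ω.shift t x)| :=
      Finset.sum_nonneg fun _ _ => abs_nonneg _
    calc _ ≤ ∑ x ∈ latticeBox d (2 * 2 ^ k), ∑ y ∈ latticeBox d (2 * 2 ^ k),
          (|h x - h y| + (C + C)) := by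
          refine Finset.sum_le_sum fun x _ => Finset.sum_le_sum fun y _ => ?_
          have : ((x j : ℝ) - harmonicCoord Φ₀ j ω t x) - ((y j : ℝ) - harmonicCoord Φ₀ j ω t y)
              = (h x - h y) + (φ m (ω.shift t x) - φ m (ω.shift t y)) := by
            simp only [hh]
            ring
          rw [this]
          exact (abs_add_le _ _).trans (add_le_add le_rfl
            ((abs_sub _ _).trans (add_le_add (hC _) (hC _))))
      _ = (∑ x ∈ latticeBox d (2 * 2 ^ k), ∑ y ∈ latticeBox d (2 * 2 ^ k), |h x - h y|)
          + N * (N * (C + C)) := by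
          simp only [Finset.sum_add_distrib, Finset.sum_const, nsmul_eq_mul, hN]
          ring
      _ ≤ _ := by
          gcongr
          refine hpoin.trans ?_
          push_cast
          gcongr
          linarith
  have hXc : Continuous fun t => ∑ x ∈ latticeBox d (2 * 2 ^ k), ∑ y ∈ latticeBox d (2 * 2 ^ k),
      |((x j : ℝ) - harmonicCoord Φ₀ j ω t x) - ((y j : ℝ) - harmonicCoord Φ₀ j ω t y)| :=
    continuous_finsetSum _ fun x _ => continuous_finsetSum _ fun y _ =>
      ((continuous_const.sub (hcont j x)).sub (continuous_const.sub (hcont j y))).abs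
  calc _ ≤ ∫ t in (0 : ℝ)..4 ^ k,
        (N * (5 * 2 ^ k) * (∑ x ∈ latticeBox d (2 * 2 ^ k), |r m (ω.shift t x)|)
        + N * (N * (C + C))) :=
        intervalIntegral.integral_mono_ae h4k (hXc.intervalIntegrable _ _)
          ((hrint.const_mul _).add intervalIntegrable_const) hpt
    _ = N * (5 * 2 ^ k) * (∫ t in (0 : ℝ)..4 ^ k,
          ∑ x ∈ latticeBox d (2 * 2 ^ k), |r m (ω.shift t x)|) + 4 ^ k * (N * (N * (C + C))) := by
        rw [intervalIntegral.integral_add (hrint.const_mul _) intervalIntegrable_const,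
          intervalIntegral.integral_const_mul, intervalIntegral.integral_const]
        simp
    _ ≤ N * (5 * 2 ^ k) * ((1 / 2) ^ m * (4 ^ k * N)) + 4 ^ k * (N * (N * (ε / 2 * 2 ^ k))) := by
        gcongr
        exact hm1 k
    _ = ((1 / 2) ^ m * 5) * (2 ^ k * 4 ^ k * N ^ 2) + ε / 2 * (2 ^ k * 4 ^ k * N ^ 2) := by ring
    _ ≤ ε / 2 * (2 ^ k * 4 ^ k * N ^ 2) + ε / 2 * (2 ^ k * 4 ^ k * N ^ 2) := by gcongr
    _ = _ := by ring

/-- Absolute continuity allows the differential equation, known at a.e. time, to be integrated; its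
right-hand side is the stationary drift seen from `x`. -/
theorem GeneratesHarmonicCoord.sub_eq_integral_drift [IsProbabilityMeasure P]
    (hP : StationaryErgodicLaw P) (hΦ : GeneratesHarmonicCoord P Φ₀) (j : Fin d) :
    ∀ᵐ ω ∂P, ∀ (x : Fin d → ℤ) (t : ℝ), harmonicCoord Φ₀ j ω t x - harmonicCoord Φ₀ j ω 0 x
      = -∫ s in (0 : ℝ)..t, drift (Φ₀ j) (ω.shift s x) := by
  filter_upwards [hΦ.abs_cont, hΦ.harmonic, hP.ae_ae_shift (hΦ.mem_cov j).cocycle]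
    with ω h1 h2 h3 x t
  rw [← (h1 j x 0 t).integral_deriv_eq_sub, ← intervalIntegral.integral_neg]
  refine intervalIntegral.integral_congr_ae ?_
  filter_upwards [h2, h3] with s h2 h3 _
  rw [(h2 j x).deriv]
  congr 1
  exact gen_eq_drift (h3 0) _ x

/-- The drift is a divergence of fluxes. Summing over p gives ergodic averages of size o(4^k) times
the volume; summing over q telescopes the divergence and keeps only a fraction of order 2^(-k) of
the terms. -/
theorem GeneratesHarmonicCoord.temporal_oscillation [IsProbabilityMeasure P]
    (hP : StationaryErgodicLaw P) (hΦ : GeneratesHarmonicCoord P Φ₀) (j : Fin d) :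
    ∀ᵐ ω ∂P, ∀ ε > (0 : ℝ), ∀ᶠ k : ℕ in atTop, ∀ t ∈ Set.Icc (0 : ℝ) (4 ^ k),
      |∑ q ∈ latticeBox d (2 ^ k), ∑ p ∈ latticeBox d (2 ^ k),
        ((((p + q) j : ℤ) : ℝ) - harmonicCoord Φ₀ j ω t (p + q)
          - ((((p + q) j : ℤ) : ℝ) - harmonicCoord Φ₀ j ω 0 (p + q)))|
        ≤ ε * (2 ^ k * ((latticeBox d (2 ^ k)).card : ℝ) ^ 2) := by
  set F : (Fin d → ℤ) → Env d → ℝ := fun z ω =>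
    flux (Φ₀ j) z ω - ∫ ω', flux (Φ₀ j) z ω' ∂P with hF
  have hfi := (hΦ.mem_cov j).integrable_flux hP
  have hFi : ∀ z, Integrable (F z) P := fun z => (hfi z).sub (integrable_const _)
  have hF0 : ∀ z, ∫ ω, F z ω ∂P = 0 := fun z => by
    rw [hF]
    simp only
    rw [integral_sub (hfi z) (integrable_const _)]
    simp
  have hu1 : ∀ z, HasUniformZeroAverages P (F z) := fun z =>
    hP.uniformZeroAverages_of_integrable (hFi z) (hF0 z)
  -- The point q - z may leave the box of admissible translations, so the shifted flux is treated as
  -- a separate stationary function.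
  have hu2 : ∀ z, HasUniformZeroAverages P (fun ω => F z (ω.shift 0 (-z))) := fun z =>
    hP.uniformZeroAverages_of_integrable (hP.integrable_comp_shift (hFi z) 0 (-z))
      (by rw [hP.integral_comp_shift (hFi z).aestronglyMeasurable, hF0])
  filter_upwards [hΦ.sub_eq_integral_drift hP j, ae_all_iff.2 hu1, ae_all_iff.2 hu2,
    ae_all_iff.2 fun z => hP.ae_intervalIntegrable (hFi z),
    hP.ae_ae_shift (hΦ.mem_cov j).cocycle] with ω h1 h2 h3 h4 h5 ε hε
  set n : ℝ := ((latticeBall (0 : Fin d → ℤ) 1).card : ℝ) with hn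
  have hδ : 0 < ε / (n * d + 1) := by positivity
  set δ := ε / (n * d + 1) with hδdef
  have hall2 := (Finset.eventually_all (latticeBall (0 : Fin d → ℤ) 1)).2 fun z _ => h2 z δ hδ
  have hall3 := (Finset.eventually_all (latticeBall (0 : Fin d → ℤ) 1)).2 fun z _ => h3 z δ hδ
  filter_upwards [hall2, hall3] with k hk2 hk3 t ht
  set B := latticeBox d (2 ^ k) with hB
  set N : ℝ := (B.card : ℝ) with hN
  -- The inner average, as a function of the translation q. It is uniformly small, and the
  -- divergence acts on it by differences in q.
  set J : (Fin d → ℤ) → (Fin d → ℤ) → ℝ := fun z q =>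
    ∫ s in (0 : ℝ)..t, ∑ p ∈ B, F z (ω.shift s (p + q)) with hJ
  have hJb : ∀ z ∈ latticeBall (0 : Fin d → ℤ) 1, ∀ q ∈ B, |J z q| ≤ δ * (4 ^ k * N) :=
    fun z hz q hq => hk2 z hz q hq t ht
  have hJb' : ∀ z ∈ latticeBall (0 : Fin d → ℤ) 1, ∀ q ∈ B,
      |J z (q + -z)| ≤ δ * (4 ^ k * N) := by
    intro z hz q hq
    have := hk3 z hz q hq t ht
    have e1 : ∀ p, -z + (p + q) = p + (q + -z) := fun p => by abel
    simpa only [Env.shift_shift, zero_add, e1] using this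
  have hii : ∀ z q, IntervalIntegrable (fun s => ∑ p ∈ B, F z (ω.shift s (p + q))) volume 0 t :=
    fun z q => intervalIntegrable_sum_shift (h4 z) B q 0 t
  have hdr : ∀ x, ∫ s in (0 : ℝ)..t, drift (Φ₀ j) (ω.shift s x)
      = ∫ s in (0 : ℝ)..t, 1 / 2 * ∑ z ∈ latticeBall (0 : Fin d → ℤ) 1,
        (F z (ω.shift s x) - F z (ω.shift s (x + -z))) := by
    intro x
    refine intervalIntegral.integral_congr_ae ?_
    filter_upwards [h5] with s hs _
    have hco : IsCocycleAt (Φ₀ j) (ω.shift s x) := hs x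
    rw [drift_eq_half_sum hco]
    congr 1
    refine Finset.sum_congr rfl fun z _ => ?_
    simp only [hF, Env.shift_shift, zero_add, add_comm (-z) x]
    ring
  have hsum : ∑ q ∈ B, ∑ p ∈ B, ((((p + q) j : ℤ) : ℝ) - harmonicCoord Φ₀ j ω t (p + q)
          - ((((p + q) j : ℤ) : ℝ) - harmonicCoord Φ₀ j ω 0 (p + q)))
      = -(1 / 2 * ∑ z ∈ latticeBall (0 : Fin d → ℤ) 1,
        (∑ q ∈ B, J z (q + -z) - ∑ q ∈ B, J z q)) := by
    have e1 : ∀ x : Fin d → ℤ, ((x j : ℝ) - harmonicCoord Φ₀ j ω t x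
        - ((x j : ℝ) - harmonicCoord Φ₀ j ω 0 x))
        = 1 / 2 * ∑ z ∈ latticeBall (0 : Fin d → ℤ) 1, ((∫ s in (0 : ℝ)..t, F z (ω.shift s x))
          - ∫ s in (0 : ℝ)..t, F z (ω.shift s (x + -z))) := by
      intro x
      have := h1 x t
      rw [hdr, intervalIntegral.integral_const_mul, intervalIntegral.integral_finsetSum
        (fun z _ => (h4 z x 0 t).sub (h4 z (x + -z) 0 t))] at this
      rw [Finset.sum_congr rfl fun z _ =>
        intervalIntegral.integral_sub (h4 z x 0 t) (h4 z (x + -z) 0 t)] at this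
      linarith
    have e2 : ∀ z q, J z q = ∑ p ∈ B, ∫ s in (0 : ℝ)..t, F z (ω.shift s (p + q)) := fun z q =>
      intervalIntegral.integral_finsetSum fun p _ => h4 z (p + q) 0 t
    simp only [e1, e2, ← Finset.mul_sum]
    rw [← mul_neg, ← Finset.sum_neg_distrib]
    congr 1
    have e3 : ∀ q, ∑ p ∈ B, ∑ z ∈ latticeBall (0 : Fin d → ℤ) 1,
        ((∫ s in (0 : ℝ)..t, F z (ω.shift s (p + q)))
          - ∫ s in (0 : ℝ)..t, F z (ω.shift s (p + q + -z)))
        = ∑ z ∈ latticeBall (0 : Fin d → ℤ) 1, ∑ p ∈ B,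
        ((∫ s in (0 : ℝ)..t, F z (ω.shift s (p + q)))
          - ∫ s in (0 : ℝ)..t, F z (ω.shift s (p + q + -z))) := fun q => Finset.sum_comm
    simp only [e3]
    rw [Finset.sum_comm]
    refine Finset.sum_congr rfl fun z _ => ?_
    rw [neg_sub, ← Finset.sum_sub_distrib]
    refine Finset.sum_congr rfl fun q _ => ?_
    rw [Finset.sum_sub_distrib]
    simp only [add_assoc]
  rw [hsum, abs_neg, abs_mul, abs_of_pos (by norm_num : (0 : ℝ) < 1 / 2)]
  have h2k : (0 : ℝ) < 2 ^ k := by positivity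
  -- A box of radius 2^k loses at most d N / 2^k points under a unit translation, where N is its
  -- cardinality. With |J| ≤ δ 4^k N, the two boundary terms give 2 δ d 2^k N².
  have hface : ∀ z ∈ latticeBall (0 : Fin d → ℤ) 1,
      |∑ q ∈ B, J z (q + -z) - ∑ q ∈ B, J z q| ≤ 2 * (δ * d) * (2 ^ k * N ^ 2) := by
    intro z hz
    have := abs_sum_add_sub_sum_le (n := 2 ^ k)
      (neg_mem_latticeBox (mem_latticeBox_of_mem_latticeBall hz))
      (h := J z) (hJb z hz) (hJb' z hz)
    push_cast at this
    refine le_of_mul_le_mul_right (this.trans_eq ?_) h2k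
    have h4 : (4 : ℝ) ^ k = 2 ^ k * 2 ^ k := by rw [← mul_pow]; norm_num
    rw [h4]
    ring
  calc _ ≤ 1 / 2 * ∑ _z ∈ latticeBall (0 : Fin d → ℤ) 1, 2 * (δ * d) * (2 ^ k * N ^ 2) := by
        gcongr
        exact (Finset.abs_sum_le_sum_abs _ _).trans (Finset.sum_le_sum hface)
    _ = δ * (n * d) * (2 ^ k * N ^ 2) := by
        rw [Finset.sum_const, nsmul_eq_mul]
        ring
    _ ≤ δ * (n * d + 1) * (2 ^ k * N ^ 2) := by
        gcongr
        linarith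
    _ = _ := by rw [hδdef, div_mul_cancel₀ _ (by positivity)]

end Corrector

/-! ### Sublinearity of the corrector -/

theorem EuclideanSpace.norm_le_sum_abs {ι : Type*} [Fintype ι] (v : EuclideanSpace ℝ ι) :
    ‖v‖ ≤ ∑ i, |v i| := by
  rw [EuclideanSpace.norm_eq]
  refine Real.sqrt_le_iff.2 ⟨Finset.sum_nonneg fun _ _ => abs_nonneg _, ?_⟩
  simp only [Real.norm_eq_abs]
  exact Finset.sum_sq_le_sq_sum_of_nonneg fun i _ => abs_nonneg _

/-- The ball contains the box of radius ⌊n/d⌋, and 4·2^k + 1 ≤ 9 n ≤ 9 d (2⌊n/d⌋ + 1). -/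
theorem card_latticeBox_le_mul_card_latticeBall {d : ℕ} (hd : 0 < d) {n k : ℕ} (hn : 0 < n)
    (hk : 2 ^ k ≤ 2 * n) : ((latticeBox d (2 * 2 ^ k)).card : ℝ)
      ≤ (9 * d : ℝ) ^ d * (latticeBall (0 : Fin d → ℤ) n).card := by
  have h1 : latticeBox d (n / d) ⊆ latticeBall (0 : Fin d → ℤ) n := by
    intro x hx
    rw [mem_latticeBox] at hx
    rw [mem_latticeBall]
    calc ∑ i, |x i - (0 : Fin d → ℤ) i| ≤ ∑ _i : Fin d, ((n / d : ℕ) : ℤ) :=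
          Finset.sum_le_sum fun i _ => by
            simpa using abs_le.2 (hx i)
      _ = ((d * (n / d) : ℕ) : ℤ) := by simp
      _ ≤ (n : ℤ) := by exact_mod_cast Nat.mul_div_le n d
  have h2 := Finset.card_le_card h1
  rw [card_latticeBox] at h2
  have h3 : n ≤ d * (2 * (n / d) + 1) := by
    exact (Nat.lt_mul_div_succ n hd).le.trans (Nat.mul_le_mul_left _ (by omega))
  have h4 : (latticeBox d (2 * 2 ^ k)).card
      ≤ (9 * d) ^ d * (latticeBall (0 : Fin d → ℤ) n).card := by
    rw [card_latticeBox]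
    calc (2 * (2 * 2 ^ k) + 1) ^ d ≤ (9 * d * (2 * (n / d) + 1)) ^ d := by
          refine Nat.pow_le_pow_left ?_ d
          rw [mul_assoc]
          omega
      _ = (9 * d) ^ d * (2 * (n / d) + 1) ^ d := mul_pow _ _ _
      _ ≤ _ := Nat.mul_le_mul_left _ h2
  exact_mod_cast h4

/-- The ball of radius n and the time interval [0, n²] sit in a dyadic cylinder of comparable
volume, so the dyadic estimates for the components suffice. -/
theorem GeneratesHarmonicCoord.sublinear {d : ℕ} (hd : 0 < d) [MeasurableSpace (Env d)]
    {P : Measure (Env d)} [IsProbabilityMeasure P] (hP : StationaryErgodicLaw P)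
    {Φ₀ : Fin d → Env d → (Fin d → ℤ) → ℝ} (hΦ : GeneratesHarmonicCoord P Φ₀) :
    ∀ᵐ ω ∂P,
      (∀ (x : Fin d → ℤ) (a b : ℝ),
        IntervalIntegrable (fun t => ‖corrector Φ₀ ω t x‖) volume a b) ∧
      Tendsto (fun n : ℕ => 1 / (n : ℝ) ^ 3 *
          ∫ t in (0 : ℝ)..(n : ℝ) ^ 2,
            1 / ((latticeBall (0 : Fin d → ℤ) n).card : ℝ) *
              ∑ x ∈ latticeBall (0 : Fin d → ℤ) n, ‖corrector Φ₀ ω t x‖)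
        atTop (𝓝 0) := by
  filter_upwards [hΦ.continuous_coord, ae_all_iff.2 fun j => hΦ.spatial_oscillation hP j,
    ae_all_iff.2 fun j => hΦ.temporal_oscillation hP j] with ω hc hs ht
  have hcX : ∀ (j : Fin d) (x : Fin d → ℤ),
      Continuous fun t => (x j : ℝ) - harmonicCoord Φ₀ j ω t x :=
    fun j x => continuous_const.sub (hc j x)
  have hcn : ∀ x, Continuous fun t => ‖corrector Φ₀ ω t x‖ := fun x =>
    ((PiLp.continuous_toLp 2 _).comp (continuous_pi fun j => hcX j x)).norm
  refine ⟨fun x a b => (hcn x).intervalIntegrable a b, ?_⟩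
  have hsub : ∀ j, ∀ ε > (0 : ℝ), ∀ᶠ k : ℕ in atTop,
      ∫ t in (0 : ℝ)..4 ^ k, ∑ x ∈ latticeBox d (2 * 2 ^ k),
        |(x j : ℝ) - harmonicCoord Φ₀ j ω t x|
        ≤ ε * (2 ^ k * 4 ^ k * (latticeBox d (2 * 2 ^ k)).card) := fun j =>
    eventually_integral_le_of_oscillation
      (X := fun x t => (x j : ℝ) - harmonicCoord Φ₀ j ω t x) (hcX j) (hs j) (ht j)
  rw [Metric.tendsto_atTop]
  intro ε hε
  have hδ : 0 < ε / (2 * (d * (8 * (9 * d) ^ d))) := by positivity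
  set δ := ε / (2 * (d * (8 * (9 * d : ℝ) ^ d))) with hδdef
  obtain ⟨K, hK⟩ := eventually_atTop.1 (eventually_all.2 fun j => hsub j δ hδ)
  refine ⟨2 ^ K + 2, fun n hn => ?_⟩
  have hn1 : 1 < n := by
    have : 0 < 2 ^ K := by positivity
    omega
  -- The least k with n ≤ 2^k, so that 2^k ≤ 2n and 2^k 4^k ≤ 8 n³.
  set k := Nat.clog 2 n with hk
  have hnk : n ≤ 2 ^ k := Nat.le_pow_clog (by norm_num) n
  have hkn : 2 ^ k ≤ 2 * n := by
    have h1 := Nat.pow_pred_clog_lt_self (b := 2) (by norm_num) hn1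
    have h2 : 0 < k := Nat.clog_pos (by norm_num) hn1
    rw [← hk] at h1
    obtain ⟨l, hl⟩ : ∃ l, k = l + 1 := ⟨k - 1, by omega⟩
    rw [hl] at h1 ⊢
    rw [Nat.pred_succ] at h1
    rw [pow_succ]
    omega
  have hKk : K ≤ k := by
    by_contra hlt
    push Not at hlt
    have : 2 ^ k ≤ 2 ^ K := Nat.pow_le_pow_right (by norm_num) hlt.le
    omega
  have hnk' : (n : ℝ) ^ 2 ≤ 4 ^ k := by
    have h1 : (n : ℝ) ≤ 2 ^ k := by exact_mod_cast hnk
    calc (n : ℝ) ^ 2 ≤ (2 ^ k) ^ 2 := by gcongr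
      _ = 4 ^ k := by rw [← pow_mul, mul_comm k 2, pow_mul]; norm_num
  have hsubset : latticeBall (0 : Fin d → ℤ) n ⊆ latticeBox d (2 * 2 ^ k) := fun x hx =>
    latticeBox_mono (by omega) (mem_latticeBox_of_mem_latticeBall hx)
  have hcard : (0 : ℝ) < (latticeBall (0 : Fin d → ℤ) n).card := by
    exact_mod_cast Finset.card_pos.2 ⟨0, by simp [mem_latticeBall]⟩
  set N : ℝ := ((latticeBall (0 : Fin d → ℤ) n).card : ℝ) with hN
  have hn0 : (0 : ℝ) < n := by positivity
  have hcS : Continuous fun t => ∑ x ∈ latticeBox d (2 * 2 ^ k), ∑ j,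
      |(x j : ℝ) - harmonicCoord Φ₀ j ω t x| :=
    continuous_finsetSum _ fun x _ => continuous_finsetSum _ fun j _ => (hcX j x).abs
  have hmain : ∫ t in (0 : ℝ)..(n : ℝ) ^ 2, ∑ x ∈ latticeBall (0 : Fin d → ℤ) n,
      ‖corrector Φ₀ ω t x‖ ≤ d * (δ * (2 ^ k * 4 ^ k * (latticeBox d (2 * 2 ^ k)).card)) := by
    calc _ ≤ ∫ t in (0 : ℝ)..(n : ℝ) ^ 2, ∑ x ∈ latticeBox d (2 * 2 ^ k), ∑ j,
          |(x j : ℝ) - harmonicCoord Φ₀ j ω t x| := by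
          refine intervalIntegral.integral_mono_on (by positivity)
            ((continuous_finsetSum _ fun x _ => hcn x).intervalIntegrable _ _)
            (hcS.intervalIntegrable _ _) fun t _ => ?_
          refine (Finset.sum_le_sum_of_subset_of_nonneg hsubset fun _ _ _ => norm_nonneg _).trans ?_
          exact Finset.sum_le_sum fun x _ => EuclideanSpace.norm_le_sum_abs _
      _ ≤ ∫ t in (0 : ℝ)..4 ^ k, ∑ x ∈ latticeBox d (2 * 2 ^ k), ∑ j,
          |(x j : ℝ) - harmonicCoord Φ₀ j ω t x| := by
          refine intervalIntegral.integral_mono_interval le_rfl (by positivity) hnk' ?_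
            (hcS.intervalIntegrable _ _)
          exact Eventually.of_forall fun t => Finset.sum_nonneg fun _ _ =>
            Finset.sum_nonneg fun _ _ => abs_nonneg _
      _ = ∑ j, ∫ t in (0 : ℝ)..4 ^ k, ∑ x ∈ latticeBox d (2 * 2 ^ k),
          |(x j : ℝ) - harmonicCoord Φ₀ j ω t x| := by
          rw [← intervalIntegral.integral_finsetSum]
          · refine intervalIntegral.integral_congr fun t _ => ?_
            exact Finset.sum_comm
          · exact fun j _ =>
              (continuous_finsetSum _ fun x _ => (hcX j x).abs).intervalIntegrable _ _
      _ ≤ ∑ _j : Fin d, δ * (2 ^ k * 4 ^ k * (latticeBox d (2 * 2 ^ k)).card) :=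
          Finset.sum_le_sum fun j _ => hK k hKk j
      _ = _ := by simp
  have hpow : (2 : ℝ) ^ k * 4 ^ k ≤ 8 * (n : ℝ) ^ 3 := by
    have h1 : (2 : ℝ) ^ k ≤ 2 * n := by exact_mod_cast hkn
    have h4 : (4 : ℝ) ^ k = 2 ^ k * 2 ^ k := by rw [← mul_pow]; norm_num
    calc (2 : ℝ) ^ k * 4 ^ k = (2 ^ k) ^ 3 := by rw [h4]; ring
      _ ≤ (2 * n) ^ 3 := by gcongr
      _ = _ := by ring
  have hbox := card_latticeBox_le_mul_card_latticeBall hd (by omega) hkn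
  rw [intervalIntegral.integral_const_mul, dist_zero_right, Real.norm_eq_abs, abs_of_nonneg]
  · calc 1 / (n : ℝ) ^ 3 * (1 / N * _)
        ≤ 1 / (n : ℝ) ^ 3 * (1 / N *
          (d * (δ * (8 * (n : ℝ) ^ 3 * ((9 * d : ℝ) ^ d * N))))) := by
          gcongr
          exact hmain.trans (by gcongr)
      _ = δ * (d * (8 * (9 * d : ℝ) ^ d)) := by
          field_simp
      _ = ε / 2 := by
          have : (d : ℝ) ≠ 0 := by exact_mod_cast hd.ne'
          rw [hδdef]
          field_simp
      _ < ε := half_lt_self hε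
  · have : 0 ≤ ∫ t in (0 : ℝ)..(n : ℝ) ^ 2, ∑ x ∈ latticeBall (0 : Fin d → ℤ) n,
        ‖corrector Φ₀ ω t x‖ := intervalIntegral.integral_nonneg (by positivity)
          fun t _ => Finset.sum_nonneg fun _ _ => norm_nonneg _
    positivity

/-! ### Test functions that are differentiable in time -/

theorem bounded_add {d : ℕ} {f g : Env d → ℝ}
    (hf : ∃ C, ∀ ω, |f ω| ≤ C) (hg : ∃ C, ∀ ω, |g ω| ≤ C) :
    ∃ C, ∀ ω, |f ω + g ω| ≤ C := by
  obtain ⟨C, hC⟩ := hf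
  obtain ⟨D, hD⟩ := hg
  exact ⟨C + D, fun ω => (abs_add_le _ _).trans (add_le_add (hC ω) (hD ω))⟩

theorem bounded_const_mul {d : ℕ} (c : ℝ) {f : Env d → ℝ} (hf : ∃ C, ∀ ω, |f ω| ≤ C) :
    ∃ C, ∀ ω, |c * f ω| ≤ C := by
  obtain ⟨C, hC⟩ := hf
  refine ⟨|c| * C, fun ω => ?_⟩
  rw [abs_mul]
  exact mul_le_mul_of_nonneg_left (hC ω) (abs_nonneg c)

section TestPair

variable {d : ℕ} [MeasurableSpace (Env d)] {P : Measure (Env d)}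

/-- `ζ` is a bounded measurable function with the bounded measurable time derivative `ζ'`. -/
structure IsTestPair (ζ ζ' : Env d → ℝ) : Prop where
  measurable : Measurable ζ
  measurable' : Measurable ζ'
  bounded : ∃ C, ∀ ω, |ζ ω| ≤ C
  bounded' : ∃ C, ∀ ω, |ζ' ω| ≤ C
  sub_eq : ∀ (ω : Env d) (t : ℝ), ζ (ω.shift t 0) - ζ ω = ∫ s in (0 : ℝ)..t, ζ' (ω.shift s 0)

namespace IsTestPair

theorem zero : IsTestPair (fun _ : Env d => (0 : ℝ)) (fun _ => 0) :=
  ⟨measurable_const, measurable_const, ⟨0, by simp⟩, ⟨0, by simp⟩, by simp⟩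

theorem intervalIntegrable (hP : StationaryErgodicLaw P) {ζ ζ' : Env d → ℝ}
    (h : IsTestPair ζ ζ') (ω : Env d) (x : Fin d → ℤ) (a b : ℝ) :
    IntervalIntegrable (fun t => ζ' (ω.shift t x)) volume a b := by
  obtain ⟨C, hC⟩ := h.bounded'
  exact hP.intervalIntegrable_of_bounded h.measurable' hC ω x a b

theorem add (hP : StationaryErgodicLaw P) {ζ ζ' ξ ξ' : Env d → ℝ} (h : IsTestPair ζ ζ')
    (k : IsTestPair ξ ξ') : IsTestPair (fun ω => ζ ω + ξ ω) (fun ω => ζ' ω + ξ' ω) :=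
  ⟨h.measurable.add k.measurable, h.measurable'.add k.measurable',
    bounded_add h.bounded k.bounded, bounded_add h.bounded' k.bounded', fun ω t => by
      rw [intervalIntegral.integral_add (h.intervalIntegrable hP ω 0 0 t)
        (k.intervalIntegrable hP ω 0 0 t), ← h.sub_eq, ← k.sub_eq]
      ring⟩

theorem const_mul {ζ ζ' : Env d → ℝ} (h : IsTestPair ζ ζ') (c : ℝ) :
    IsTestPair (fun ω => c * ζ ω) (fun ω => c * ζ' ω) :=
  ⟨h.measurable.const_mul c, h.measurable'.const_mul c, bounded_const_mul c h.bounded,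
    bounded_const_mul c h.bounded', fun ω t => by
      rw [intervalIntegral.integral_const_mul, ← h.sub_eq]
      ring⟩

theorem comp_shift (hP : StationaryErgodicLaw P) {ζ ζ' : Env d → ℝ} (h : IsTestPair ζ ζ')
    (x : Fin d → ℤ) : IsTestPair (fun ω => ζ (ω.shift 0 x)) (fun ω => ζ' (ω.shift 0 x)) := by
  refine ⟨h.measurable.comp (hP.measurable_shift_fixed 0 x),
    h.measurable'.comp (hP.measurable_shift_fixed 0 x), ?_, ?_, fun ω t => ?_⟩
  · obtain ⟨C, hC⟩ := h.bounded
    exact ⟨C, fun ω => hC _⟩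
  · obtain ⟨C, hC⟩ := h.bounded'
    exact ⟨C, fun ω => hC _⟩
  · have := h.sub_eq (ω.shift 0 x) t
    simpa only [Env.shift_shift, zero_add, add_zero] using this

theorem sub_shift (hP : StationaryErgodicLaw P) {ζ ζ' : Env d → ℝ} (h : IsTestPair ζ ζ')
    (x : Fin d → ℤ) :
    IsTestPair (fun ω => ζ (ω.shift 0 x) - ζ ω) (fun ω => ζ' (ω.shift 0 x) - ζ' ω) := by
  have := (h.comp_shift hP x).add hP (h.const_mul (-1))
  simpa only [neg_one_mul, ← sub_eq_add_neg] using this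

theorem sum (hP : StationaryErgodicLaw P) {ι : Type*} (s : Finset ι) {ζ ζ' : ι → Env d → ℝ}
    (h : ∀ i, IsTestPair (ζ i) (ζ' i)) :
    IsTestPair (fun ω => ∑ i ∈ s, ζ i ω) (fun ω => ∑ i ∈ s, ζ' i ω) := by
  classical
  induction s using Finset.induction_on with
  | empty => simpa using zero
  | insert a s ha ih =>
    simp only [Finset.sum_insert ha]
    exact (h a).add hP ih

theorem integrable_mul {ζ : Env d → ℝ} (hm : Measurable ζ) (hb : ∃ C, ∀ ω, |ζ ω| ≤ C)
    {F : Env d → ℝ} (hF : Integrable F P) : Integrable (fun ω => F ω * ζ ω) P := by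
  obtain ⟨C, hC⟩ := hb
  exact hF.mul_bdd (c := C) hm.aestronglyMeasurable (Eventually.of_forall hC)

theorem integrable [IsProbabilityMeasure P] {ζ : Env d → ℝ} (hm : Measurable ζ)
    (hb : ∃ C, ∀ ω, |ζ ω| ≤ C) : Integrable ζ P := by
  obtain ⟨C, hC⟩ := hb
  exact Integrable.of_bound hm.aestronglyMeasurable C (Eventually.of_forall hC)

end IsTestPair

theorem StationaryErgodicLaw.integral_intervalIntegral_shift [IsProbabilityMeasure P]
    (hP : StationaryErgodicLaw P) {F : Env d → ℝ} (hF : Integrable F P) (x : Fin d → ℤ)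
    {a b : ℝ} (hab : a ≤ b) :
    ∫ ω, (∫ s in a..b, F (ω.shift s x)) ∂P = (b - a) * ∫ ω, F ω ∂P := by
  simp only [intervalIntegral.integral_of_le hab]
  have hint : Integrable (Function.uncurry fun (ω : Env d) (s : ℝ) => F (ω.shift s x))
      (P.prod (volume.restrict (Set.Ioc a b))) :=
    hP.integrable_prod_shift hF x (I := Set.Ioc a b) (by simp)
  rw [integral_integral_swap hint]
  simp only [hP.integral_comp_shift hF.aestronglyMeasurable]
  rw [setIntegral_const]
  simp [hab]

/-- The time derivative is antisymmetric. -/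
theorem IsTestPair.integral_mul_eq_zero [IsProbabilityMeasure P] (hP : StationaryErgodicLaw P)
    {ζ ζ' : Env d → ℝ} (h : IsTestPair ζ ζ') : ∫ ω, ζ ω * ζ' ω ∂P = 0 := by
  -- The fundamental theorem of calculus for ζ² along a trajectory. By stationarity the expectation
  -- of the right-hand side is zero.
  have hpt : ∀ ω : Env d, ∫ s in (0 : ℝ)..1, 2 * (ζ (ω.shift s 0) * ζ' (ω.shift s 0))
      = ζ (ω.shift 1 0) ^ 2 - ζ ω ^ 2 := by
    intro ω
    have hi := h.intervalIntegrable hP ω 0 0 1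
    have hg : (fun t => ζ (ω.shift t 0))
        = fun t => ζ ω + ∫ s in (0 : ℝ)..t, ζ' (ω.shift s 0) := by
      ext t
      rw [← h.sub_eq]
      ring
    have hac : AbsolutelyContinuousOnInterval (fun t => ζ (ω.shift t 0)) 0 1 := by
      rw [hg]
      exact (LipschitzWith.const (ζ ω)).lipschitzOnWith.absolutelyContinuousOnInterval.add
        (hi.absolutelyContinuousOnInterval_intervalIntegral (by simp))
    have hd : ∀ᵐ t : ℝ, t ∈ Set.uIcc (0 : ℝ) 1 →
        deriv (fun t => ζ (ω.shift t 0)) t = ζ' (ω.shift t 0) := by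
      filter_upwards [hi.ae_hasDerivAt_integral] with t ht htm
      rw [hg]
      exact ((ht htm 0 (by simp)).const_add (ζ ω)).deriv
    have := hac.integral_deriv_mul_eq_sub hac
    simp only [Env.shift_zero] at this
    rw [pow_two, pow_two, ← this]
    refine intervalIntegral.integral_congr_ae ?_
    filter_upwards [hd] with t ht htm
    rw [ht (Set.uIoc_subset_uIcc htm)]
    ring
  have hint : Integrable (fun ω => ζ ω * ζ' ω) P :=
    IsTestPair.integrable_mul h.measurable' h.bounded'
      (IsTestPair.integrable h.measurable h.bounded)
  have h1 := hP.integral_intervalIntegral_shift (hint.const_mul 2) 0 (a := 0) (b := 1) zero_le_one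
  simp only [hpt] at h1
  have hsq : Integrable (fun ω => ζ ω ^ 2) P := by
    simp only [pow_two]
    exact IsTestPair.integrable_mul h.measurable h.bounded
      (IsTestPair.integrable h.measurable h.bounded)
  rw [integral_sub (hP.integrable_comp_shift hsq 1 0) hsq,
    hP.integral_comp_shift hsq.aestronglyMeasurable, integral_const_mul] at h1
  linarith

/-- Pairs of test functions and their time derivatives. -/
def testPairs (hP : StationaryErgodicLaw P) : Submodule ℝ ((Env d → ℝ) × (Env d → ℝ)) where
  carrier := {p | IsTestPair p.1 p.2}
  add_mem' := fun h k => h.add hP k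
  zero_mem' := IsTestPair.zero
  smul_mem' := fun c _ h => h.const_mul c

/-! ### Abstract existence for weak equations -/

/-- The bound makes ℓ vanish on the kernel of `A`, so ℓ descends to a continuous functional on the
range, which is extended by Hahn–Banach and represented by Riesz. No continuity of `A` is required.
-/
theorem exists_inner_eq_of_bound {V H : Type*} [AddCommGroup V] [Module ℝ V]
    [NormedAddCommGroup H] [InnerProductSpace ℝ H] [CompleteSpace H] (A : V →ₗ[ℝ] H)
    (ℓ : V →ₗ[ℝ] ℝ) (C : ℝ) (h : ∀ v, |ℓ v| ≤ C * ‖A v‖) :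
    ∃ u : H, ∀ v, inner ℝ u (A v) = ℓ v := by
  have hker : LinearMap.ker A ≤ LinearMap.ker ℓ := by
    intro v hv
    rw [LinearMap.mem_ker] at hv ⊢
    have := h v
    rw [hv, norm_zero, mul_zero] at this
    exact abs_nonpos_iff.1 this
  let f0 : LinearMap.range A →ₗ[ℝ] ℝ :=
    (LinearMap.ker A).liftQ ℓ hker ∘ₗ A.quotKerEquivRange.symm.toLinearMap
  have hf0 : ∀ v, f0 ⟨A v, LinearMap.mem_range_self A v⟩ = ℓ v := by
    intro v
    simp only [f0, LinearMap.comp_apply, LinearEquiv.coe_coe]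
    rw [LinearMap.quotKerEquivRange_symm_apply_image]
    simp
  let f : LinearMap.range A →L[ℝ] ℝ := f0.mkContinuous C (by
    rintro ⟨_, v, rfl⟩
    have := hf0 v
    rw [show (⟨A v, ⟨v, rfl⟩⟩ : LinearMap.range A) = ⟨A v, LinearMap.mem_range_self A v⟩ from rfl,
      this]
    exact h v)
  obtain ⟨g, hg, _⟩ := exists_extension_norm_eq (LinearMap.range A) f
  refine ⟨(InnerProductSpace.toDual ℝ H).symm g, fun v => ?_⟩
  rw [InnerProductSpace.toDual_symm_apply]
  exact (hg ⟨A v, LinearMap.mem_range_self A v⟩).trans (hf0 v)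

/-- Lions' form of the Lax–Milgram lemma, in a closed subspace `K`. -/
theorem exists_mem_inner_eq_of_coercive {V H : Type*} [AddCommGroup V] [Module ℝ V]
    [NormedAddCommGroup H] [InnerProductSpace ℝ H] [CompleteSpace H] (K : Submodule ℝ H)
    (hK : IsClosed (K : Set H)) (J A : V →ₗ[ℝ] H) (hJ : ∀ v, J v ∈ K) {c : ℝ} (hc : 0 < c)
    (hcoer : ∀ v, c * ‖J v‖ ^ 2 ≤ inner ℝ (J v) (A v)) (w : H) :
    ∃ u ∈ K, ∀ v, inner ℝ u (A v) = inner ℝ w (J v) := by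
  have : CompleteSpace K := hK.completeSpace_coe
  -- As J v lies in `K`, its inner product with A v sees only the projection of A v. The projected
  -- operator is thus bounded below by `J`, while the solution is kept in `K`.
  have hbound : ∀ v, c * ‖J v‖ ≤ ‖K.orthogonalProjectionOnto (A v)‖ := by
    intro v
    have h1 : inner ℝ (J v) (A v) = inner ℝ (⟨J v, hJ v⟩ : K) (K.orthogonalProjectionOnto (A v)) :=
      (Submodule.inner_orthogonalProjectionOnto_eq_of_mem_left ⟨J v, hJ v⟩ (A v)).symm
    have h2 := real_inner_le_norm (⟨J v, hJ v⟩ : K) (K.orthogonalProjectionOnto (A v))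
    rw [← h1, Submodule.coe_norm] at h2
    rcases (norm_nonneg (J v)).eq_or_lt with h0 | h0
    · rw [← h0, mul_zero]
      exact norm_nonneg _
    · have h3 : (c * ‖J v‖) * ‖J v‖ ≤ ‖K.orthogonalProjectionOnto (A v)‖ * ‖J v‖ := by
        have := hcoer v
        nlinarith
      exact le_of_mul_le_mul_right h3 h0
  obtain ⟨u, hu⟩ := exists_inner_eq_of_bound (K.orthogonalProjectionOnto.toLinearMap ∘ₗ A)
    ((innerₛₗ ℝ w) ∘ₗ J) (‖w‖ / c) (fun v => by
      have h1 := abs_real_inner_le_norm w (J v)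
      have h2 := hbound v
      simp only [LinearMap.comp_apply, innerₛₗ_apply_apply, ContinuousLinearMap.coe_coe]
      refine h1.trans ?_
      rw [div_mul_eq_mul_div, le_div_iff₀ hc]
      calc ‖w‖ * ‖J v‖ * c = ‖w‖ * (c * ‖J v‖) := by ring
        _ ≤ _ := by gcongr)
  refine ⟨u, u.2, fun v => ?_⟩
  have h1 := hu v
  simp only [LinearMap.comp_apply, innerₛₗ_apply_apply, ContinuousLinearMap.coe_coe] at h1
  rw [← h1]
  exact (Submodule.inner_orthogonalProjectionOnto_eq_of_mem_left u (A v)).symm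

end TestPair

/-! ### The weak corrector equation -/

/-- Coordinate directions. -/
def coordDir (d : ℕ) (i : Fin d) : Fin d → ℤ := Pi.single i 1

theorem coordDir_injective {d : ℕ} : Function.Injective (coordDir d) := by
  intro i j h
  by_contra hij
  have := congrFun h i
  simp [coordDir, hij] at this

theorem adj_coordDir {d : ℕ} (i : Fin d) : (latticeGraph d).Adj 0 (coordDir d i) :=
  latticeGraph_adj_single i

section WeakEquation

variable {d : ℕ} [MeasurableSpace (Env d)] {P : Measure (Env d)}

theorem memLp_horizGrad [IsProbabilityMeasure P] (hP : StationaryErgodicLaw P) {φ : Env d → ℝ}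
    (hm : Measurable φ) (hb : ∃ C, ∀ ω, |φ ω| ≤ C) : MemLp (horizGrad φ) 2 (gradMeasure P) := by
  obtain ⟨C, hC⟩ := hb
  have hmz : ∀ z, Measurable fun ω => horizGrad φ (ω, z) := fun z =>
    (hm.comp (hP.measurable_shift_fixed 0 z)).sub hm
  refine memLp_two_gradMeasure hP (fun z _ => (hmz z).aestronglyMeasurable) fun z _ => ?_
  refine (hP.integrable_cond_apply 0 0 z).mul_bdd (c := (C + C) ^ 2)
    ((hmz z).pow_const 2).aestronglyMeasurable (Eventually.of_forall fun ω => ?_)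
  rw [Real.norm_eq_abs, abs_pow]
  exact pow_le_pow_left₀ (abs_nonneg _) ((abs_sub _ _).trans (add_le_add (hC _) (hC _))) 2

variable (P) in
/-- The gradients of bounded measurable functions. -/
def gradSubmodule :
    Submodule ℝ (Lp ℝ 2 (gradMeasure P)) where
  carrier := {g | ∃ φ : Env d → ℝ, Measurable φ ∧ (∃ C : ℝ, ∀ ω, |φ ω| ≤ C) ∧
    g =ᵐ[gradMeasure P] horizGrad φ}
  add_mem' := by
    rintro f g ⟨φ, hφ, hφb, hf⟩ ⟨ξ, hξ, hξb, hg⟩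
    refine ⟨fun ω => φ ω + ξ ω, hφ.add hξ, bounded_add hφb hξb, ?_⟩
    filter_upwards [Lp.coeFn_add f g, hf, hg] with p h1 h2 h3
    rw [h1, Pi.add_apply, h2, h3]
    simp only [horizGrad]
    ring
  zero_mem' := by
    refine ⟨fun _ => 0, measurable_const, ⟨0, by simp⟩, ?_⟩
    filter_upwards [Lp.coeFn_zero ℝ 2 (gradMeasure P)] with p h1
    rw [h1]
    simp [horizGrad]
  smul_mem' := by
    rintro c f ⟨φ, hφ, hφb, hf⟩
    refine ⟨fun ω => c * φ ω, hφ.const_mul c, bounded_const_mul c hφb, ?_⟩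
    filter_upwards [Lp.coeFn_smul c f, hf] with p h1 h2
    rw [h1, Pi.smul_apply, h2, smul_eq_mul]
    simp only [horizGrad]
    ring

theorem inner_toLp_gradMeasure [IsProbabilityMeasure P] (hP : StationaryErgodicLaw P)
    (h : Lp ℝ 2 (gradMeasure P)) {f : Env d × (Fin d → ℤ) → ℝ} (hf : MemLp f 2 (gradMeasure P)) :
    inner ℝ h (hf.toLp f) = ∑ z ∈ latticeBall (0 : Fin d → ℤ) 1,
      ∫ ω, ω.cond 0 0 z * (h (ω, z) * f (ω, z)) ∂P := by
  rw [L2.inner_def, integral_gradMeasure hP (L2.integrable_inner h _)]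
  refine Finset.sum_congr rfl fun z _ => ?_
  by_cases hz : (latticeGraph d).Adj 0 z
  · refine integral_congr_ae ?_
    filter_upwards [(ae_gradMeasure_iff hP).1 hf.coeFn_toLp z hz] with ω hω
    rw [hω]
    simp [mul_comm]
  · simp [Env.cond_eq_zero _ _ hz]

/-- The test function `∑_i (ζ_i ∘ τ_{0,-e_i} - ζ_i)`, for a component of test pairs. -/
def divTest (ζ : Fin d → Env d → ℝ) (ω : Env d) : ℝ :=
  ∑ i, (ζ i (ω.shift 0 (-coordDir d i)) - ζ i ω)

theorem isTestPair_divTest (hP : StationaryErgodicLaw P) {ζ ζ' : Fin d → Env d → ℝ}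
    (h : ∀ i, IsTestPair (ζ i) (ζ' i)) : IsTestPair (divTest ζ) (divTest ζ') :=
  IsTestPair.sum hP Finset.univ fun i => (h i).sub_shift hP (-coordDir d i)

open Classical in
/-- The density of the linear functional `h ↦ ∑_i E[h(·, e_i) ξ_i]` in `L²(m)`. -/
noncomputable def dirField (ξ : Fin d → Env d → ℝ) (p : Env d × (Fin d → ℤ)) : ℝ :=
  (∑ i, if p.2 = coordDir d i then ξ i p.1 else 0) * (p.1.cond 0 0 p.2)⁻¹

/-- The weight ω of the measure and the square of the factor 1/ω combine to 1/ω, which is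
integrable. -/
theorem memLp_dirField [IsProbabilityMeasure P] (hP : StationaryErgodicLaw P)
    {ξ : Fin d → Env d → ℝ} (hm : ∀ i, Measurable (ξ i)) (hb : ∀ i, ∃ C, ∀ ω, |ξ i ω| ≤ C) :
    MemLp (dirField ξ) 2 (gradMeasure P) := by
  classical
  choose C hC using hb
  have hmz : ∀ z : Fin d → ℤ,
      Measurable fun ω => ∑ i, if z = coordDir d i then ξ i ω else 0 := fun z =>
    Finset.measurable_fun_sum _ fun i _ => by
      by_cases hz : z = coordDir d i
      · simpa [hz] using hm i
      · simp [hz]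
  refine memLp_two_gradMeasure hP (fun z _ => (hmz z).aestronglyMeasurable.mul
    (hP.integrable_inv_cond_apply 0 0 z).aestronglyMeasurable) fun z hz => ?_
  have heq : ∀ ω : Env d, ω.cond 0 0 z * dirField ξ (ω, z) ^ 2
      = (ω.cond 0 0 z)⁻¹ * (∑ i, if z = coordDir d i then ξ i ω else 0) ^ 2 := by
    intro ω
    have := (ω.cond_pos 0 hz).ne'
    simp only [dirField]
    field_simp
  simp only [heq]
  refine (hP.integrable_inv_cond_apply 0 0 z).mul_bdd (c := (∑ i, C i) ^ 2)
    ((hmz z).pow_const 2).aestronglyMeasurable (Eventually.of_forall fun ω => ?_)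
  rw [Real.norm_eq_abs, abs_pow]
  refine pow_le_pow_left₀ (abs_nonneg _) ((Finset.abs_sum_le_sum_abs _ _).trans
    (Finset.sum_le_sum fun i _ => ?_)) 2
  by_cases hz : z = coordDir d i
  · simpa [hz] using hC i ω
  · simpa [hz] using (abs_nonneg _).trans (hC i ω)

theorem inner_dirField [IsProbabilityMeasure P] (hP : StationaryErgodicLaw P)
    (h : Lp ℝ 2 (gradMeasure P)) {ξ : Fin d → Env d → ℝ} (hm : ∀ i, Measurable (ξ i))
    (hb : ∀ i, ∃ C, ∀ ω, |ξ i ω| ≤ C) :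
    inner ℝ h ((memLp_dirField hP hm hb).toLp (dirField ξ))
      = ∑ i, ∫ ω, h (ω, coordDir d i) * ξ i ω ∂P := by
  classical
  rw [inner_toLp_gradMeasure hP]
  have h1 : ∀ z ∈ latticeBall (0 : Fin d → ℤ) 1,
      ∫ ω, ω.cond 0 0 z * (h (ω, z) * dirField ξ (ω, z)) ∂P
        = ∑ i, if z = coordDir d i then ∫ ω, h (ω, coordDir d i) * ξ i ω ∂P else 0 := by
    intro z _
    by_cases hz : ∃ i, z = coordDir d i
    · obtain ⟨i, rfl⟩ := hz
      simp only [dirField, coordDir_injective.eq_iff, Finset.sum_ite_eq, Finset.mem_univ, if_true]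
      refine integral_congr_ae (Eventually.of_forall fun ω => ?_)
      have := (ω.cond_pos 0 (adj_coordDir i)).ne'
      simp only
      field_simp
    · push Not at hz
      simp [dirField, hz]
  rw [Finset.sum_congr rfl h1, Finset.sum_comm]
  refine Finset.sum_congr rfl fun i _ => ?_
  rw [Finset.sum_ite_eq' (latticeBall (0 : Fin d → ℤ) 1) (coordDir d i), if_pos]
  exact mem_latticeBall_zero_one (adj_coordDir i)

/-- Summation by parts. -/
theorem sum_integral_grad_mul_eq [IsProbabilityMeasure P] (hP : StationaryErgodicLaw P)
    {η : Env d → ℝ} (hm : Measurable η) (hb : ∃ C, ∀ ω, |η ω| ≤ C) {ξ : Fin d → Env d → ℝ}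
    (hξm : ∀ i, Measurable (ξ i)) (hξb : ∀ i, ∃ C, ∀ ω, |ξ i ω| ≤ C) :
    ∑ i, ∫ ω, horizGrad η (ω, coordDir d i) * ξ i ω ∂P = ∫ ω, η ω * divTest ξ ω ∂P := by
  have hηi := IsTestPair.integrable (P := P) hm hb
  have hi1 : ∀ i, Integrable (fun ω => η ω * ξ i (ω.shift 0 (-coordDir d i))) P := fun i => by
    obtain ⟨C, hC⟩ := hξb i
    exact IsTestPair.integrable_mul ((hξm i).comp (hP.measurable_shift_fixed 0 _))
      ⟨C, fun ω => hC _⟩ hηi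
  have hi2 : ∀ i, Integrable (fun ω => η ω * ξ i ω) P := fun i =>
    IsTestPair.integrable_mul (hξm i) (hξb i) hηi
  have hi3 : ∀ i, Integrable (fun ω => η (ω.shift 0 (coordDir d i)) * ξ i ω) P := fun i =>
    IsTestPair.integrable_mul (hξm i) (hξb i) (hP.integrable_comp_shift hηi 0 _)
  simp only [divTest, Finset.mul_sum, mul_sub]
  rw [integral_finsetSum (f := fun i ω => η ω * ξ i (ω.shift 0 (-coordDir d i)) - η ω * ξ i ω) _
    fun i _ => (hi1 i).sub (hi2 i)]
  refine Finset.sum_congr rfl fun i _ => ?_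
  rw [integral_sub (hi1 i) (hi2 i)]
  have h1 := hP.integral_comp_shift (hi1 i).aestronglyMeasurable 0 (coordDir d i)
  simp only [Env.shift_shift, add_zero, neg_add_cancel, Env.shift_zero] at h1
  rw [← h1, ← integral_sub (hi3 i) (hi2 i)]
  refine integral_congr_ae (Eventually.of_forall fun ω => ?_)
  simp only [horizGrad]
  ring

theorem memLp_coord [IsProbabilityMeasure P] (hP : StationaryErgodicLaw P) (j : Fin d) :
    MemLp (fun p : Env d × (Fin d → ℤ) => (p.2 j : ℝ)) 2 (gradMeasure P) :=
  memLp_two_gradMeasure hP (fun z _ => aestronglyMeasurable_const (b := (z j : ℝ))) fun z _ =>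
    (hP.integrable_cond_apply 0 0 z).mul_const ((z j : ℝ) ^ 2)

/-- There is a potential field `u` such that `x - u` solves the weak form of the equation
`∂_t Φ + L_t Φ = 0`. -/
theorem exists_weak_solution [IsProbabilityMeasure P] (hP : StationaryErgodicLaw P) (j : Fin d) :
    ∃ u ∈ L2pot P, ∀ (i : Fin d) (ζ ζ' : Env d → ℝ), IsTestPair ζ ζ' →
      ∑ z ∈ latticeBall (0 : Fin d → ℤ) 1, ∫ ω, ω.cond 0 0 z * (((z j : ℝ) - u (ω, z)) *
        horizGrad (fun ω => ζ (ω.shift 0 (-coordDir d i)) - ζ ω) (ω, z)) ∂P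
        = 2 * ∫ ω, u (ω, coordDir d i) * ζ' ω ∂P := by
  classical
  -- A potential field need not be the gradient of a stationary function in L². Testing with
  -- divergences moves the time derivative onto the components of u, which are well defined.
  let V := Fin d → testPairs hP
  have hpair : ∀ (v : V) (i : Fin d), IsTestPair (v i).1.1 (v i).1.2 := fun v i => (v i).2
  have hadd1 : ∀ (v w : V) i, ((v + w) i).1.1 = (v i).1.1 + (w i).1.1 := fun _ _ _ => rfl
  have hadd2 : ∀ (v w : V) i, ((v + w) i).1.2 = (v i).1.2 + (w i).1.2 := fun _ _ _ => rfl
  have hsmul1 : ∀ (c : ℝ) (v : V) i, ((c • v) i).1.1 = c • (v i).1.1 := fun _ _ _ => rfl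
  have hsmul2 : ∀ (c : ℝ) (v : V) i, ((c • v) i).1.2 = c • (v i).1.2 := fun _ _ _ => rfl
  have hdiv : ∀ v : V, IsTestPair (divTest fun i => (v i).1.1) (divTest fun i => (v i).1.2) :=
    fun v => isTestPair_divTest hP (hpair v)
  let J : V →ₗ[ℝ] Lp ℝ 2 (gradMeasure P) :=
    { toFun := fun v => (memLp_horizGrad hP (hdiv v).measurable (hdiv v).bounded).toLp _
      map_add' := fun v w => by
        rw [← MemLp.toLp_add]
        refine MemLp.toLp_congr _ _ (Eventually.of_forall fun p => ?_)
        simp only [horizGrad, divTest, Pi.add_apply, hadd1,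
          ← Finset.sum_add_distrib, ← Finset.sum_sub_distrib]
        exact Finset.sum_congr rfl fun i _ => by ring
      map_smul' := fun c v => by
        rw [RingHom.id_apply, ← MemLp.toLp_const_smul]
        refine MemLp.toLp_congr _ _ (Eventually.of_forall fun p => ?_)
        simp only [horizGrad, divTest, Pi.smul_apply, hsmul1,
          smul_eq_mul, ← Finset.sum_sub_distrib, Finset.mul_sum]
        exact Finset.sum_congr rfl fun i _ => by ring }
  let D : V →ₗ[ℝ] Lp ℝ 2 (gradMeasure P) :=
    { toFun := fun v => (memLp_dirField hP (fun i => (hpair v i).measurable')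
        fun i => (hpair v i).bounded').toLp _
      map_add' := fun v w => by
        rw [← MemLp.toLp_add]
        refine MemLp.toLp_congr _ _ (Eventually.of_forall fun p => ?_)
        simp only [dirField, Pi.add_apply, hadd2]
        rw [← add_mul, ← Finset.sum_add_distrib]
        congr 1
        exact Finset.sum_congr rfl fun i _ => by split_ifs <;> simp
      map_smul' := fun c v => by
        rw [RingHom.id_apply, ← MemLp.toLp_const_smul]
        refine MemLp.toLp_congr _ _ (Eventually.of_forall fun p => ?_)
        simp only [dirField, Pi.smul_apply, hsmul2, smul_eq_mul]
        rw [← mul_assoc, Finset.mul_sum]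
        congr 1
        exact Finset.sum_congr rfl fun i _ => by split_ifs <;> simp }
  -- With η = div ζ, summation by parts turns this inner product into E[η η'], which vanishes by
  -- stationarity. Hence the time derivative does not affect coercivity.
  have hJD : ∀ v, inner ℝ (J v) (D v) = 0 := by
    intro v
    refine (inner_dirField hP (J v) (fun i => (hpair v i).measurable')
      fun i => (hpair v i).bounded').trans ?_
    rw [← (hdiv v).integral_mul_eq_zero hP, ← sum_integral_grad_mul_eq hP (hdiv v).measurable
      (hdiv v).bounded (fun i => (hpair v i).measurable') fun i => (hpair v i).bounded']
    refine Finset.sum_congr rfl fun i _ => integral_congr_ae ?_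
    filter_upwards [(ae_gradMeasure_iff hP).1 (memLp_horizGrad hP (hdiv v).measurable
      (hdiv v).bounded).coeFn_toLp _ (adj_coordDir i)] with ω hω
    congr 1
  -- The form is the Dirichlet form ½ J plus the time derivative D; the right-hand side is half the
  -- coordinate field. Coercivity with constant 1/2 is then an equality.
  obtain ⟨u, huK, hu⟩ := exists_mem_inner_eq_of_coercive (gradSubmodule P).topologicalClosure
    (gradSubmodule P).isClosed_topologicalClosure J ((1 / 2 : ℝ) • J + D)
    (fun v => subset_closure ⟨_, (hdiv v).measurable, (hdiv v).bounded, MemLp.coeFn_toLp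
      (memLp_horizGrad hP (hdiv v).measurable (hdiv v).bounded)⟩)
    (c := 1 / 2) (by norm_num)
    (fun v => by
      rw [LinearMap.add_apply, LinearMap.smul_apply, inner_add_right, inner_smul_right, hJD,
        real_inner_self_eq_norm_sq, add_zero])
    ((1 / 2 : ℝ) • (memLp_coord hP j).toLp _)
  refine ⟨u, huK, fun i ζ ζ' h => ?_⟩
  let v : V := Pi.single i ⟨(ζ, ζ'), h⟩
  have hv1 : (fun k => (v k).1.1) = Pi.single i ζ := by
    ext k ω
    by_cases hk : k = i
    · subst hk
      simp [v]
    · simp [v, hk]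
  have hv2 : (fun k => (v k).1.2) = Pi.single i ζ' := by
    ext k ω
    by_cases hk : k = i
    · subst hk
      simp [v]
    · simp [v, hk]
  have hdivs : (divTest fun k => (v k).1.1)
      = fun ω => ζ (ω.shift 0 (-coordDir d i)) - ζ ω := by
    ext ω
    rw [hv1, divTest, Finset.sum_eq_single i]
    · simp
    · intro k _ hk
      simp [hk]
    · simp
  have huv := hu v
  rw [LinearMap.add_apply, LinearMap.smul_apply, inner_add_right, inner_smul_right,
    inner_smul_left] at huv
  have e1 : inner ℝ u (D v) = ∫ ω, u (ω, coordDir d i) * ζ' ω ∂P := by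
    refine (inner_dirField hP u (fun i => (hpair v i).measurable')
      fun i => (hpair v i).bounded').trans ?_
    have : ∀ k, (v k).1.2 = (Pi.single i ζ' : Fin d → Env d → ℝ) k := fun k => congrFun hv2 k
    simp only [this]
    rw [Finset.sum_eq_single i]
    · simp
    · intro k _ hk
      simp [hk]
    · simp
  have e2 : inner ℝ ((memLp_coord hP j).toLp _ - u) (J v)
      = ∑ z ∈ latticeBall (0 : Fin d → ℤ) 1, ∫ ω, ω.cond 0 0 z * (((z j : ℝ) - u (ω, z)) *
        horizGrad (fun ω => ζ (ω.shift 0 (-coordDir d i)) - ζ ω) (ω, z)) ∂P := by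
    refine (inner_toLp_gradMeasure hP _
      (memLp_horizGrad hP (hdiv v).measurable (hdiv v).bounded)).trans ?_
    rw [hdivs]
    refine Finset.sum_congr rfl fun z _ => ?_
    by_cases hz : (latticeGraph d).Adj 0 z
    · refine integral_congr_ae ?_
      filter_upwards [(ae_gradMeasure_iff hP).1 (Lp.coeFn_sub ((memLp_coord hP j).toLp _) u) z hz,
        (ae_gradMeasure_iff hP).1 (memLp_coord hP j).coeFn_toLp z hz] with ω h1 h2
      rw [h1, Pi.sub_apply, h2]
    · simp [Env.cond_eq_zero _ _ hz]
  rw [← e2, inner_sub_left, ← e1]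
  simp only [conj_trivial] at huv
  linarith

end WeakEquation

/-! ### Extensions of potential fields -/

/-- Induction on the lattice along the coordinate directions. -/
theorem lattice_induction {d : ℕ} {p : (Fin d → ℤ) → Prop} (h0 : p 0)
    (hadd : ∀ x i, p x → p (x + coordDir d i)) (hsub : ∀ x i, p x → p (x - coordDir d i))
    (x : Fin d → ℤ) : p x := by
  have hline : ∀ (n : ℤ) (i : Fin d) (y : Fin d → ℤ), p y → p (y + n • coordDir d i) := by
    intro n i y hy
    induction n using Int.induction_on with
    | zero => simpa using hy
    | succ k ih =>
      rw [add_smul, one_smul, ← add_assoc]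
      exact hadd _ i ih
    | pred k ih =>
      rw [sub_smul, one_smul, ← add_sub_assoc]
      exact hsub _ i ih
  have hx : x = ∑ i, x i • coordDir d i := by
    ext k
    simp [coordDir, Finset.sum_apply, Pi.single_apply]
  rw [hx]
  have : ∀ s : Finset (Fin d), p (∑ i ∈ s, x i • coordDir d i) := by
    intro s
    induction s using Finset.induction_on with
    | empty => simpa using h0
    | insert a s ha ih =>
      rw [Finset.sum_insert ha, add_comm]
      exact hline _ _ _ ih
  exact this Finset.univ

theorem latticeGraph_reachable_zero {d : ℕ} (x : Fin d → ℤ) : (latticeGraph d).Reachable 0 x := by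
  have hadj : ∀ (y : Fin d → ℤ) i, (latticeGraph d).Adj y (y + coordDir d i) := fun y i => by
    have := (latticeGraph_adj_add 0 (coordDir d i) y).2 (adj_coordDir i)
    rwa [zero_add, add_comm] at this
  refine lattice_induction (SimpleGraph.Reachable.refl _) (fun y i h => ?_) (fun y i h => ?_) x
  · exact h.trans (hadj y i).reachable
  · have := hadj (y - coordDir d i) i
    rw [sub_add_cancel] at this
    exact h.trans this.symm.reachable

/-- The L¹ errors are summable, so the sum of the pointwise errors is a.e. finite and its terms tend
to zero. -/
theorem ae_tendsto_of_integral_abs_sub_le {α : Type*} [MeasurableSpace α] {μ : Measure α}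
    {f : ℕ → α → ℝ} {g : α → ℝ} (hi : ∀ k, Integrable (fun a => g a - f k a) μ)
    (h : ∀ k, ∫ a, |g a - f k a| ∂μ ≤ (1 / 2) ^ k) :
    ∀ᵐ a ∂μ, Tendsto (fun k => f k a) atTop (𝓝 (g a)) := by
  have h1 : ∫⁻ a, ∑' k, ‖g a - f k a‖ₑ ∂μ ≠ ∞ := by
    rw [lintegral_tsum fun k => (hi k).aestronglyMeasurable.enorm]
    refine ne_top_of_le_ne_top (b := ∑' k : ℕ, ENNReal.ofReal ((1 / 2) ^ k)) ?_
      (ENNReal.tsum_le_tsum fun k => ?_)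
    · rw [← ENNReal.ofReal_tsum_of_nonneg (fun k => by positivity) summable_geometric_two]
      exact ENNReal.ofReal_ne_top
    · rw [← ofReal_integral_norm_eq_lintegral_enorm (hi k)]
      exact ENNReal.ofReal_le_ofReal (h k)
  have h2 := ae_lt_top' (AEMeasurable.tsum
    fun k => (hi k).aestronglyMeasurable.enorm) h1
  filter_upwards [h2] with a ha
  have h3 := ENNReal.tendsto_atTop_zero_of_tsum_ne_top ha.ne
  rw [tendsto_iff_edist_tendsto_0]
  refine h3.congr fun k => ?_
  rw [edist_comm, edist_eq_enorm_sub]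

section Extension

variable {d : ℕ} [MeasurableSpace (Env d)] {P : Measure (Env d)}

/-- Pointwise limits of true gradients inherit path independence. This is what makes a potential
field, defined only on edges, extend to a cocycle. -/
theorem exists_gradient_tendsto [IsProbabilityMeasure P] (hP : StationaryErgodicLaw P)
    {u : Lp ℝ 2 (gradMeasure P)} (hu : u ∈ L2pot P) :
    ∃ φ : ℕ → Env d → ℝ, (∀ k, Measurable (φ k)) ∧
      ∀ᵐ ω ∂P, ∀ x y, (latticeGraph d).Adj x y →
        Tendsto (fun k => φ k (ω.shift 0 y) - φ k (ω.shift 0 x)) atTop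
          (𝓝 (u (ω.shift 0 x, y - x))) := by
  choose φ hm hb h using fun k : ℕ => exists_gradient_approx hP hu (ε := (1 / 2) ^ k)
    (by positivity)
  refine ⟨φ, hm, ?_⟩
  have h1 : ∀ᵐ ω ∂P, ∀ z, (latticeGraph d).Adj 0 z →
      Tendsto (fun k => horizGrad (φ k) (ω, z)) atTop (𝓝 (u (ω, z))) := by
    refine ae_all_iff.2 fun z => ?_
    by_cases hz : (latticeGraph d).Adj 0 z
    · filter_upwards [ae_tendsto_of_integral_abs_sub_le (fun k => (integrable_Lp_component hP u
        hz).sub ((hP.integrable_comp_shift (IsTestPair.integrable (hm k) (hb k)) 0 z).sub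
        (IsTestPair.integrable (hm k) (hb k)))) fun k => h k z hz] with ω hω _ using hω
    · exact Eventually.of_forall fun _ hz' => absurd hz' hz
  filter_upwards [hP.ae_shift h1] with ω hω x y hxy
  have hadj : (latticeGraph d).Adj 0 (y - x) := by
    rw [← latticeGraph_adj_add _ _ x]
    simpa using hxy
  simpa only [horizGrad, Env.shift_shift, add_zero, sub_add_cancel] using hω x (y - x) hadj

/-- The extension of a potential field. -/
theorem exists_extension [IsProbabilityMeasure P] (hP : StationaryErgodicLaw P)
    {u : Lp ℝ 2 (gradMeasure P)} (hu : u ∈ L2pot P) :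
    ∃ U : Env d → (Fin d → ℤ) → ℝ, (∀ x, Measurable fun ω => U ω x) ∧ IsExtension P u U ∧
      (∀ᵐ ω ∂P, IsCocycleAt U ω) ∧ ∀ᵐ ω ∂P, ∀ z, (latticeGraph d).Adj 0 z → U ω z = u (ω, z) := by
  obtain ⟨φ, hm, h⟩ := exists_gradient_tendsto hP hu
  -- The limsup gives a measurable function on all environments; it is a limit on almost every one.
  set U : Env d → (Fin d → ℤ) → ℝ := fun ω x =>
    limsup (fun k => φ k (ω.shift 0 x) - φ k ω) atTop with hU
  have hUm : ∀ x, Measurable fun ω => U ω x := fun x =>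
    Measurable.limsup fun k => ((hm k).comp (hP.measurable_shift_fixed 0 x)).sub (hm k)
  -- The differences of φ telescope along a walk, so the sum of `u` along it depends only on the
  -- endpoints.
  have hwalk : ∀ᵐ ω ∂P, ∀ (x y : Fin d → ℤ) (w : (latticeGraph d).Walk x y),
      Tendsto (fun k => φ k (ω.shift 0 y) - φ k (ω.shift 0 x)) atTop
        (𝓝 (w.darts.map fun a => u (ω.shift 0 a.fst, a.snd - a.fst)).sum) := by
    filter_upwards [h] with ω hω x y w
    induction w with
    | nil => simp
    | cons hxy w ih =>
      rw [SimpleGraph.Walk.darts_cons, List.map_cons, List.sum_cons]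
      refine ((hω _ _ hxy).add ih).congr fun k => ?_
      ring
  have hext : IsExtension P u U := by
    filter_upwards [hwalk] with ω hω x w
    have := hω 0 x w
    simp only [Env.shift_zero] at this
    exact this.limsup_eq
  refine ⟨U, hUm, hext, ?_, ?_⟩
  · filter_upwards [hwalk] with ω hω x y
    have hlim : ∀ x y, ∃ l, Tendsto (fun k => φ k (ω.shift 0 y) - φ k (ω.shift 0 x)) atTop (𝓝 l) :=
      fun x y => by
        obtain ⟨w⟩ := (latticeGraph_reachable_zero x).symm.trans (latticeGraph_reachable_zero y)
        exact ⟨_, hω x y w⟩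
    obtain ⟨l, hl⟩ := hlim 0 x
    obtain ⟨m, hm'⟩ := hlim 0 y
    simp only [Env.shift_zero] at hl hm'
    simp only [hU, Env.shift_shift, add_zero, sub_add_cancel]
    rw [hl.limsup_eq, hm'.limsup_eq]
    refine ((hm'.sub hl).congr fun k => ?_).limsup_eq
    ring
  · filter_upwards [hext] with ω hω z hz
    rw [hω z hz.toWalk]
    simp [SimpleGraph.Adj.toWalk]

end Extension

/-! ### From the weak to the strong equation -/

section StrongEquation

variable {d : ℕ} [MeasurableSpace (Env d)] {P : Measure (Env d)}

theorem integrable_drift {Φ : Env d → (Fin d → ℤ) → ℝ} (hF : ∀ z, Integrable (flux Φ z) P) :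
    Integrable (drift Φ) P :=
  integrable_finsetSum _ fun z _ => hF z

/-- Summation by parts for the drift of a cocycle. -/
theorem sum_integral_flux_mul_horizGrad (hP : StationaryErgodicLaw P)
    {Φ : Env d → (Fin d → ℤ) → ℝ} (hc : ∀ᵐ ω ∂P, IsCocycleAt Φ ω)
    (hF : ∀ z, Integrable (flux Φ z) P) {η : Env d → ℝ} (hm : Measurable η)
    (hb : ∃ C, ∀ ω, |η ω| ≤ C) :
    ∑ z ∈ latticeBall (0 : Fin d → ℤ) 1, ∫ ω, flux Φ z ω * horizGrad η (ω, z) ∂P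
      = -2 * ∫ ω, drift Φ ω * η ω ∂P := by
  have hm' : ∀ z : Fin d → ℤ, Measurable fun ω : Env d => η (ω.shift 0 z) := fun z =>
    hm.comp (hP.measurable_shift_fixed 0 z)
  have hb' : ∀ z : Fin d → ℤ, ∃ C, ∀ ω : Env d, |η (ω.shift 0 z)| ≤ C := fun z => by
    obtain ⟨C, hC⟩ := hb
    exact ⟨C, fun ω => hC _⟩
  have hi1 : ∀ z, Integrable (fun ω => flux Φ z ω * η (ω.shift 0 z)) P := fun z =>
    IsTestPair.integrable_mul (hm' z) (hb' z) (hF z)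
  have hi2 : ∀ z, Integrable (fun ω => flux Φ z ω * η ω) P := fun z =>
    IsTestPair.integrable_mul hm hb (hF z)
  have hi3 : ∀ z, Integrable (fun ω => flux Φ z (ω.shift 0 (-z)) * η ω) P := fun z =>
    IsTestPair.integrable_mul hm hb (hP.integrable_comp_shift (hF z) 0 (-z))
  have h1 : ∀ z, ∫ ω, flux Φ z ω * horizGrad η (ω, z) ∂P
      = ∫ ω, (flux Φ z (ω.shift 0 (-z)) - flux Φ z ω) * η ω ∂P := by
    intro z
    have h2 := hP.integral_comp_shift (hi1 z).aestronglyMeasurable 0 (-z)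
    simp only [Env.shift_shift, add_zero, add_neg_cancel, Env.shift_zero] at h2
    simp only [horizGrad, mul_sub, sub_mul]
    rw [integral_sub (hi1 z) (hi2 z), integral_sub (hi3 z) (hi2 z), h2]
  rw [Finset.sum_congr rfl fun z _ => h1 z, ← integral_const_mul,
    ← integral_finsetSum (f := fun z ω => (flux Φ z (ω.shift 0 (-z)) - flux Φ z ω) * η ω) _
      fun z _ => ((hi3 z).sub (hi2 z)).congr (Eventually.of_forall fun ω => (sub_mul _ _ _).symm)]
  refine integral_congr_ae ?_
  filter_upwards [hc] with ω hω
  rw [drift_eq_half_sum hω, ← Finset.sum_mul]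
  have : ∑ z ∈ latticeBall (0 : Fin d → ℤ) 1, (flux Φ z (ω.shift 0 (-z)) - flux Φ z ω)
      = -∑ z ∈ latticeBall (0 : Fin d → ℤ) 1, (flux Φ z ω - flux Φ z (ω.shift 0 (-z))) := by
    rw [← Finset.sum_neg_distrib]
    simp only [neg_sub]
  rw [this]
  ring

/-- Time averages of bounded functions are test functions. -/
theorem isTestPair_timeAverage (hP : StationaryErgodicLaw P) {f : Env d → ℝ} (hm : Measurable f)
    (hb : ∃ C, ∀ ω, |f ω| ≤ C) (a : ℝ) :
    IsTestPair (fun ω => ∫ s in (0 : ℝ)..a, f (ω.shift (-s) 0))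
      (fun ω => f ω - f (ω.shift (-a) 0)) := by
  obtain ⟨C, hC⟩ := hb
  have hii : ∀ (ω : Env d) a b, IntervalIntegrable (fun s => f (ω.shift s 0)) volume a b :=
    fun ω a b => hP.intervalIntegrable_of_bounded hm hC ω 0 a b
  have hζ : ∀ ω : Env d, ∫ s in (0 : ℝ)..a, f (ω.shift (-s) 0)
      = ∫ s in (-a)..0, f (ω.shift s 0) := by
    intro ω
    rw [intervalIntegral.integral_comp_neg fun s => f (ω.shift s 0), neg_zero]
  refine ⟨?_, hm.sub (hm.comp (hP.measurable_shift_fixed _ 0)), ⟨C * |a|, fun ω => ?_⟩,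
    ⟨C + C, fun ω => (abs_sub _ _).trans (add_le_add (hC _) (hC _))⟩, fun ω t => ?_⟩
  · have h1 : Measurable fun p : Env d × ℝ => f (p.1.shift (-p.2) 0) :=
      hm.comp ((hP.measurable_shift_time 0).comp (measurable_fst.prodMk measurable_snd.neg))
    simp only [intervalIntegral]
    exact (h1.stronglyMeasurable.integral_prod_right' (ν := volume.restrict (Set.Ioc 0 a))).sub
      (h1.stronglyMeasurable.integral_prod_right' (ν := volume.restrict (Set.Ioc a 0)))
      |>.measurable
  · have := intervalIntegral.norm_integral_le_of_norm_le_const (a := 0) (b := a) (C := C)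
      (f := fun s => f (ω.shift (-s) 0)) fun s _ => hC _
    simpa using this
  · have h1 : IntervalIntegrable (fun s => f (ω.shift (-a + s) 0)) volume 0 t := by
      simpa only [Env.shift_shift, add_zero, add_comm _ (-a)] using hii (ω.shift (-a) 0) 0 t
    rw [hζ, hζ]
    simp only [Env.shift_shift, add_zero]
    rw [intervalIntegral.integral_comp_add_right fun s => f (ω.shift s 0),
      intervalIntegral.integral_sub (hii ω 0 t) h1,
      intervalIntegral.integral_comp_add_left fun s => f (ω.shift s 0), zero_add, add_zero]
    have h2 := intervalIntegral.integral_add_adjacent_intervals (hii ω (-a) 0) (hii ω 0 t)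
    have h3 := intervalIntegral.integral_add_adjacent_intervals (hii ω (-a) (-a + t))
      (hii ω (-a + t) t)
    linarith

theorem integrable_intervalIntegral_shift [IsProbabilityMeasure P] (hP : StationaryErgodicLaw P)
    {H : Env d → ℝ} (hH : Integrable H P) {a : ℝ} (ha : 0 ≤ a) :
    Integrable (fun ω => ∫ s in (0 : ℝ)..a, H (ω.shift s 0)) P := by
  simp only [intervalIntegral.integral_of_le ha]
  exact (hP.integrable_prod_shift hH 0 (I := Set.Ioc 0 a) (by simp)).integral_prod_left

/-- A weak time derivative gives increments. -/
theorem sub_shift_eq_integral_of_weak [IsProbabilityMeasure P] (hP : StationaryErgodicLaw P)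
    {F H : Env d → ℝ} (hF : Integrable F P) (hH : Integrable H P)
    (h : ∀ ζ ζ', IsTestPair ζ ζ' → ∫ ω, F ω * ζ' ω ∂P = ∫ ω, H ω * ζ ω ∂P) {a : ℝ} (ha : 0 ≤ a) :
    ∀ᵐ ω ∂P, F ω - F (ω.shift a 0) = ∫ s in (0 : ℝ)..a, H (ω.shift s 0) := by
  have hFa := hP.integrable_comp_shift hF a 0
  have hI := integrable_intervalIntegral_shift hP hH ha
  refine Integrable.ae_eq_of_forall_setIntegral_eq _ _ (hF.sub hFa) hI fun A hA _ => ?_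
  set f : Env d → ℝ := A.indicator fun _ => 1 with hf
  have hfm : Measurable f := measurable_const.indicator hA
  have hfC : ∀ ω, |f ω| ≤ 1 := fun ω => by
    by_cases hω : ω ∈ A <;> simp [hf, hω]
  have hfb : ∃ C, ∀ ω, |f ω| ≤ C := ⟨1, hfC⟩
  have hmul : ∀ G : Env d → ℝ, ∫ ω in A, G ω ∂P = ∫ ω, G ω * f ω ∂P := by
    intro G
    rw [← integral_indicator hA]
    refine integral_congr_ae (Eventually.of_forall fun ω => ?_)
    by_cases hω : ω ∈ A <;> simp [hf, hω]
  rw [hmul, hmul]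
  have hsh : ∀ G : Env d → ℝ, Integrable G P → ∀ s : ℝ,
      ∫ ω, G ω * f (ω.shift (-s) 0) ∂P = ∫ ω, G (ω.shift s 0) * f ω ∂P := by
    intro G hG s
    have h1 := hP.integral_comp_shift (IsTestPair.integrable_mul
      (hfm.comp (hP.measurable_shift_fixed (-s) 0)) ⟨1, fun ω => hfC _⟩ hG).aestronglyMeasurable s 0
    simp only [Function.comp_apply, Env.shift_shift, add_zero, neg_add_cancel,
      Env.shift_zero] at h1
    exact h1.symm
  -- Testing with the time average of the indicator of `A` replaces the derivative by the increment
  -- f - f ∘ τ_{-a}. Stationarity then moves all shifts from `f` to `F` and `H`.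
  have hw := h _ _ (isTestPair_timeAverage hP hfm hfb a)
  have e1 : ∫ ω, F ω * (f ω - f (ω.shift (-a) 0)) ∂P
      = ∫ ω, (F ω - F (ω.shift a 0)) * f ω ∂P := by
    simp only [mul_sub, sub_mul]
    have h1 : Integrable (fun ω => F ω * f (ω.shift (-a) 0)) P := IsTestPair.integrable_mul
      (hfm.comp (hP.measurable_shift_fixed (-a) 0)) ⟨1, fun ω => hfC _⟩ hF
    rw [integral_sub (IsTestPair.integrable_mul hfm hfb hF) h1,
      integral_sub (IsTestPair.integrable_mul hfm hfb hF) (IsTestPair.integrable_mul hfm hfb hFa),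
      hsh F hF]
  have e2 : ∫ ω, H ω * (∫ s in (0 : ℝ)..a, f (ω.shift (-s) 0)) ∂P
      = ∫ ω, (∫ s in (0 : ℝ)..a, H (ω.shift s 0)) * f ω ∂P := by
    have h1 : ∀ ω : Env d, H ω * (∫ s in (0 : ℝ)..a, f (ω.shift (-s) 0))
        = ∫ s in Set.Ioc 0 a, H ω * f (ω.shift (-s) 0) := fun ω => by
      rw [intervalIntegral.integral_of_le ha, integral_const_mul]
    have h2 : ∀ ω : Env d, (∫ s in (0 : ℝ)..a, H (ω.shift s 0)) * f ω
        = ∫ s in Set.Ioc 0 a, H (ω.shift s 0) * f ω := fun ω => by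
      rw [intervalIntegral.integral_of_le ha, integral_mul_const]
    simp only [h1, h2]
    have h3 : Integrable (Function.uncurry fun (ω : Env d) (s : ℝ) => H ω * f (ω.shift (-s) 0))
        (P.prod (volume.restrict (Set.Ioc 0 a))) :=
      (hH.comp_fst (ν := volume.restrict (Set.Ioc 0 a))).mul_bdd (c := 1)
        (hfm.comp ((hP.measurable_shift_time 0).comp
          (measurable_fst.prodMk measurable_snd.neg))).aestronglyMeasurable
        (Eventually.of_forall fun p => hfC _)
    have h4 : Integrable (Function.uncurry fun (ω : Env d) (s : ℝ) => H (ω.shift s 0) * f ω)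
        (P.prod (volume.restrict (Set.Ioc 0 a))) :=
      (hP.integrable_prod_shift hH 0 (I := Set.Ioc 0 a) (by simp)).mul_bdd (c := 1)
        (hfm.comp measurable_fst).aestronglyMeasurable (Eventually.of_forall fun p => hfC _)
    rw [integral_integral_swap h3, integral_integral_swap h4]
    exact integral_congr_ae (Eventually.of_forall fun s => hsh H hH s)
  rw [← e2, ← hw, ← e1]

theorem ae_sub_shift_eq_integral_of_weak [IsProbabilityMeasure P] (hP : StationaryErgodicLaw P)
    {F H : Env d → ℝ} (hF : Integrable F P) (hH : Integrable H P)
    (h : ∀ ζ ζ', IsTestPair ζ ζ' → ∫ ω, F ω * ζ' ω ∂P = ∫ ω, H ω * ζ ω ∂P) (a : ℝ) :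
    ∀ᵐ ω ∂P, F ω - F (ω.shift a 0) = ∫ s in (0 : ℝ)..a, H (ω.shift s 0) := by
  rcases le_total 0 a with ha | ha
  · exact sub_shift_eq_integral_of_weak hP hF hH h ha
  -- For negative `a`, the identity for `-a` is read from the environment shifted by `a`.
  · have h1 := sub_shift_eq_integral_of_weak hP hF hH h (neg_nonneg.2 ha)
    filter_upwards [(hP.measurePreserving a 0).quasiMeasurePreserving.ae h1] with ω hω
    simp only [Env.shift_shift, add_zero, neg_add_cancel, Env.shift_zero] at hω
    rw [intervalIntegral.integral_comp_add_right fun s => H (ω.shift s 0), zero_add,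
      neg_add_cancel, intervalIntegral.integral_symm] at hω
    linarith

/-- The increments along almost every trajectory, at almost all times. -/
theorem ae_ae_shift_eq_of_weak [IsProbabilityMeasure P] (hP : StationaryErgodicLaw P)
    {F H : Env d → ℝ} (hFm : Measurable F) (hF : Integrable F P) (hH : Integrable H P)
    (h : ∀ ζ ζ', IsTestPair ζ ζ' → ∫ ω, F ω * ζ' ω ∂P = ∫ ω, H ω * ζ ω ∂P) :
    ∀ᵐ ω ∂P, ∀ᵐ t : ℝ, F (ω.shift t 0) = F ω - ∫ s in (0 : ℝ)..t, H (ω.shift s 0) := by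
  obtain ⟨H', hH'm, hHH'⟩ := hH.aestronglyMeasurable
  have hI : ∀ᵐ ω ∂P, ∀ t, ∫ s in (0 : ℝ)..t, H (ω.shift s 0)
      = ∫ s in (0 : ℝ)..t, H' (ω.shift s 0) := by
    filter_upwards [hP.ae_ae_shift hHH'] with ω hω t
    refine intervalIntegral.integral_congr_ae ?_
    filter_upwards [hω] with s hs _ using hs 0
  -- Rescaling to [0, 1] removes the moving endpoint, so the integral is jointly measurable in (ω,
  -- t), as the exchange of null sets below requires.
  have hI' : ∀ (ω : Env d) (t : ℝ), ∫ s in (0 : ℝ)..t, H' (ω.shift s 0)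
      = t * ∫ r in (0 : ℝ)..1, H' (ω.shift (r * t) 0) := by
    intro ω t
    have := intervalIntegral.smul_integral_comp_mul_right (a := 0) (b := 1)
      (fun s => H' (ω.shift s 0)) t
    rw [zero_mul, one_mul, smul_eq_mul] at this
    exact this.symm
  have hjoint : Measurable fun p : Env d × ℝ => ∫ s in (0 : ℝ)..p.2, H' (p.1.shift s 0) := by
    simp only [hI', intervalIntegral.integral_of_le zero_le_one]
    refine measurable_snd.mul ?_
    have h1 : Measurable fun q : (Env d × ℝ) × ℝ => H' (q.1.1.shift (q.2 * q.1.2) 0) :=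
      hH'm.measurable.comp ((hP.measurable_shift_time 0).comp
        ((measurable_fst.comp measurable_fst).prodMk
          (measurable_snd.mul (measurable_snd.comp measurable_fst))))
    exact (h1.stronglyMeasurable.integral_prod_right'
      (ν := volume.restrict (Set.Ioc 0 1))).measurable
  have hset : MeasurableSet {p : Env d × ℝ |
      F (p.1.shift p.2 0) = F p.1 - ∫ s in (0 : ℝ)..p.2, H' (p.1.shift s 0)} :=
    measurableSet_eq_fun (hFm.comp (hP.measurable_shift_time 0))
      ((hFm.comp measurable_fst).sub hjoint)
  have h1 : ∀ᵐ t : ℝ, ∀ᵐ ω ∂P,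
      F (ω.shift t 0) = F ω - ∫ s in (0 : ℝ)..t, H' (ω.shift s 0) := by
    refine Eventually.of_forall fun t => ?_
    filter_upwards [ae_sub_shift_eq_integral_of_weak hP hF hH h t, hI] with ω h2 h3
    rw [← h3]
    linarith
  have h2 := (Measure.ae_ae_comm (μ := P) (ν := volume)
    (p := fun ω t => F (ω.shift t 0) = F ω - ∫ s in (0 : ℝ)..t, H' (ω.shift s 0)) hset).2 h1
  filter_upwards [h2, hI] with ω h3 h4
  filter_upwards [h3] with t h5
  rw [h4, h5]

/-- The weak equation for a cocycle implies the strong one, at almost all times. -/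
theorem ae_ae_cocycle_shift_eq [IsProbabilityMeasure P] (hP : StationaryErgodicLaw P)
    {Φ : Env d → (Fin d → ℤ) → ℝ} (hm : ∀ x, Measurable fun ω => Φ ω x)
    (hc : ∀ᵐ ω ∂P, IsCocycleAt Φ ω) (hΦ : ∀ i, Integrable (fun ω => Φ ω (coordDir d i)) P)
    (hF : ∀ z, Integrable (flux Φ z) P)
    (hw : ∀ (i : Fin d) (ζ ζ' : Env d → ℝ), IsTestPair ζ ζ' →
      ∑ z ∈ latticeBall (0 : Fin d → ℤ) 1, ∫ ω, flux Φ z ω *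
        horizGrad (fun ω => ζ (ω.shift 0 (-coordDir d i)) - ζ ω) (ω, z) ∂P
        = -2 * ∫ ω, Φ ω (coordDir d i) * ζ' ω ∂P) :
    ∀ᵐ ω ∂P, ∀ᵐ t : ℝ, ∀ x, Φ (ω.shift t 0) x
      = Φ ω x - ((∫ s in (0 : ℝ)..t, drift Φ (ω.shift s x))
        - ∫ s in (0 : ℝ)..t, drift Φ (ω.shift s 0)) := by
  have hG := integrable_drift hF
  have hH : ∀ i, Integrable (fun ω => drift Φ (ω.shift 0 (coordDir d i)) - drift Φ ω) P := fun i =>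
    (hP.integrable_comp_shift hG 0 _).sub hG
  -- Summation by parts in space turns the flux term into the drift, and moving the shift by -e_i
  -- off ζ yields the increment of the drift across the edge e_i.
  have hweak : ∀ (i : Fin d) ζ ζ', IsTestPair ζ ζ' → ∫ ω, Φ ω (coordDir d i) * ζ' ω ∂P
      = ∫ ω, (drift Φ (ω.shift 0 (coordDir d i)) - drift Φ ω) * ζ ω ∂P := by
    intro i ζ ζ' h
    have hη := h.sub_shift hP (-coordDir d i)
    have hsh := h.comp_shift hP (-coordDir d i)
    have h1 := hw i ζ ζ' h
    rw [sum_integral_flux_mul_horizGrad hP hc hF hη.measurable hη.bounded] at h1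
    have i1 := IsTestPair.integrable_mul hsh.measurable hsh.bounded hG
    have i2 := IsTestPair.integrable_mul h.measurable h.bounded hG
    have i3 := IsTestPair.integrable_mul h.measurable h.bounded
      (hP.integrable_comp_shift hG 0 (coordDir d i))
    have h2 := hP.integral_comp_shift i1.aestronglyMeasurable 0 (coordDir d i)
    simp only [Env.shift_shift, add_zero, neg_add_cancel, Env.shift_zero] at h2
    simp only [mul_sub, sub_mul] at h1 ⊢
    rw [integral_sub i1 i2] at h1
    rw [integral_sub i3 i2]
    linarith
  have h1 : ∀ᵐ ω ∂P, ∀ i, ∀ᵐ t : ℝ, Φ (ω.shift t 0) (coordDir d i) = Φ ω (coordDir d i)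
      - ∫ s in (0 : ℝ)..t, (drift Φ ((ω.shift s 0).shift 0 (coordDir d i))
        - drift Φ (ω.shift s 0)) :=
    ae_all_iff.2 fun i => ae_ae_shift_eq_of_weak hP (F := fun ω => Φ ω (coordDir d i))
      (H := fun ω => drift Φ (ω.shift 0 (coordDir d i)) - drift Φ ω) (hm _) (hΦ i) (hH i) (hweak i)
  filter_upwards [hP.ae_shift h1, hc, hP.ae_ae_shift hc, hP.ae_intervalIntegrable hG]
    with ω h2 h3 h4 h5
  filter_upwards [h4, ae_all_iff.2 fun y => ae_all_iff.2 (h2 y)] with t h6 h7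
  have hco : IsCocycleAt Φ (ω.shift t 0) := h6 0
  have hstep : ∀ x i, Φ (ω.shift t 0) (x + coordDir d i) - Φ (ω.shift t 0) x
      = Φ ω (x + coordDir d i) - Φ ω x
        - ((∫ s in (0 : ℝ)..t, drift Φ (ω.shift s (x + coordDir d i)))
          - ∫ s in (0 : ℝ)..t, drift Φ (ω.shift s x)) := by
    intro x i
    have h8 := h7 x i
    simp only [Env.shift_shift, add_zero, zero_add] at h8
    rw [hco.apply_shift_add, h3.apply_add, add_comm (coordDir d i) x,
      intervalIntegral.integral_sub (h5 _ _ _) (h5 _ _ _)] at h8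
    exact h8
  refine lattice_induction ?_ (fun x i ih => ?_) (fun x i ih => ?_)
  · rw [hco.apply_zero, h3.apply_zero]
    simp
  · linarith [hstep x i]
  · have := hstep (x - coordDir d i) i
    rw [sub_add_cancel] at this
    linarith

end StrongEquation

/-! ### A representative with regular trajectories -/

/-- Averages over intervals shrinking to t from the right. They ignore null sets of times but
recover the value of a continuous function. -/
theorem tendsto_integral_comp_div {g : ℝ → ℝ} (hg : Continuous g) (t : ℝ) :
    Tendsto (fun n : ℕ => ∫ r in (0 : ℝ)..1, g (t + 1 / ((n : ℝ) + 1) * r)) atTop (𝓝 (g t)) := by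
  have hc : Continuous fun c : ℝ => ∫ r in (0 : ℝ)..1, g (t + c * r) :=
    intervalIntegral.continuous_parametric_intervalIntegral_of_continuous'
      (f := fun c r => g (t + c * r)) (by fun_prop) 0 1
  have h1 := hc.tendsto 0
  simp only [zero_mul, add_zero, intervalIntegral.integral_const, sub_zero, one_smul] at h1
  exact h1.comp tendsto_one_div_add_atTop_nhds_zero_nat

section Representative

variable {d : ℕ} [MeasurableSpace (Env d)] {P : Measure (Env d)}

/-- A cocycle that solves the equation at almost all times has a version that solves it at all
times. -/
theorem exists_regular_version [IsProbabilityMeasure P] (hP : StationaryErgodicLaw P)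
    {Φ : Env d → (Fin d → ℤ) → ℝ} {G : Env d → ℝ} (hm : ∀ x, Measurable fun ω => Φ ω x)
    (hG : Integrable G P)
    (h : ∀ᵐ ω ∂P, ∀ᵐ t : ℝ, ∀ x, Φ (ω.shift t 0) x
      = Φ ω x - ((∫ s in (0 : ℝ)..t, G (ω.shift s x)) - ∫ s in (0 : ℝ)..t, G (ω.shift s 0))) :
    ∃ Ψ : Env d → (Fin d → ℤ) → ℝ, (∀ x, Measurable fun ω => Ψ ω x) ∧
      ∀ᵐ ω ∂P, ∀ (t : ℝ) x, Ψ (ω.shift t 0) x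
        = Φ ω x - ((∫ s in (0 : ℝ)..t, G (ω.shift s x))
          - ∫ s in (0 : ℝ)..t, G (ω.shift s 0)) := by
  -- A version depending on the environment alone: evaluated at the environment shifted by t, it
  -- reads the averages just after t. These agree with those of the continuous right-hand side, so
  -- the identity holds at every t.
  refine ⟨fun ω x => limsup (fun n : ℕ => ∫ r in (0 : ℝ)..1,
    Φ (ω.shift (1 / ((n : ℝ) + 1) * r) 0) x) atTop, fun x => ?_, ?_⟩
  · refine Measurable.limsup fun n => ?_
    have h1 : Measurable fun p : Env d × ℝ => Φ (p.1.shift (1 / ((n : ℝ) + 1) * p.2) 0) x :=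
      (hm x).comp ((hP.measurable_shift_time 0).comp
        (measurable_fst.prodMk (measurable_snd.const_mul _)))
    simp only [intervalIntegral.integral_of_le zero_le_one]
    exact (h1.stronglyMeasurable.integral_prod_right'
      (ν := volume.restrict (Set.Ioc 0 1))).measurable
  · filter_upwards [h, hP.ae_intervalIntegrable hG] with ω h1 h2 t x
    set g : ℝ → ℝ := fun t => Φ ω x - ((∫ s in (0 : ℝ)..t, G (ω.shift s x))
      - ∫ s in (0 : ℝ)..t, G (ω.shift s 0)) with hg
    have hgc : Continuous g := continuous_const.sub
      ((intervalIntegral.continuous_primitive (fun a b => h2 x a b) 0).sub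
        (intervalIntegral.continuous_primitive (fun a b => h2 0 a b) 0))
    refine ((tendsto_integral_comp_div hgc t).congr fun n => ?_).limsup_eq
    have hn : (1 / ((n : ℝ) + 1)) ≠ 0 := by positivity
    simp only [Env.shift_shift, add_zero, add_comm _ t]
    rw [intervalIntegral.integral_comp_add_mul g hn,
      intervalIntegral.integral_comp_add_mul (fun s => Φ (ω.shift s 0) x) hn]
    congr 1
    refine intervalIntegral.integral_congr_ae ?_
    filter_upwards [h1] with s hs _ using (hs x).symm

theorem isL2Cov_of_integrable {Ψ : Env d → (Fin d → ℤ) → ℝ} (hm : ∀ x, Measurable fun ω => Ψ ω x)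
    (hc : ∀ᵐ ω ∂P, IsCocycleAt Ψ ω)
    (hi : ∀ z, Integrable (fun ω => ω.cond 0 0 z * Ψ ω z ^ 2) P) : IsL2Cov P Ψ := by
  refine ⟨hm, hc, ?_⟩
  have h1 : ∀ ω : Env d, ∑' x : Fin d → ℤ, ENNReal.ofReal (ω.cond 0 0 x * Ψ ω x ^ 2)
      = ∑ x ∈ latticeBall (0 : Fin d → ℤ) 1, ENNReal.ofReal (ω.cond 0 0 x * Ψ ω x ^ 2) := by
    intro ω
    refine tsum_eq_sum fun x hx => ?_
    rw [ω.cond_eq_zero 0 fun h => hx (mem_latticeBall_zero_one h)]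
    simp
  simp only [h1]
  rw [lintegral_finsetSum' _ fun z _ => (hi z).aemeasurable.ennreal_ofReal]
  exact ENNReal.sum_lt_top.2 fun z _ => (hi z).lintegral_lt_top

/-- The components of the harmonic coordinates. -/
theorem exists_harmonic_component [IsProbabilityMeasure P] (hP : StationaryErgodicLaw P)
    (j : Fin d) :
    ∃ Ψ : Env d → (Fin d → ℤ) → ℝ, IsL2Cov P Ψ ∧
      (∃ ψ ∈ L2pot P, IsExtension P ψ fun ω x => (x j : ℝ) - Ψ ω x) ∧
      ∀ᵐ ω ∂P, ∀ (t : ℝ) x, Ψ (ω.shift t 0) x = Ψ ω x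
        - ((∫ s in (0 : ℝ)..t, drift Ψ (ω.shift s x))
          - ∫ s in (0 : ℝ)..t, drift Ψ (ω.shift s 0)) := by
  obtain ⟨u, hu, hweak⟩ := exists_weak_solution hP j
  obtain ⟨U, hUm, hext, hUc, hUu⟩ := exists_extension hP hu
  set Φ : Env d → (Fin d → ℤ) → ℝ := fun ω x => (x j : ℝ) - U ω x with hΦ
  have hΦU : ∀ ω x, Φ ω x = (x j : ℝ) - U ω x := fun _ _ => rfl
  have hm : ∀ x, Measurable fun ω => Φ ω x := fun x => (hUm x).const_sub _
  have hc : ∀ᵐ ω ∂P, IsCocycleAt Φ ω := by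
    filter_upwards [hUc] with ω hω x y
    simp only [hΦ, hω x y, Pi.sub_apply]
    push_cast
    ring
  have hsq : ∀ z, Integrable (fun ω => ω.cond 0 0 z * Φ ω z ^ 2) P := by
    intro z
    by_cases hz : (latticeGraph d).Adj 0 z
    · refine (integrable_mul_sq_of_Lp hP ((memLp_coord hP j).toLp _ - u) hz).congr ?_
      filter_upwards [(ae_gradMeasure_iff hP).1 (Lp.coeFn_sub ((memLp_coord hP j).toLp _) u) z hz,
        (ae_gradMeasure_iff hP).1 (memLp_coord hP j).coeFn_toLp z hz, hUu] with ω h1 h2 h3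
      rw [h1, Pi.sub_apply, h2, hΦU, h3 z hz]
    · simp [Env.cond_eq_zero _ _ hz]
  have hF : ∀ z, Integrable (flux Φ z) P := fun z =>
    integrable_flux_of_integrable_mul_sq hP (hm z).aestronglyMeasurable (hsq z)
  have hΦi : ∀ i, Integrable (fun ω => Φ ω (coordDir d i)) P := fun i =>
    integrable_of_integrable_mul_sq hP (adj_coordDir i) (hm _).aestronglyMeasurable (hsq _)
  have hw : ∀ (i : Fin d) (ζ ζ' : Env d → ℝ), IsTestPair ζ ζ' →
      ∑ z ∈ latticeBall (0 : Fin d → ℤ) 1, ∫ ω, flux Φ z ω *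
        horizGrad (fun ω => ζ (ω.shift 0 (-coordDir d i)) - ζ ω) (ω, z) ∂P
        = -2 * ∫ ω, Φ ω (coordDir d i) * ζ' ω ∂P := by
    intro i ζ ζ' hζ
    -- A time derivative has mean zero, so the deterministic part x_j drops from the time term and
    -- `u` may be replaced by -Φ there.
    have h1 : ∫ ω, ζ' ω ∂P = 0 := by
      have h2 := hP.integral_intervalIntegral_shift (IsTestPair.integrable (P := P) hζ.measurable'
        hζ.bounded') 0 (a := 0) (b := 1) zero_le_one
      have h3 := IsTestPair.integrable (P := P) hζ.measurable hζ.bounded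
      simp only [← hζ.sub_eq] at h2
      rw [integral_sub (hP.integrable_comp_shift h3 1 0) h3,
        hP.integral_comp_shift h3.aestronglyMeasurable] at h2
      linarith
    have h2 : ∫ ω, Φ ω (coordDir d i) * ζ' ω ∂P = -∫ ω, u (ω, coordDir d i) * ζ' ω ∂P := by
      have h3 : ∫ ω, Φ ω (coordDir d i) * ζ' ω ∂P = ∫ ω, ((coordDir d i j : ℝ) * ζ' ω
          - u (ω, coordDir d i) * ζ' ω) ∂P := by
        refine integral_congr_ae ?_
        filter_upwards [hUu] with ω hω
        rw [hΦU, hω _ (adj_coordDir i)]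
        ring
      rw [h3, integral_sub ((IsTestPair.integrable hζ.measurable' hζ.bounded').const_mul _)
        (IsTestPair.integrable_mul hζ.measurable' hζ.bounded'
          (integrable_Lp_component hP u (adj_coordDir i))), integral_const_mul, h1]
      ring
    rw [h2]
    refine (Finset.sum_congr rfl fun z _ => ?_).trans ((hweak i ζ ζ' hζ).trans (by ring))
    by_cases hz : (latticeGraph d).Adj 0 z
    · refine integral_congr_ae ?_
      filter_upwards [hUu] with ω hω
      rw [flux, hΦU, hω z hz, mul_assoc]
    · simp [flux, Env.cond_eq_zero _ _ hz]
  obtain ⟨Ψ, hΨm, hΨ⟩ := exists_regular_version hP hm (integrable_drift hF)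
    (ae_ae_cocycle_shift_eq hP hm hc hΦi hF hw)
  -- Time zero of the identity: the regular version agrees with Φ almost surely, so integrability,
  -- the cocycle property and the extension property carry over.
  have heq : ∀ᵐ ω ∂P, Ψ ω = Φ ω := by
    filter_upwards [hΨ] with ω hω
    funext x
    simpa using hω 0 x
  refine ⟨Ψ, isL2Cov_of_integrable hΨm ?_ fun z => ?_, ⟨u, hu, ?_⟩, ?_⟩
  · filter_upwards [hP.ae_shift heq, hc] with ω h1 h2 x y
    have h3 := h1 0
    rw [Env.shift_zero] at h3
    rw [h1 x, h3]
    exact h2 x y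
  · refine (hsq z).congr ?_
    filter_upwards [heq] with ω hω
    rw [hω]
  · filter_upwards [heq, hext] with ω h1 h2 x w
    rw [h1, hΦU, sub_sub_cancel]
    exact h2 x w
  · have hdr : ∀ᵐ ω ∂P, drift Φ ω = drift Ψ ω := by
      filter_upwards [heq] with ω hω
      simp only [drift, flux, hω]
    filter_upwards [hΨ, heq, hP.ae_ae_shift hdr] with ω h1 h2 h3 t x
    have h4 : ∀ y, ∫ s in (0 : ℝ)..t, drift Φ (ω.shift s y)
        = ∫ s in (0 : ℝ)..t, drift Ψ (ω.shift s y) := fun y => by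
      refine intervalIntegral.integral_congr_ae ?_
      filter_upwards [h3] with s hs _ using hs y
    rw [h1, h2, h4, h4]

/-- The integral subtracted in `harmonicCoord` cancels the drift at the origin. Each coordinate is
thus its initial value minus the time integral of the drift seen from `x`, from which regularity and
the equation are read off. -/
theorem exists_generatesHarmonicCoord [IsProbabilityMeasure P] (hP : StationaryErgodicLaw P) :
    ∃ Φ₀ : Fin d → Env d → (Fin d → ℤ) → ℝ, GeneratesHarmonicCoord P Φ₀ := by
  choose Ψ hcov hpot hΨ using fun j => exists_harmonic_component hP j
  have hG : ∀ j, Integrable (drift (Ψ j)) P := fun j =>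
    integrable_drift fun z => (hcov j).integrable_flux hP z
  have hco : ∀ᵐ ω ∂P, ∀ᵐ t : ℝ, ∀ j, IsCocycleAt (Ψ j) (ω.shift t 0) := by
    filter_upwards [hP.ae_ae_shift (ae_all_iff.2 fun j => (hcov j).cocycle)] with ω hω
    filter_upwards [hω] with t ht using ht 0
  have hcoord : ∀ᵐ ω ∂P, ∀ j t x, harmonicCoord Ψ j ω t x
      = Ψ j ω x - ∫ s in (0 : ℝ)..t, drift (Ψ j) (ω.shift s x) := by
    filter_upwards [ae_all_iff.2 hΨ, hco] with ω h1 h2 j t x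
    have h3 : ∫ s in (0 : ℝ)..t, ω.gen s (Ψ j (ω.shift s 0)) 0
        = ∫ s in (0 : ℝ)..t, drift (Ψ j) (ω.shift s 0) := by
      refine intervalIntegral.integral_congr_ae ?_
      filter_upwards [h2] with s hs _
      simpa using gen_eq_drift (hs j) 0 0
    rw [harmonicCoord, h3, h1]
    ring
  have hii := ae_all_iff.2 fun j => hP.ae_intervalIntegrable (hG j)
  refine ⟨Ψ, hcov, hpot, ?_, ?_, ?_⟩
  · filter_upwards [hcoord, hii] with ω h1 h2 j x a b
    simp only [h1]
    have h3 : (fun t => Ψ j ω x - ∫ s in (0 : ℝ)..t, drift (Ψ j) (ω.shift s x))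
        = fun t => (Ψ j ω x - ∫ s in (0 : ℝ)..a, drift (Ψ j) (ω.shift s x))
          - ∫ s in a..t, drift (Ψ j) (ω.shift s x) := by
      funext t
      rw [← intervalIntegral.integral_add_adjacent_intervals (h2 j x 0 a) (h2 j x a t)]
      ring
    rw [h3]
    exact (LipschitzWith.const _).lipschitzOnWith.absolutelyContinuousOnInterval.sub
      ((h2 j x a b).absolutelyContinuousOnInterval_intervalIntegral (by simp))
  · filter_upwards [hcoord, hii, hco] with ω h1 h2 h3
    have h4 : ∀ j x, ∀ᵐ t : ℝ, HasDerivAt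
        (fun t => ∫ s in (0 : ℝ)..t, drift (Ψ j) (ω.shift s x)) (drift (Ψ j) (ω.shift t x)) t := by
      intro j x
      have hloc : LocallyIntegrable (fun s => drift (Ψ j) (ω.shift s x)) volume := by
        intro t
        refine ⟨Set.Ioc (t - 1) (t + 1), Ioc_mem_nhds (by linarith) (by linarith), ?_⟩
        exact (h2 j x (t - 1) (t + 1)).1
      filter_upwards [LocallyIntegrable.ae_hasDerivAt_integral hloc] with t ht using ht 0
    filter_upwards [ae_all_iff.2 fun j => ae_all_iff.2 (h4 j), h3] with t h5 h6 j x
    -- At a fixed time the coordinate is the cocycle minus a constant, the form in which the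
    -- generator is computed.
    have h7 : harmonicCoord Ψ j ω t = fun y => Ψ j (ω.shift t 0) y
        - ∫ s in (0 : ℝ)..t, ω.gen s (Ψ j (ω.shift s 0)) 0 := rfl
    rw [h7, gen_eq_drift (h6 j)]
    simp only [h1]
    exact (h5 j x).const_sub _
  · filter_upwards [hcoord, ae_all_iff.2 fun j => (hcov j).cocycle] with ω h1 h2 j
    rw [h1, intervalIntegral.integral_same, sub_zero]
    exact IsCocycleAt.apply_zero (h2 j)

end Representative

theorem proposition3p3 {d : ℕ} (hd : 2 ≤ d) [MeasurableSpace (Env d)] (P : Measure (Env d))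
    [IsProbabilityMeasure P] (hP : StationaryErgodicLaw P) :
    (∃ Φ₀ : Fin d → Env d → (Fin d → ℤ) → ℝ, GeneratesHarmonicCoord P Φ₀) ∧
    ∀ Φ₀ : Fin d → Env d → (Fin d → ℤ) → ℝ, GeneratesHarmonicCoord P Φ₀ →
      ∀ᵐ ω ∂P,
        (∀ (x : Fin d → ℤ) (a b : ℝ),
          IntervalIntegrable (fun t => ‖corrector Φ₀ ω t x‖) volume a b) ∧
        Tendsto (fun n : ℕ => 1 / (n : ℝ) ^ 3 *
            ∫ t in (0 : ℝ)..(n : ℝ) ^ 2,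
              1 / ((latticeBall (0 : Fin d → ℤ) n).card : ℝ) *
                ∑ x ∈ latticeBall (0 : Fin d → ℤ) n, ‖corrector Φ₀ ω t x‖)
          atTop (𝓝 0) :=
  ⟨exists_generatesHarmonicCoord hP, fun _ hΦ => hΦ.sublinear (by omega) hP⟩
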